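/- Let $\theta>0$, let $f:S^1\to\mathbb{C}$ be a real analytic function on the unit circle $S^1=\{z\in\mathbb{C}:|z|=1\}$, and let $x\in S^1$. Assume that one of the following holds: (a) $x$ is not a root of unity, $x$ is of finite type (that is, $x=e^{2\pi i t}$ and there are $K,\gamma>0$ such that $\operatorname{dist}(mt,\mathbb{Z})>K/|m|^{\gamma}$ for all $m\in\mathbb{Z}\setminus\{0\}$), and all zeros of $f$ on $S^1$ are roots of unity; or (b) $x$ is a root of unity of order $p$ and $f(x^m)\neq 0$ for all $1\le m\le p$. For a function $\varphi$ on $S^1$ write $\langle\varphi\rangle_x=\int_0^1\varphi(e^{2\pi i s})\,ds$ in case (a) and $\langle\varphi\rangle_x=\frac1p\sum_{m=1}^p\varphi(x^m)$ in case (b). Let $\log$ be the principal branch of the logarithm, with $\log(-y)=\log y+i\pi$ for $y>0$, and put $m(f)(x)=\langle\log f\rangle_x$. Endow the symmetric group $S_n$ with the Ewens measure $\mathbb{P}_\theta(\sigma)=\theta^{\ell(\sigma)}/\bigl(\theta(\theta+1)\cdots(\theta+n-1)\bigr)$, where $\ell(\sigma)$ is the number of cycles of $\sigma$ (fixed points included),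 let $C_m^{(n)}(\sigma)$ be the number of cycles of length $m$ of $\sigma$, and let $$w^n(f)(x)=\sum_{m=1}^n C_m^{(n)}\log\bigl(f(x^m)\bigr).$$ Let $\mathcal{N}$ be a complex normal random variable with mean $0$ whose real and imaginary part have covariance matrix $$\Sigma=\theta\begin{pmatrix}\langle(\log|f|)^2\rangle_x&\langle\log|f|\,\arg f\rangle_x\\ \langle\log|f|\,\arg f\rangle_x&\langle(\arg f)^2\rangle_x\end{pmatrix},\qquad \log|f|=\operatorname{Re}\log f,\quad \arg f=\operatorname{Im}\log f .$$ For random variables $X_1,X_2$ with values in $\mathbb{R}^d$, not necessarily defined on the same space, the weak Wasserstein distance is $\mathrm{d}_{wW}(X_1,X_2)=\sup_g\bigl|\mathbb{E}[g(X_1)]-\mathbb{E}[g(X_2)]\bigr|$, where $g$ ranges over all $g\in C^\infty(\mathbb{R}^d,\mathbb{R})$ all of whose first and second order partial derivatives are bounded by $1$ in absolute value on $\mathbb{R}^d$. Identify $\mathbb{C}$ with $\mathbb{R}^2$. Then, as $n\to\infty$, $$\mathrm{d}_{wW}\Bigl(\mathcal{N},\ \frac{w^n(f)(x)}{\sqrt{\log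 n}}-\theta\sqrt{\log n}\;m(f)(x)\Bigr)=O\bigl(\log^{-1/2}n\bigr).$$ -/

import Mathlib

open MeasureTheory ProbabilityTheory Filter
open scoped ENNReal

noncomputable section

namespace EwensCLT

/-! ### The Ewens measure and cycle counts -/

/-- The number of cycles of length `m` of `σ`, fixed points being cycles of length `1`. -/
def cycleCount {n : ℕ} (σ : Equiv.Perm (Fin n)) (m : ℕ) : ℕ := σ.partition.parts.count m

/-- The total number of cycles of `σ` (the length of its cycle type), fixed points included. -/
def numCycles {n : ℕ} (σ : Equiv.Perm (Fin n)) : ℕ := Multiset.card σ.partition.parts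

/-- The Ewens weight `θ ^ ℓ(σ) / (θ (θ + 1) ⋯ (θ + n - 1))`. -/
def ewensWeight (θ : ℝ) {n : ℕ} (σ : Equiv.Perm (Fin n)) : ℝ :=
  θ ^ numCycles σ / ∏ i ∈ Finset.range n, (θ + i)

/-- All subsets of the finite set of permutations are measurable. -/
instance permMeasurableSpace (n : ℕ) : MeasurableSpace (Equiv.Perm (Fin n)) := ⊤

/-- The Ewens measure with parameter `θ` on the symmetric group `S_n`. -/
def ewensMeasure (θ : ℝ) (n : ℕ) : Measure (Equiv.Perm (Fin n)) :=
  ∑ σ : Equiv.Perm (Fin n), ENNReal.ofReal (ewensWeight θ σ) • Measure.dirac σ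

/-! ### Functions on the circle -/

/-- `f` is real analytic on the unit circle, read in the coordinate `s ↦ exp (i s)`, which is a
local real analytic diffeomorphism of the line onto the circle. -/
def IsRealAnalytic (f : Circle → ℂ) : Prop :=
  AnalyticOnNhd ℝ (fun s : ℝ => f (Circle.exp s)) Set.univ

/-- The distance of `s ∈ [0, 1)` to the nearer of the endpoints `0` and `1`. -/
def endDist (s : ℝ) : ℝ := min s (1 - s)

/-- `x = exp (2 π i t)` is of finite type: for some `K, γ > 0`, the distance of `m t` to the
nearest integer exceeds `K / |m| ^ γ` for all nonzero integers `m`. -/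
def IsFiniteType (x : Circle) : Prop :=
  ∃ t : ℝ, Circle.exp (2 * Real.pi * t) = x ∧
    ∃ K γ : ℝ, 0 < K ∧ 0 < γ ∧
      ∀ m : ℤ, m ≠ 0 → K / |(m : ℝ)| ^ γ < endDist (Int.fract (m * t))

open scoped Classical in
/-- The mean of `φ` along the powers of `x`: the average over `x, x², …, x^p` if `x` is a root of
unity of order `p`, and the integral over the circle if `x` is not a root of unity. -/
def powerMean {E : Type*} [NormedAddCommGroup E] [NormedSpace ℝ E] (x : Circle) (φ : Circle → E) :
    E :=
  if IsOfFinOrder x then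
    (orderOf x : ℝ)⁻¹ • ∑ m ∈ Finset.Icc 1 (orderOf x), φ (x ^ m)
  else ∫ s in (0 : ℝ)..1, φ (Circle.exp (2 * Real.pi * s))

/-- The (logarithmic, complex) Mahler measure `m(f)(x)`. The logarithm is the principal branch,
with `log (-y) = log y + i π` for `y > 0`. -/
def mahler (f : Circle → ℂ) (x : Circle) : ℂ := powerMean x fun z => Complex.log (f z)

/-- The logarithm `w^n(f)(x)` of the multiplicative class function associated to `f`. -/
def logClassFun (f : Circle → ℂ) (x : Circle) {n : ℕ} (σ : Equiv.Perm (Fin n)) : ℂ :=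
  ∑ m ∈ Finset.Icc 1 n, (cycleCount σ m : ℂ) * Complex.log (f (x ^ m))

/-- The rescaled random variable `w^n(f)(x) / √(log n) - θ √(log n) m(f)(x)` on `S_n`. -/
def rescaled (θ : ℝ) (f : Circle → ℂ) (x : Circle) (n : ℕ) (σ : Equiv.Perm (Fin n)) : ℂ :=
  logClassFun f x σ / (√(Real.log n) : ℝ) - (θ : ℂ) * (√(Real.log n) : ℝ) * mahler f x

/-! ### The limiting complex normal distribution -/

/-- The covariance matrix `θ (V_a, E_ab; E_ab, V_b)` of the real and imaginary part of the limit,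
where `V_a`, `V_b`, `E_ab` are the means of `(log |f|)²`, `(arg f)²` and `log |f| · arg f`. -/
def limitCov (θ : ℝ) (f : Circle → ℂ) (x : Circle) : Matrix (Fin 2) (Fin 2) ℝ :=
  θ • !![powerMean x (fun z => (Complex.log (f z)).re ^ 2),
         powerMean x (fun z => (Complex.log (f z)).re * (Complex.log (f z)).im);
         powerMean x (fun z => (Complex.log (f z)).re * (Complex.log (f z)).im),
         powerMean x (fun z => (Complex.log (f z)).im ^ 2)]

/-- The identification of `ℂ` with the Euclidean plane. -/
def toPlane (z : ℂ) : EuclideanSpace ℝ (Fin 2) := !₂[z.re, z.im]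

/-- The complex random variable `N` is centred normal with covariance matrix `S` of its real and
imaginary part. -/
def IsCenteredComplexNormal {Ω : Type*} [MeasurableSpace Ω] (N : Ω → ℂ) (P : Measure Ω)
    (S : Matrix (Fin 2) (Fin 2) ℝ) : Prop :=
  HasLaw (fun ω => toPlane (N ω)) (multivariateGaussian 0 S) P

/-! ### The weak Wasserstein distance -/

/-- `M_k(g)`: the supremum over all points `u` and all indices `i_1, …, i_k` of the absolute value
of the partial derivative `∂^k g / ∂u_{i_1} ⋯ ∂u_{i_k}` at `u`. -/
def partialSup {d : ℕ} (k : ℕ) (g : EuclideanSpace ℝ (Fin d) → ℝ) : ℝ≥0∞ :=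
  ⨆ (u : EuclideanSpace ℝ (Fin d)) (i : Fin k → Fin d),
    ‖iteratedFDeriv ℝ k g u (fun j => EuclideanSpace.single (i j) 1)‖ₑ

/-- The test functions: smooth, with all first and second partial derivatives bounded by `1`. -/
def testFunctions (d : ℕ) : Set (EuclideanSpace ℝ (Fin d) → ℝ) :=
  {g | ContDiff ℝ ((⊤ : ℕ∞) : WithTop ℕ∞) g ∧ partialSup 1 g ≤ 1 ∧ partialSup 2 g ≤ 1}

/-- The weak Wasserstein distance of `X₁` and `X₂`, random variables on possibly different
probability spaces, as a supremum in `[0, ∞]`. -/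
def weakWasserstein {d : ℕ} {Ω₁ Ω₂ : Type*} [MeasurableSpace Ω₁] [MeasurableSpace Ω₂]
    (X₁ : Ω₁ → EuclideanSpace ℝ (Fin d)) (P₁ : Measure Ω₁)
    (X₂ : Ω₂ → EuclideanSpace ℝ (Fin d)) (P₂ : Measure Ω₂) : ℝ≥0∞ :=
  ⨆ g ∈ testFunctions d, ENNReal.ofReal |(∫ ω, g (X₁ ω) ∂P₁) - ∫ ω, g (X₂ ω) ∂P₂|

end EwensCLT

end

/-! The Ewens measure on S_n is replaced by the geometric mixture of the Ewens measures of all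
orders k, with weights proportional to u^k r_k, where r_k = `ewensMass θ k` and u = 1 - 1/n. Under
the mixture the cycle counts behave as independent Poisson variables with parameters θ u^m / m. This
is expressed through size biasing: `ewensSum_apply_sum` says that marking a cycle of length m
amounts to adding one at rate θ / m, and summing over all orders gives the Stein identity
`mixMeasure_stein` for the centred functional.

The way back from the mixture to S_n is `abs_mix_sub_le`. If adding a cycle of length m changes G by
at most K b_m, with b having bounded moments on average, then the Ewens means of G at orders k and n
differ by O(K (1 + |H_k - H_n|)), H_k being the mean number of cycles. The mixture mean of |H_k -
H_n| is O(1), because the logarithms cancel. For the rescaled functional K is of order (log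
n)^(-1/2), which is the claimed rate.

The normal approximation of the mixture is `abs_integral_sub_gaussian_le`. It differentiates the
mean of g along sin α V + cos α Z from the normal variable Z to the given V, using the Stein
identity for V and integration by parts for Z. Only two derivatives of g are bounded, so a third
order Taylor remainder is not available. Instead, translating the Gaussian part by a jump changes
its law in total variation by O(size / cos α) (`abs_smooth_taylor_le`), and the factor cos α from
differentiating the path removes the singularity. This needs the jumps to lie in the range of the
covariance, which may be degenerate. In a degenerate direction the square of the corresponding
component of log f has mean zero, so the component vanishes along the powers of x up to finitely
many exceptions (`HasPairMeans`, `exists_gaussian_system`); the exceptions are treated crudely.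

The arithmetic input is that averages of the monomials in log |f| and arg f along the powers of x
converge at a power rate. Abel summation (`HasPowerMean.exists_abel`) then gives the sums over θ u^m
/ m as θ log n times the mean plus O(1), which identifies centring and covariance. For a root of
unity the rate is clear by periodicity. For x of finite type, `IsLogType.exists_abs_sum_sub_le`
combines Dirichlet approximation with a truncation near the zeros of f and the branch cut; the zeros
being roots of unity keeps log f(x^m) of size O(log m). -/

noncomputable section

namespace EwensCLT

/-! ### Ewens weights on partitions and the size bias identity. -/

section Combinatorics

open scoped Nat

variable {E : Type*} [NormedAddCommGroup E] [NormedSpace ℝ E]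

/-- The total Ewens mass of the permutations with cycle lengths `s`, divided by `n!`. -/
def partWeight (θ : ℝ) (s : Multiset ℕ) : ℝ :=
  θ ^ Multiset.card s / ((s.prod : ℝ) * ∏ m ∈ s.toFinset, ((s.count m)! : ℝ))

/-- The unnormalised Ewens sum of a function of the multiset of cycle lengths. -/
def ewensSum (θ : ℝ) (n : ℕ) (F : Multiset ℕ → E) : E :=
  ∑ p : n.Partition, partWeight θ p.parts • F p.parts

/-- The total mass `θ (θ + 1) ⋯ (θ + n - 1) / n!`. -/
def ewensMass (θ : ℝ) (n : ℕ) : ℝ := ∏ i ∈ Finset.range n, (θ + i) / (i + 1)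

lemma prod_factorial_count_of_subset {s : Multiset ℕ} {T : Finset ℕ} (h : s.toFinset ⊆ T) :
    ∏ m ∈ s.toFinset, ((s.count m)! : ℝ) = ∏ m ∈ T, ((s.count m)! : ℝ) :=
  Finset.prod_subset h fun m _ hm => by
    rw [Multiset.mem_toFinset] at hm
    simp [Multiset.count_eq_zero_of_notMem hm]

/-- A new part m contributes a factor θ to the numerator and m to the product, and it multiplies the
factorial of the count of m by the new count, which is the factor on the left. -/
lemma partWeight_cons (θ : ℝ) (m : ℕ) (s : Multiset ℕ) :
    partWeight θ (m ::ₘ s) * ((m ::ₘ s).count m : ℝ) = θ / m * partWeight θ s := by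
  have h1 : ∏ k ∈ (m ::ₘ s).toFinset, (((m ::ₘ s).count k)! : ℝ) =
      ((s.count m : ℝ) + 1) * ∏ k ∈ s.toFinset, ((s.count k)! : ℝ) := by
    have hm : m ∈ (m ::ₘ s).toFinset := by simp
    rw [prod_factorial_count_of_subset (s := s) (T := (m ::ₘ s).toFinset) (by simp),
      ← Finset.mul_prod_erase _ _ hm, ← Finset.mul_prod_erase _ _ hm, ← mul_assoc]
    congr 1
    · rw [Multiset.count_cons_self, Nat.factorial_succ]; push_cast; ring
    · refine Finset.prod_congr rfl fun k hk => ?_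
      rw [Multiset.count_cons_of_ne (Finset.ne_of_mem_erase hk)]
  have h2 : ((s.count m : ℝ) + 1) ≠ 0 := by positivity
  have h3 : (∏ k ∈ s.toFinset, ((s.count k)! : ℝ)) ≠ 0 :=
    Finset.prod_ne_zero_iff.2 fun k _ => by positivity
  unfold partWeight
  rw [h1, Multiset.count_cons_self, Multiset.card_cons, Multiset.prod_cons]
  rw [Nat.cast_mul, Nat.cast_add_one]
  -- Zero parts are harmless: division by zero makes both sides vanish.
  by_cases hm : (m : ℝ) = 0
  · simp [hm]
  by_cases hs : (s.prod : ℝ) = 0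
  · simp [hs]
  field_simp
  ring

/-- Adding a part to a partition. -/
def consPartition {n m : ℕ} (hm : 0 < m) (hmn : m ≤ n) (p : (n - m).Partition) : n.Partition where
  parts := m ::ₘ p.parts
  parts_pos := by
    intro i hi
    rcases Multiset.mem_cons.1 hi with rfl | hi
    · exact hm
    · exact p.parts_pos hi
  parts_sum := by rw [Multiset.sum_cons, p.parts_sum]; omega

lemma consPartition_injective {n m : ℕ} (hm : 0 < m) (hmn : m ≤ n) :
    Function.Injective (consPartition hm hmn) := by
  intro p q h
  have := congrArg Nat.Partition.parts h
  exact Nat.Partition.ext ((Multiset.cons_inj_right m).1 this)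

lemma mem_range_consPartition {n m : ℕ} (hm : 0 < m) (hmn : m ≤ n) {p : n.Partition}
    (hp : m ∈ p.parts) : ∃ q, consPartition hm hmn q = p := by
  have h := Multiset.cons_erase hp
  refine ⟨⟨p.parts.erase m, fun hi => p.parts_pos (Multiset.mem_of_mem_erase hi), ?_⟩, ?_⟩
  · have := congrArg Multiset.sum h
    rw [Multiset.sum_cons, p.parts_sum] at this
    omega
  · exact Nat.Partition.ext h

/-- The size bias identity: cycles of length `m` are picked at the rate `θ / m`. -/
lemma ewensSum_count (θ : ℝ) {n m : ℕ} (hm : 0 < m) (hmn : m ≤ n) (F : Multiset ℕ → E) :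
    ewensSum θ n (fun s => (s.count m : ℝ) • F s) =
      (θ / m) • ewensSum θ (n - m) (fun s => F (m ::ₘ s)) := by
  unfold ewensSum
  rw [Finset.smul_sum]
  symm
  refine Finset.sum_of_injOn (consPartition hm hmn) (consPartition_injective hm hmn).injOn
    (by simp) ?_ ?_
  · intro p _ hp
    have : m ∉ p.parts := fun h => hp (by
      obtain ⟨q, rfl⟩ := mem_range_consPartition hm hmn h
      simp)
    simp [Multiset.count_eq_zero_of_notMem this]
  · intro p _
    simp only [consPartition, smul_smul]
    rw [partWeight_cons]

lemma sum_map_eq_sum_count {n : ℕ} (p : n.Partition) {M : Type*} [AddCommGroup M] [Module ℝ M]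
    (a : ℕ → M) :
    (p.parts.map a).sum = ∑ m ∈ Finset.Icc 1 n, (p.parts.count m : ℝ) • a m := by
  rw [Finset.sum_multiset_map_count]
  simp only [Nat.cast_smul_eq_nsmul]
  refine Finset.sum_subset ?_ ?_
  · intro m hm
    rw [Multiset.mem_toFinset] at hm
    exact Finset.mem_Icc.2 ⟨p.parts_pos hm, Nat.Partition.le_of_mem_parts hm⟩
  · intro m _ hm
    rw [Multiset.mem_toFinset] at hm
    simp [Multiset.count_eq_zero_of_notMem hm]

/-- The size bias identity for an additive functional of the cycle lengths. -/
lemma ewensSum_apply_sum {V : Type*} [NormedAddCommGroup V] [NormedSpace ℝ V] (θ : ℝ) (n : ℕ)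
    (H : Multiset ℕ → V →L[ℝ] E) (a : ℕ → V) :
    ewensSum θ n (fun s => H s (s.map a).sum) =
      ∑ m ∈ Finset.Icc 1 n, (θ / m) • ewensSum θ (n - m) (fun s => H (m ::ₘ s) (a m)) := by
  have : ∀ m ∈ Finset.Icc 1 n, (θ / m) • ewensSum θ (n - m) (fun s => H (m ::ₘ s) (a m)) =
      ewensSum θ n (fun s => (s.count m : ℝ) • H s (a m)) := fun m hm => by
    rw [Finset.mem_Icc] at hm
    rw [ewensSum_count θ hm.1 hm.2]
  rw [Finset.sum_congr rfl this]
  unfold ewensSum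
  rw [Finset.sum_comm]
  refine Finset.sum_congr rfl fun p _ => ?_
  simp only [sum_map_eq_sum_count, map_sum, Finset.smul_sum, map_smul]

/-- The parts sum to n, so the size bias identity for a m = m has n on the left, and its factor m
cancels the rate 1 / m. In probabilistic terms, the cycle through a given point is removed. -/
lemma nsmul_ewensSum (θ : ℝ) (n : ℕ) (F : Multiset ℕ → E) :
    (n : ℝ) • ewensSum θ n F =
      θ • ∑ m ∈ Finset.Icc 1 n, ewensSum θ (n - m) (fun s => F (m ::ₘ s)) := by
  have h := ewensSum_apply_sum θ n
    (fun s => (ContinuousLinearMap.toSpanSingleton ℝ (F s))) (fun m => (m : ℝ))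
  have h1 : ewensSum θ n (fun s => (ContinuousLinearMap.toSpanSingleton ℝ (F s))
      (s.map (fun m : ℕ => (m : ℝ))).sum) = (n : ℝ) • ewensSum θ n F := by
    unfold ewensSum
    rw [Finset.smul_sum]
    refine Finset.sum_congr rfl fun p _ => ?_
    have : (p.parts.map (fun m : ℕ => (m : ℝ))).sum = n := by
      conv_rhs => rw [← p.parts_sum]
      exact (map_multiset_sum (Nat.castAddMonoidHom ℝ) _).symm
    beta_reduce
    rw [this, ContinuousLinearMap.toSpanSingleton_apply, smul_comm]
  rw [← h1, h, Finset.smul_sum]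
  refine Finset.sum_congr rfl fun m hm => ?_
  have hm0 : (m : ℝ) ≠ 0 := by
    have := (Finset.mem_Icc.1 hm).1
    positivity
  unfold ewensSum
  rw [Finset.smul_sum, Finset.smul_sum]
  refine Finset.sum_congr rfl fun p _ => ?_
  beta_reduce
  rw [ContinuousLinearMap.toSpanSingleton_apply, smul_comm _ (m : ℝ), smul_smul,
    div_mul_cancel₀ _ hm0]

lemma sum_Icc_sub {M : Type*} [AddCommMonoid M] (n : ℕ) (g : ℕ → M) :
    ∑ m ∈ Finset.Icc 1 n, g (n - m) = ∑ k ∈ Finset.range n, g k := by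
  rw [← Finset.sum_range_reflect, Finset.range_eq_Ico, Finset.sum_Ico_eq_sum_range,
    ← Finset.Ico_succ_right_eq_Icc, Finset.sum_Ico_eq_sum_range]
  refine Finset.sum_congr (by simp) fun k hk => ?_
  congr 1
  simp at hk
  omega

lemma ewensMass_succ (θ : ℝ) (n : ℕ) :
    ewensMass θ (n + 1) = ewensMass θ n * ((θ + n) / (n + 1)) := by
  rw [ewensMass, Finset.prod_range_succ, ewensMass]

lemma ewensMass_pos {θ : ℝ} (hθ : 0 < θ) (n : ℕ) : 0 < ewensMass θ n :=
  Finset.prod_pos fun i _ => by positivity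

lemma mul_sum_ewensMass (θ : ℝ) (n : ℕ) :
    θ * ∑ k ∈ Finset.range n, ewensMass θ k = n * ewensMass θ n := by
  induction n with
  | zero => simp
  | succ n ih =>
    rw [Finset.sum_range_succ, mul_add, ih, ewensMass_succ]
    push_cast
    field_simp
    ring

lemma ewensSum_zero (θ : ℝ) (F : Multiset ℕ → E) : ewensSum θ 0 F = F 0 := by
  unfold ewensSum
  rw [Fintype.sum_unique]
  have : (default : (0 : ℕ).Partition).parts = 0 := by simp
  rw [this]
  simp [partWeight]

/-- `nsmul_ewensSum` for F = 1 is the recursion `mul_sum_ewensMass`, which determines the sequence.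
-/
lemma ewensSum_one (θ : ℝ) (n : ℕ) : ewensSum θ n (fun _ => (1 : ℝ)) = ewensMass θ n := by
  induction n using Nat.strong_induction_on with
  | _ n ih =>
    rcases Nat.eq_zero_or_pos n with rfl | hn
    · simp [ewensSum_zero, ewensMass]
    · have h := nsmul_ewensSum θ n (fun _ => (1 : ℝ))
      rw [sum_Icc_sub n (fun k => ewensSum θ k (fun _ => (1 : ℝ))),
        Finset.sum_congr rfl (fun k hk => ih k (Finset.mem_range.1 hk)), smul_eq_mul, smul_eq_mul,
        mul_sum_ewensMass] at h
      exact mul_left_cancel₀ (by positivity) h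

/-- Both sides are the unnormalised mean number of cycles: the left by the size bias identity with a
= 1, the right by solving the recursion `nsmul_ewensSum`. -/
lemma ewensSum_card (θ : ℝ) (hθ : 0 < θ) (n : ℕ) :
    ∑ m ∈ Finset.Icc 1 n, θ / m * ewensMass θ (n - m) =
      ewensMass θ n * ∑ i ∈ Finset.range n, θ / (θ + i) := by
  have key : ∀ n, ewensSum θ n (fun s => (Multiset.card s : ℝ)) =
      ewensMass θ n * ∑ i ∈ Finset.range n, θ / (θ + i) := by
    intro n
    have hrec : ∀ n : ℕ, (n : ℝ) * ewensSum θ n (fun s => (Multiset.card s : ℝ)) =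
        θ * ∑ k ∈ Finset.range n,
          (ewensSum θ k (fun s => (Multiset.card s : ℝ)) + ewensMass θ k) := by
      intro n
      have h := nsmul_ewensSum θ n (fun s => (Multiset.card s : ℝ))
      rw [smul_eq_mul, smul_eq_mul] at h
      rw [h, ← sum_Icc_sub n]
      congr 1
      refine Finset.sum_congr rfl fun m _ => ?_
      rw [← ewensSum_one]
      unfold ewensSum
      rw [← Finset.sum_add_distrib]
      simp [mul_add]
    induction n with
    | zero => simp [ewensSum_zero]
    | succ n ih =>
      have h1 := hrec (n + 1)
      rw [Finset.sum_range_succ, mul_add, ← hrec n, ih] at h1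
      have h2 : ((n + 1 : ℕ) : ℝ) ≠ 0 := by positivity
      refine mul_left_cancel₀ h2 ?_
      rw [h1, ewensMass_succ, Finset.sum_range_succ]
      have h3 : θ + n ≠ 0 := by positivity
      push_cast
      field_simp
      ring
  rw [← key]
  have h := ewensSum_apply_sum θ n (fun _ => ContinuousLinearMap.id ℝ ℝ) (fun _ => (1 : ℝ))
  have h4 : ewensSum θ n (fun s => (Multiset.card s : ℝ)) = ewensSum θ n
      (fun s => ContinuousLinearMap.id ℝ ℝ (s.map (fun _ => (1 : ℝ))).sum) := by
    congr 1; ext s; simp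
  rw [h4, h]
  refine Finset.sum_congr rfl fun m _ => ?_
  rw [← ewensSum_one]
  simp

/-- Cauchy's formula for the size of a conjugacy class. Since `cycleType` forgets fixed points, the
parts equal to 1 are split off, and their factorial is that of the number of points left over. -/
lemma card_partition_eq {n : ℕ} (p : n.Partition) :
    (Finset.card {σ : Equiv.Perm (Fin n) | σ.partition.parts = p.parts} : ℝ) *
      ((p.parts.prod : ℝ) * ∏ m ∈ p.parts.toFinset, ((p.parts.count m)! : ℝ)) = n ! := by
  set c := p.parts.filter (fun k => 2 ≤ k) with hc
  have hdecomp : p.parts = c + Multiset.replicate (p.parts.count 1) 1 := by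
    conv_lhs => rw [← Multiset.filter_add_not (fun k => 2 ≤ k) p.parts]
    congr 1
    rw [← Multiset.filter_eq']
    refine Multiset.filter_congr fun k hk => ?_
    have := p.parts_pos hk
    omega
  have hsum : c.sum + p.parts.count 1 = n := by
    have := congrArg Multiset.sum hdecomp
    rw [p.parts_sum, Multiset.sum_add] at this
    simp at this
    omega
  have hset : ∀ σ : Equiv.Perm (Fin n), σ.partition.parts = p.parts ↔ σ.cycleType = c := by
    intro σ
    constructor
    · intro h
      rw [← Equiv.Perm.filter_parts_partition_eq_cycleType, h]
    · intro h
      rw [Equiv.Perm.parts_partition, h, ← Equiv.Perm.sum_cycleType, h, hdecomp]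
      rw [Fintype.card_fin, ← hdecomp, show n - c.sum = p.parts.count 1 by omega, ← hdecomp]
  have h := Equiv.Perm.card_of_cycleType_mul_eq (Fin n) c
  rw [if_pos ⟨by rw [Fintype.card_fin]; omega, fun a ha => (Multiset.mem_filter.1 ha).2⟩,
    Fintype.card_fin] at h
  have hns : n - c.sum = p.parts.count 1 := by omega
  rw [hns] at h
  rw [← h]
  simp only [hset]
  rw [Nat.cast_mul, Nat.cast_mul, Nat.cast_mul, Nat.cast_prod]
  congr 1
  have hprod : p.parts.prod = c.prod := by
    conv_lhs => rw [hdecomp]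
    simp
  have h1c : 1 ∉ c.toFinset := by simp [hc]
  have hsub : p.parts.toFinset ⊆ insert 1 c.toFinset := by
    intro k hk
    rw [Multiset.mem_toFinset] at hk
    have := p.parts_pos hk
    rw [Finset.mem_insert, Multiset.mem_toFinset, hc, Multiset.mem_filter]
    by_cases h : k = 1
    · exact Or.inl h
    · exact Or.inr ⟨hk, by omega⟩
  rw [hprod, prod_factorial_count_of_subset hsub, Finset.prod_insert h1c]
  have : ∏ k ∈ c.toFinset, ((p.parts.count k)! : ℝ) = ∏ k ∈ c.toFinset, ((c.count k)! : ℝ) := by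
    refine Finset.prod_congr rfl fun k hk => ?_
    rw [Multiset.mem_toFinset, hc, Multiset.mem_filter] at hk
    rw [hc, Multiset.count_filter, if_pos hk.2]
  rw [this]
  ring

lemma factorial_mul_ewensMass (θ : ℝ) (n : ℕ) :
    (n ! : ℝ) * ewensMass θ n = ∏ i ∈ Finset.range n, (θ + i) := by
  have h : (n ! : ℝ) = ∏ i ∈ Finset.range n, ((i : ℝ) + 1) := by
    rw [← Finset.prod_range_add_one_eq_factorial]
    push_cast
    rfl
  rw [ewensMass, Finset.prod_div_distrib, ← h, mul_div_cancel₀]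
  positivity

/-- Integration of a function of the cycle lengths against the Ewens measure. -/
lemma integral_ewensMeasure {θ : ℝ} (hθ : 0 < θ) (n : ℕ) (F : Multiset ℕ → ℝ) :
    ∫ σ, F σ.partition.parts ∂(ewensMeasure θ n) = (ewensMass θ n)⁻¹ * ewensSum θ n F := by
  have hw : ∀ σ : Equiv.Perm (Fin n), 0 ≤ ewensWeight θ σ := fun σ =>
    div_nonneg (by positivity) (Finset.prod_nonneg fun i _ => by positivity)
  have h1 : ∫ σ, F σ.partition.parts ∂(ewensMeasure θ n) =
      ∑ σ : Equiv.Perm (Fin n), ewensWeight θ σ * F σ.partition.parts := by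
    rw [ewensMeasure, integral_finsetSum_measure]
    · refine Finset.sum_congr rfl fun σ _ => ?_
      rw [integral_smul_measure, integral_dirac, ENNReal.toReal_ofReal (hw σ), smul_eq_mul]
    · intro σ _
      exact (integrable_dirac (by simp)).smul_measure (by simp)
  rw [h1]
  let e : Equiv.Perm (Fin n) → n.Partition := fun σ =>
    ⟨σ.partition.parts, σ.partition.parts_pos, by rw [σ.partition.parts_sum, Fintype.card_fin]⟩
  rw [← Finset.sum_fiberwise (s := Finset.univ) (g := e)]
  unfold ewensSum
  rw [Finset.mul_sum]
  refine Finset.sum_congr rfl fun p _ => ?_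
  have h2 : ∀ σ ∈ Finset.univ.filter (fun σ => e σ = p), ewensWeight θ σ * F σ.partition.parts =
      θ ^ Multiset.card p.parts / (∏ i ∈ Finset.range n, (θ + i)) * F p.parts := by
    intro σ hσ
    have : σ.partition.parts = p.parts := by
      rw [← (Finset.mem_filter.1 hσ).2]
    rw [ewensWeight, numCycles, this]
  rw [Finset.sum_congr rfl h2, Finset.sum_const, nsmul_eq_mul]
  have h3 : Finset.univ.filter (fun σ => e σ = p) =
      Finset.univ.filter (fun σ : Equiv.Perm (Fin n) => σ.partition.parts = p.parts) := by
    ext σ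
    simp [e, Nat.Partition.ext_iff]
  rw [h3, ← factorial_mul_ewensMass, partWeight, smul_eq_mul, ← card_partition_eq p]
  have h4 : ((p.parts.prod : ℝ) * ∏ m ∈ p.parts.toFinset, ((p.parts.count m)! : ℝ)) ≠ 0 := by
    refine mul_ne_zero ?_ (Finset.prod_ne_zero_iff.2 fun k _ => by positivity)
    have : 0 < p.parts.prod := Multiset.prod_pos fun a ha => p.parts_pos ha
    positivity
  have h5 : (Finset.card {σ : Equiv.Perm (Fin n) | σ.partition.parts = p.parts} : ℝ) ≠ 0 := by
    intro h0
    have := card_partition_eq p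
    rw [h0, zero_mul] at this
    have : (n ! : ℝ) ≠ 0 := by positivity
    tauto
  have h6 := (ewensMass_pos hθ n).ne'
  field_simp

end Combinatorics

/-! ### Growth of the total masses and of the mean number of cycles. -/

section MassComparison

/-- Bernoulli's inequality for 1 + (θ - 1) / (n + 1), factor by factor. A power of the mass ratio is
absorbed into a change of the parameter, after which its sum is explicit (`sum_ewensMass_ratio`). -/
lemma ewensMass_rpow_le {θ θ' q : ℝ} (hθ : 0 < θ) (hq : 1 ≤ q) (hθ' : θ' = 1 - q * (1 - θ))
    (h0 : 0 < θ') {k n : ℕ} (hkn : k ≤ n) :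
    (ewensMass θ k / ewensMass θ n) ^ q ≤ ewensMass θ' k / ewensMass θ' n := by
  induction n, hkn using Nat.le_induction with
  | base => simp [div_self (ewensMass_pos hθ k).ne', div_self (ewensMass_pos h0 k).ne']
  | succ n hkn ih =>
    have hn : (0 : ℝ) < n + 1 := by positivity
    have hr := ewensMass_pos hθ n
    have hr' := ewensMass_pos h0 n
    have hk := ewensMass_pos hθ k
    have hk' := ewensMass_pos h0 k
    have hx : (0 : ℝ) < (θ + n) / (n + 1) := by positivity
    have hx' : (0 : ℝ) < (θ' + n) / (n + 1) := by positivity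
    have hB : (θ' + n) / (n + 1) ≤ ((θ + n) / (n + 1)) ^ q := by
      have := one_add_mul_self_le_rpow_one_add (s := (θ - 1) / (n + 1)) (p := q)
        (by rw [le_div_iff₀ hn]; nlinarith [(Nat.cast_nonneg n : (0 : ℝ) ≤ n)]) hq
      have e1 : 1 + (θ - 1) / (n + 1) = (θ + n) / (n + 1) := by field_simp; ring
      have e2 : 1 + q * ((θ - 1) / (n + 1)) = (θ' + n) / (n + 1) := by
        rw [hθ']; field_simp; ring
      rwa [e1, e2] at this
    rw [ewensMass_succ, ewensMass_succ, ← div_div, ← div_div, Real.div_rpow (by positivity) hx.le]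
    have : 0 ≤ (ewensMass θ k / ewensMass θ n) ^ q := by positivity
    gcongr

lemma sum_ewensMass_ratio {θ : ℝ} (hθ : 0 < θ) (n : ℕ) :
    ∑ k ∈ Finset.range n, ewensMass θ k / ewensMass θ n = n / θ := by
  rw [← Finset.sum_div, div_eq_div_iff (ewensMass_pos hθ n).ne' hθ.ne', mul_comm,
    mul_sum_ewensMass]

/-- The size of the cycle through a given point has bounded `b`-mean if `b` has bounded moments. -/
lemma exists_sum_ewensMass_mul_le {θ : ℝ} (hθ : 0 < θ) {b : ℕ → ℝ} (hb : ∀ m, 0 ≤ b m)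
    (hmom : ∀ p : ℕ, ∃ C : ℝ, ∀ N : ℕ, ∑ m ∈ Finset.Icc 1 N, b m ^ p ≤ C * N) :
    ∃ J : ℝ, 0 ≤ J ∧ ∀ n : ℕ,
      θ * ∑ m ∈ Finset.Icc 1 n, ewensMass θ (n - m) * b m ≤ J * (n * ewensMass θ n) := by
  -- For θ < 1 the ratios r_(n-m) / r_n are unbounded near m = n, so a high moment of b is needed: p
  -- θ > 1 is what makes the new parameter θ' = (p θ - 1) / (p - 1) positive.
  obtain ⟨p, hp⟩ := exists_nat_gt (max 2 (1 / θ))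
  have hp2 : (2 : ℝ) < p := lt_of_le_of_lt (le_max_left _ _) hp
  have hpθ : 1 < p * θ := by
    have := lt_of_le_of_lt (le_max_right _ _) hp
    rwa [div_lt_iff₀ hθ] at this
  have hp1 : (0 : ℝ) < p - 1 := by linarith
  set q : ℝ := p / (p - 1) with hq
  have hq1 : 1 ≤ q := by rw [hq, le_div_iff₀ hp1]; linarith
  have hpq : Real.HolderConjugate q p := by
    rw [Real.holderConjugate_iff]
    refine ⟨by rw [hq, lt_div_iff₀ hp1]; linarith, ?_⟩
    rw [hq]; field_simp; ring
  set θ' : ℝ := 1 - q * (1 - θ) with hθ'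
  have h0 : 0 < θ' := by
    have : θ' = (p * θ - 1) / (p - 1) := by rw [hθ', hq]; field_simp; ring
    rw [this]
    exact div_pos (by linarith) hp1
  obtain ⟨C, hC⟩ := hmom p
  have hC0 : 0 ≤ C := by
    have := hC 1
    simp at this
    exact le_trans (by have := hb 1; positivity) this
  refine ⟨θ * (1 / θ' + C), by positivity, fun n => ?_⟩
  have hr := ewensMass_pos hθ n
  have key : ∑ m ∈ Finset.Icc 1 n, ewensMass θ (n - m) / ewensMass θ n * b m ≤
      (1 / θ' + C) * n := by
    calc ∑ m ∈ Finset.Icc 1 n, ewensMass θ (n - m) / ewensMass θ n * b m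
        ≤ ∑ m ∈ Finset.Icc 1 n, (ewensMass θ' (n - m) / ewensMass θ' n + b m ^ p) := by
          refine Finset.sum_le_sum fun m _ => ?_
          have hx : 0 ≤ ewensMass θ (n - m) / ewensMass θ n :=
            (div_pos (ewensMass_pos hθ _) hr).le
          -- Young's inequality term by term in place of Hölder's; the factors 1 / q and 1 / p are
          -- at most 1 and dropped.
          have h1 := Real.young_inequality_of_nonneg hx (hb m) hpq
          have h2 := ewensMass_rpow_le hθ hq1 hθ' h0 (Nat.sub_le n m)
          have h3 : (ewensMass θ (n - m) / ewensMass θ n) ^ q / q ≤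
              (ewensMass θ (n - m) / ewensMass θ n) ^ q :=
            div_le_self (Real.rpow_nonneg hx _) hq1
          have h4 : b m ^ (p : ℝ) / p ≤ b m ^ (p : ℝ) :=
            div_le_self (Real.rpow_nonneg (hb m) _) (by linarith)
          rw [Real.rpow_natCast] at h1 h4
          linarith
      _ = n / θ' + ∑ m ∈ Finset.Icc 1 n, b m ^ p := by
          rw [Finset.sum_add_distrib, sum_Icc_sub n (fun k => ewensMass θ' k / ewensMass θ' n),
            sum_ewensMass_ratio h0]
      _ ≤ (1 / θ' + C) * n := by
          have := hC n
          rw [add_mul, one_div, inv_mul_eq_div]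
          linarith
  have h5 : ∑ m ∈ Finset.Icc 1 n, ewensMass θ (n - m) * b m =
      ewensMass θ n * ∑ m ∈ Finset.Icc 1 n, ewensMass θ (n - m) / ewensMass θ n * b m := by
    rw [Finset.mul_sum]
    refine Finset.sum_congr rfl fun m _ => ?_
    field_simp
  rw [h5]
  calc θ * (ewensMass θ n * ∑ m ∈ Finset.Icc 1 n, ewensMass θ (n - m) / ewensMass θ n * b m)
      ≤ θ * (ewensMass θ n * ((1 / θ' + C) * n)) := by gcongr
    _ = _ := by ring

lemma partWeight_nonneg {θ : ℝ} (hθ : 0 < θ) (s : Multiset ℕ) : 0 ≤ partWeight θ s := by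
  unfold partWeight
  positivity

lemma norm_ewensSum_le {E : Type*} [NormedAddCommGroup E] [NormedSpace ℝ E] {θ : ℝ} (hθ : 0 < θ)
    {n : ℕ} {F : Multiset ℕ → E} {c : ℝ} (h : ∀ s, ‖F s‖ ≤ c) :
    ‖ewensSum θ n F‖ ≤ c * ewensMass θ n := by
  rw [← ewensSum_one]
  unfold ewensSum
  rw [Finset.mul_sum]
  refine norm_sum_le_of_le _ fun p _ => ?_
  rw [norm_smul, Real.norm_of_nonneg (partWeight_nonneg hθ _), smul_eq_mul, mul_one, mul_comm]
  exact mul_le_mul_of_nonneg_right (h _) (partWeight_nonneg hθ _)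

/-- The mean number of cycles under the Ewens measure. -/
def cycleMean (θ : ℝ) (n : ℕ) : ℝ := ∑ i ∈ Finset.range n, θ / (θ + i)

lemma cycleMean_succ (θ : ℝ) (n : ℕ) : cycleMean θ (n + 1) = cycleMean θ n + θ / (θ + n) :=
  Finset.sum_range_succ _ _

lemma cycleMean_mono {θ : ℝ} (hθ : 0 < θ) : Monotone (cycleMean θ) :=
  monotone_nat_of_le_succ fun n => by
    rw [cycleMean_succ]
    have : 0 ≤ θ / (θ + n) := by positivity
    linarith

lemma cycleMean_le {θ : ℝ} (hθ : 0 < θ) {n : ℕ} (hn : 1 ≤ n) :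
    cycleMean θ n ≤ 1 + θ * (1 + Real.log n) := by
  obtain ⟨k, rfl⟩ : ∃ k, n = k + 1 := ⟨n - 1, by omega⟩
  have h1 : cycleMean θ (k + 1) ≤ 1 + θ * (harmonic k : ℝ) := by
    rw [cycleMean, Finset.sum_range_succ', harmonic]
    push_cast
    rw [Finset.mul_sum, add_comm]
    refine add_le_add (by simp [hθ.ne']) (Finset.sum_le_sum fun i _ => ?_)
    rw [div_eq_mul_inv]
    refine mul_le_mul_of_nonneg_left (inv_anti₀ (by positivity) ?_) hθ.le
    linarith
  have h2 := harmonic_le_one_add_log k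
  have h3 : Real.log k ≤ Real.log (k + 1 : ℕ) := by
    rcases Nat.eq_zero_or_pos k with rfl | hk
    · simp
    · exact Real.log_le_log (by positivity) (by push_cast; linarith)
  have : θ * (harmonic k : ℝ) ≤ θ * (1 + Real.log (k + 1 : ℕ)) := by gcongr; linarith
  linarith

/-- The bound is affine in k and `cycleMean θ k`, whose means under the geometric mixture are
explicit; that is why the absolute value is traded for it. For k ≥ n, the increments beyond n are at
most θ / n each. -/
lemma abs_cycleMean_sub_le {θ : ℝ} (hθ : 0 < θ) {n : ℕ} (hn : 1 ≤ n) (k : ℕ) :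
    |cycleMean θ k - cycleMean θ n| ≤ 2 * (θ / n * k) - cycleMean θ k + cycleMean θ n := by
  have hn' : (0 : ℝ) < n := by positivity
  rcases le_total k n with h | h
  · have := cycleMean_mono hθ h
    have h2 : 0 ≤ θ / n * k := by positivity
    rw [abs_of_nonpos (by linarith)]
    linarith
  · have h1 := cycleMean_mono hθ h
    have h2 : cycleMean θ k - cycleMean θ n ≤ θ / n * k := by
      clear h1
      have : cycleMean θ k - cycleMean θ n ≤ θ / n * (k - n) := by
        induction k, h using Nat.le_induction with
        | base => simp
        | succ k hk ih =>
          rw [cycleMean_succ]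
          have : θ / (θ + k) ≤ θ / n := by
            have : (n : ℝ) ≤ k := by exact_mod_cast hk
            gcongr
            linarith
          push_cast
          have e : θ / n * ((k : ℝ) + 1 - n) = θ / n * (k - n) + θ / n := by ring
          linarith
      have h3 : 0 ≤ θ / n * n := by positivity
      nlinarith
    rw [abs_of_nonneg (by linarith)]
    linarith

end MassComparison

/-! ### Comparison of Ewens means of different orders. -/

section Depoissonization

variable {θ : ℝ} {b : ℕ → ℝ} {J K : ℝ} {G : Multiset ℕ → ℝ}

/-- The mean of `G` over the lengths of the closed cycles in the Feller coupling. -/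
def fellerMean (θ : ℝ) (G : Multiset ℕ → ℝ) (n : ℕ) : ℝ :=
  if n = 0 then G 0 else
    (∑ k ∈ Finset.range n, ewensSum θ k G) / ∑ k ∈ Finset.range n, ewensMass θ k

/-- `fellerMean` is the mean of G after the cycle through a given point has been removed. That cycle
has length m with probability θ r_(n-m) / (n r_n), and putting it back costs at most K b_m; `hbJ`
bounds the mean cost. -/
lemma abs_ewensSum_sub_fellerMean_le (hθ : 0 < θ) (hJ : 0 ≤ J) (hK : 0 ≤ K)
    (hbJ : ∀ n : ℕ, θ * ∑ m ∈ Finset.Icc 1 n, ewensMass θ (n - m) * b m ≤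
      J * (n * ewensMass θ n))
    (hG : ∀ m s, |G (m ::ₘ s) - G s| ≤ K * b m) (n : ℕ) :
    |ewensSum θ n G / ewensMass θ n - fellerMean θ G n| ≤ K * J := by
  have hr := ewensMass_pos hθ n
  rcases Nat.eq_zero_or_pos n with rfl | hn
  · simp [fellerMean, ewensSum_zero, ewensMass]
    positivity
  have hn' : (0 : ℝ) < n := by positivity
  have hR : ∑ k ∈ Finset.range n, ewensMass θ k = n * ewensMass θ n / θ := by
    rw [← mul_sum_ewensMass]; field_simp
  have h1 : ewensSum θ n G / ewensMass θ n - fellerMean θ G n =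
      (n * ewensMass θ n)⁻¹ * (θ * ∑ m ∈ Finset.Icc 1 n,
        ewensSum θ (n - m) (fun s => G (m ::ₘ s) - G s)) := by
    have h2 := nsmul_ewensSum θ n G
    rw [smul_eq_mul, smul_eq_mul] at h2
    have h3 : ∀ m ∈ Finset.Icc 1 n, ewensSum θ (n - m) (fun s => G (m ::ₘ s) - G s) =
        ewensSum θ (n - m) (fun s => G (m ::ₘ s)) - ewensSum θ (n - m) G := by
      intro m _
      unfold ewensSum
      rw [← Finset.sum_sub_distrib]
      simp [mul_sub]
    rw [Finset.sum_congr rfl h3, Finset.sum_sub_distrib, mul_sub, ← h2,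
      sum_Icc_sub n (fun k => ewensSum θ k G), fellerMean, if_neg hn.ne', hR]
    field_simp
  rw [h1, abs_mul, abs_of_pos (by positivity), inv_mul_le_iff₀ (by positivity), abs_mul,
    abs_of_pos hθ]
  calc θ * |∑ m ∈ Finset.Icc 1 n, ewensSum θ (n - m) (fun s => G (m ::ₘ s) - G s)|
      ≤ θ * ∑ m ∈ Finset.Icc 1 n, K * b m * ewensMass θ (n - m) := by
        gcongr
        refine (Finset.abs_sum_le_sum_abs _ _).trans (Finset.sum_le_sum fun m _ => ?_)
        exact norm_ewensSum_le (E := ℝ) hθ (F := fun s => G (m ::ₘ s) - G s) (fun s => hG m s)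
    _ = K * (θ * ∑ m ∈ Finset.Icc 1 n, ewensMass θ (n - m) * b m) := by
        rw [Finset.mul_sum, Finset.mul_sum, Finset.mul_sum]
        refine Finset.sum_congr rfl fun m _ => by ring
    _ ≤ K * (J * (n * ewensMass θ n)) := mul_le_mul_of_nonneg_left (hbJ n) hK
    _ = _ := by ring

/-- Passing from n to n + 1 adds the single order k = n to a weighted mean over k < n. Its relative
weight is θ / (θ + n), the increment of `cycleMean`. -/
lemma abs_fellerMean_succ_sub_le (hθ : 0 < θ)
    (hμ : ∀ n, |ewensSum θ n G / ewensMass θ n - fellerMean θ G n| ≤ K) (n : ℕ) :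
    |fellerMean θ G (n + 1) - fellerMean θ G n| ≤ K * (θ / (θ + n)) := by
  have hK : 0 ≤ K := (abs_nonneg _).trans (hμ 0)
  rcases Nat.eq_zero_or_pos n with rfl | hn
  · have : 0 ≤ K * (θ / (θ + (0 : ℕ))) := by positivity
    simpa [fellerMean, ewensSum_zero, ewensMass] using this
  have hr := ewensMass_pos hθ n
  have hn' : (0 : ℝ) < n := by positivity
  have hR : ∑ k ∈ Finset.range n, ewensMass θ k = n * ewensMass θ n / θ := by
    rw [← mul_sum_ewensMass]; field_simp
  have h1 : fellerMean θ G (n + 1) - fellerMean θ G n =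
      (ewensSum θ n G / ewensMass θ n - fellerMean θ G n) * (θ / (θ + n)) := by
    rw [fellerMean, fellerMean, if_neg hn.ne', if_neg (Nat.succ_ne_zero n),
      Finset.sum_range_succ, Finset.sum_range_succ, hR]
    field_simp
    ring
  have h2 : 0 < θ / (θ + n) := by positivity
  rw [h1, abs_mul, abs_of_pos h2]
  gcongr
  exact hμ n

/-- Each Ewens mean is within K J of its Feller mean, and the Feller means telescope. -/
lemma abs_ewensSum_div_sub_le (hθ : 0 < θ) (hJ : 0 ≤ J) (hK : 0 ≤ K)
    (hbJ : ∀ n : ℕ, θ * ∑ m ∈ Finset.Icc 1 n, ewensMass θ (n - m) * b m ≤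
      J * (n * ewensMass θ n))
    (hG : ∀ m s, |G (m ::ₘ s) - G s| ≤ K * b m) (k n : ℕ) :
    |ewensSum θ k G / ewensMass θ k - ewensSum θ n G / ewensMass θ n| ≤
      K * J * (2 + |cycleMean θ k - cycleMean θ n|) := by
  have hμ := abs_ewensSum_sub_fellerMean_le hθ hJ hK hbJ hG
  have hstep := abs_fellerMean_succ_sub_le hθ hμ
  have hKJ : 0 ≤ K * J := by positivity
  have hmono : ∀ k n, k ≤ n → |fellerMean θ G n - fellerMean θ G k| ≤
      K * J * (cycleMean θ n - cycleMean θ k) := by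
    intro k n h
    induction n, h using Nat.le_induction with
    | base => simp
    | succ n hn ih =>
      have e : K * J * (cycleMean θ (n + 1) - cycleMean θ k) =
          K * J * (θ / (θ + n)) + K * J * (cycleMean θ n - cycleMean θ k) := by
        rw [cycleMean_succ]; ring
      rw [e]
      refine (abs_sub_le _ (fellerMean θ G n) _).trans (add_le_add (hstep n) ih)
  have hν : |fellerMean θ G k - fellerMean θ G n| ≤
      K * J * |cycleMean θ k - cycleMean θ n| := by
    rcases le_total k n with h | h
    · rw [abs_sub_comm, abs_sub_comm (cycleMean θ k)]
      exact (hmono k n h).trans (mul_le_mul_of_nonneg_left (le_abs_self _) hKJ)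
    · exact (hmono n k h).trans (mul_le_mul_of_nonneg_left (le_abs_self _) hKJ)
  have h1 := hμ k
  have h2 := hμ n
  rw [abs_le] at *
  constructor <;> linarith

end Depoissonization

/-! ### The geometric mixture and its distance from a single Ewens measure. -/

section Mixture

variable {θ u : ℝ}

lemma summable_mul_ewensMass (hθ : 0 < θ) (hu : 0 < u) (hu1 : u < 1) :
    Summable (fun k : ℕ => ((k : ℝ) + 1) * (u ^ k * ewensMass θ k)) := by
  have hpos : ∀ k : ℕ, 0 < ((k : ℝ) + 1) * (u ^ k * ewensMass θ k) := fun k => by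
    have := ewensMass_pos hθ k
    positivity
  refine summable_of_ratio_test_tendsto_lt_one hu1 (Eventually.of_forall fun k => (hpos k).ne') ?_
  have h1 : ∀ k : ℕ, ‖(((k + 1 : ℕ) : ℝ) + 1) * (u ^ (k + 1) * ewensMass θ (k + 1))‖ /
      ‖((k : ℝ) + 1) * (u ^ k * ewensMass θ k)‖ =
      u * ((1 + 1 / ((k : ℝ) + 1)) * (1 + (θ - 1) * (1 / ((k : ℝ) + 1)))) := by
    intro k
    have h2 := ewensMass_pos hθ k
    rw [Real.norm_of_nonneg (hpos _).le, Real.norm_of_nonneg (hpos _).le, ewensMass_succ]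
    push_cast
    field_simp
    ring
  simp only [h1]
  have h3 := tendsto_one_div_add_atTop_nhds_zero_nat (𝕜 := ℝ)
  have h4 : Tendsto (fun k : ℕ => u * ((1 + 1 / ((k : ℝ) + 1)) *
      (1 + (θ - 1) * (1 / ((k : ℝ) + 1))))) atTop
      (nhds (u * ((1 + 0) * (1 + (θ - 1) * 0)))) :=
    ((h3.const_add 1).mul ((h3.const_mul (θ - 1)).const_add 1)).const_mul u
  simpa using h4

lemma summable_ewensMass (hθ : 0 < θ) (hu : 0 < u) (hu1 : u < 1) :
    Summable (fun k : ℕ => u ^ k * ewensMass θ k) := by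
  refine (summable_mul_ewensMass hθ hu hu1).of_nonneg_of_le
    (fun k => by have := ewensMass_pos hθ k; positivity) fun k => ?_
  have := ewensMass_pos hθ k
  exact le_mul_of_one_le_left (by positivity) (by linarith [(Nat.cast_nonneg k : (0 : ℝ) ≤ k)])

/-- The normalising constant of the geometric mixture of the Ewens measures. -/
def mixMass (θ u : ℝ) : ℝ := ∑' k : ℕ, u ^ k * ewensMass θ k

lemma mixMass_pos (hθ : 0 < θ) (hu : 0 < u) (hu1 : u < 1) : 0 < mixMass θ u :=
  (summable_ewensMass hθ hu hu1).tsum_pos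
    (fun k => by have := ewensMass_pos hθ k; positivity) 0 (by simp [ewensMass])

lemma summable_nat_mul_ewensMass (hθ : 0 < θ) (hu : 0 < u) (hu1 : u < 1) :
    Summable (fun k : ℕ => (k : ℝ) * (u ^ k * ewensMass θ k)) := by
  refine (summable_mul_ewensMass hθ hu hu1).of_nonneg_of_le
    (fun k => by have := ewensMass_pos hθ k; positivity) fun k => ?_
  have := ewensMass_pos hθ k
  gcongr
  linarith

/-- The recursion (k + 1) r_(k+1) = (θ + k) r_k gives S = u (θ Z + S) for the sum S, where Z is
`mixMass θ u`. -/
lemma tsum_nat_mul_ewensMass (hθ : 0 < θ) (hu : 0 < u) (hu1 : u < 1) :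
    ∑' k : ℕ, (k : ℝ) * (u ^ k * ewensMass θ k) = θ * u / (1 - u) * mixMass θ u := by
  have hs := summable_nat_mul_ewensMass hθ hu hu1
  have h0 := summable_ewensMass hθ hu hu1
  have h1 : ∑' k : ℕ, (k : ℝ) * (u ^ k * ewensMass θ k) =
      u * (θ * mixMass θ u + ∑' k : ℕ, (k : ℝ) * (u ^ k * ewensMass θ k)) := by
    conv_lhs => rw [hs.tsum_eq_zero_add]
    rw [mixMass, ← tsum_mul_left, ← (h0.mul_left θ).tsum_add hs, ← tsum_mul_left]
    simp only [Nat.cast_zero, zero_mul, zero_add]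
    refine tsum_congr fun k => ?_
    rw [ewensMass_succ]
    push_cast
    field_simp
    ring
  have h2 : (1 - u) ≠ 0 := by linarith
  rw [div_mul_eq_mul_div, eq_div_iff h2]
  linarith

lemma hasSum_pow_div (hu : 0 < u) (hu1 : u < 1) :
    HasSum (fun m : ℕ => θ * u ^ m / m) (θ * -Real.log (1 - u)) := by
  have h := Real.hasSum_pow_div_log_of_abs_lt_one (x := u) (by rw [abs_of_pos hu]; exact hu1)
  refine (hasSum_nat_add_iff' (f := fun m : ℕ => θ * u ^ m / m) 1).1 ?_
  simp only [Finset.range_one, Finset.sum_singleton, Nat.cast_zero, div_zero, sub_zero]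
  refine (h.mul_left θ).congr_fun fun k => ?_
  push_cast
  rw [mul_div_assoc]

lemma summable_cycleMean (hθ : 0 < θ) (hu : 0 < u) (hu1 : u < 1) :
    Summable (fun k : ℕ => cycleMean θ k * (u ^ k * ewensMass θ k)) := by
  refine (summable_nat_mul_ewensMass hθ hu hu1).of_nonneg_of_le (fun k => ?_) fun k => ?_
  · have := ewensMass_pos hθ k
    have h2 : 0 ≤ cycleMean θ k := Finset.sum_nonneg fun i _ => by positivity
    positivity
  · have := ewensMass_pos hθ k
    have h2 : cycleMean θ k ≤ k := by
      unfold cycleMean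
      refine (Finset.sum_le_card_nsmul _ _ 1 fun i _ => ?_).trans (by simp)
      rw [div_le_one (by positivity)]
      linarith [(Nat.cast_nonneg i : (0 : ℝ) ≤ i)]
    gcongr

/-- By `ewensSum_card` the terms are those of the Cauchy product of the logarithmic series with the
series of `mixMass`. -/
lemma tsum_cycleMean (hθ : 0 < θ) (hu : 0 < u) (hu1 : u < 1) :
    ∑' k : ℕ, cycleMean θ k * (u ^ k * ewensMass θ k) =
      θ * -Real.log (1 - u) * mixMass θ u := by
  have h1 := hasSum_pow_div (θ := θ) hu hu1
  have h0 := summable_ewensMass hθ hu hu1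
  rw [← h1.tsum_eq, mixMass, tsum_mul_tsum_eq_tsum_sum_antidiagonal_of_summable_norm
    h1.summable.norm h0.norm]
  refine tsum_congr fun k => ?_
  have h2 := ewensSum_card θ hθ k
  rw [cycleMean, mul_comm, mul_assoc, ← h2, Finset.Nat.sum_antidiagonal_eq_sum_range_succ_mk,
    Finset.mul_sum, Finset.range_eq_Ico, Finset.sum_eq_sum_Ico_succ_bot (by omega)]
  simp only [Nat.cast_zero, div_zero, zero_mul, zero_add]
  refine Finset.sum_congr rfl fun m hm => ?_
  have hm' := Finset.mem_Icc.1 hm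
  have : u ^ k = u ^ m * u ^ (k - m) := by rw [← pow_add]; congr 1; omega
  rw [this]
  ring

variable {b : ℕ → ℝ} {J K : ℝ} {G : Multiset ℕ → ℝ}

/-- The Ewens measure on `S_n` is close to the geometric mixture with parameter `1 - 1 / n`. -/
lemma abs_mix_sub_le (hθ : 0 < θ) (hJ : 0 ≤ J) (hK : 0 ≤ K)
    (hbJ : ∀ n : ℕ, θ * ∑ m ∈ Finset.Icc 1 n, ewensMass θ (n - m) * b m ≤
      J * (n * ewensMass θ n))
    (hG : ∀ m s, |G (m ::ₘ s) - G s| ≤ K * b m) {n : ℕ} (hn : 2 ≤ n) (hu : u = 1 - 1 / (n : ℝ)) :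
    Summable (fun k : ℕ => u ^ k * ewensSum θ k G) ∧
    |(mixMass θ u)⁻¹ * ∑' k : ℕ, u ^ k * ewensSum θ k G - (ewensMass θ n)⁻¹ * ewensSum θ n G| ≤
      K * J * (3 + θ + 2 * θ ^ 2) := by
  have hn' : (2 : ℝ) ≤ n := by exact_mod_cast hn
  have hu0 : 0 < u := by
    rw [hu, sub_pos, div_lt_one (by linarith)]; linarith
  have hu1 : u < 1 := by
    rw [hu]
    have : (0 : ℝ) < 1 / n := by positivity
    linarith
  have hZ := mixMass_pos hθ hu0 hu1
  have s0 := summable_ewensMass hθ hu0 hu1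
  have s1 := summable_nat_mul_ewensMass hθ hu0 hu1
  have sH := summable_cycleMean hθ hu0 hu1
  set μ : ℝ := (ewensMass θ n)⁻¹ * ewensSum θ n G with hμ
  -- The termwise bound from `abs_ewensSum_div_sub_le` and `abs_cycleMean_sub_le`, arranged so that
  -- its sum is known exactly.
  set B : ℕ → ℝ := fun k => K * J * ((2 + cycleMean θ n) * (u ^ k * ewensMass θ k) +
    2 * θ / n * ((k : ℝ) * (u ^ k * ewensMass θ k)) -
    cycleMean θ k * (u ^ k * ewensMass θ k)) with hB
  have sB : Summable B := (((s0.mul_left _).add (s1.mul_left _)).sub sH).mul_left _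
  have hbound : ∀ k, |u ^ k * ewensSum θ k G - μ * (u ^ k * ewensMass θ k)| ≤ B k := by
    intro k
    have hr := ewensMass_pos hθ k
    have h1 := abs_ewensSum_div_sub_le hθ hJ hK hbJ hG k n
    have h2 := abs_cycleMean_sub_le hθ (by omega : 1 ≤ n) k
    have e : u ^ k * ewensSum θ k G - μ * (u ^ k * ewensMass θ k) =
        (u ^ k * ewensMass θ k) *
          (ewensSum θ k G / ewensMass θ k - ewensSum θ n G / ewensMass θ n) := by
      rw [hμ]; field_simp
    rw [e, abs_mul, abs_of_pos (by positivity)]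
    calc (u ^ k * ewensMass θ k) *
          |ewensSum θ k G / ewensMass θ k - ewensSum θ n G / ewensMass θ n|
        ≤ (u ^ k * ewensMass θ k) * (K * J * (2 + (2 * (θ / n * k) - cycleMean θ k +
            cycleMean θ n))) := by
          gcongr
          exact h1.trans (by gcongr)
      _ = B k := by rw [hB]; ring
  have sD : Summable (fun k => u ^ k * ewensSum θ k G - μ * (u ^ k * ewensMass θ k)) :=
    Summable.of_norm_bounded sB hbound
  have sG : Summable (fun k : ℕ => u ^ k * ewensSum θ k G) := by
    have := sD.add (s0.mul_left μ)
    simpa using this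
  refine ⟨sG, ?_⟩
  have e1 : (mixMass θ u)⁻¹ * ∑' k : ℕ, u ^ k * ewensSum θ k G - μ =
      (mixMass θ u)⁻¹ * ∑' k : ℕ, (u ^ k * ewensSum θ k G - μ * (u ^ k * ewensMass θ k)) := by
    rw [sG.tsum_sub (s0.mul_left μ), tsum_mul_left, ← mixMass, mul_sub]
    field_simp
  rw [e1, abs_mul, abs_of_pos (inv_pos.2 hZ), inv_mul_le_iff₀ hZ]
  calc |∑' k : ℕ, (u ^ k * ewensSum θ k G - μ * (u ^ k * ewensMass θ k))|
      ≤ ∑' k, B k := tsum_of_norm_bounded (f := fun k => u ^ k * ewensSum θ k G -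
          μ * (u ^ k * ewensMass θ k)) sB.hasSum hbound
    _ = K * J * ((2 + cycleMean θ n) * mixMass θ u + 2 * θ / n * (θ * u / (1 - u) * mixMass θ u) -
        θ * -Real.log (1 - u) * mixMass θ u) := by
        rw [hB, tsum_mul_left, ((s0.mul_left _).add (s1.mul_left _)).tsum_sub sH,
          (s0.mul_left _).tsum_add (s1.mul_left _), tsum_mul_left, tsum_mul_left,
          tsum_nat_mul_ewensMass hθ hu0 hu1, tsum_cycleMean hθ hu0 hu1, ← mixMass]
    _ ≤ mixMass θ u * (K * J * (3 + θ + 2 * θ ^ 2)) := by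
        -- The term θ log n in `cycleMean θ n` cancels against the mixture mean -θ log (1 - u) of
        -- `cycleMean θ k`; only a constant survives.
        have h3 := cycleMean_le hθ (by omega : 1 ≤ n)
        have h4 : 1 - u = (n : ℝ)⁻¹ := by rw [hu]; simp
        rw [h4, Real.log_inv]
        have h5 : 2 * θ / n * (θ * u / (n : ℝ)⁻¹ * mixMass θ u) =
            2 * θ ^ 2 * u * mixMass θ u := by field_simp
        rw [h5]
        have h6 : 2 * θ ^ 2 * u ≤ 2 * θ ^ 2 := by
          have : 0 ≤ 2 * θ ^ 2 := by positivity
          nlinarith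
        have h7 : K * J * ((2 + cycleMean θ n) * mixMass θ u + 2 * θ ^ 2 * u * mixMass θ u -
            θ * - -Real.log n * mixMass θ u) = mixMass θ u * (K * J * (2 + cycleMean θ n +
              2 * θ ^ 2 * u - θ * Real.log n)) := by ring
        rw [h7]
        gcongr
        linarith

end Mixture

/-! ### Means under the mixture and their size bias identity. -/

section MixtureMean

variable {θ u : ℝ}

/-- The mean of a function of the cycle lengths under the geometric mixture of the Ewens
measures. -/
def mixMean (θ u : ℝ) (F : Multiset ℕ → ℝ) : ℝ :=
  (mixMass θ u)⁻¹ * ∑' n : ℕ, u ^ n * ewensSum θ n F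

/-- Summability of the series that defines the mean `mixMean θ u |F|`. -/
def MixSummable (θ u : ℝ) (F : Multiset ℕ → ℝ) : Prop :=
  Summable fun n : ℕ => u ^ n * ewensSum θ n fun s => |F s|

lemma abs_ewensSum_le (hθ : 0 < θ) (n : ℕ) (F : Multiset ℕ → ℝ) :
    |ewensSum θ n F| ≤ ewensSum θ n fun s => |F s| := by
  unfold ewensSum
  refine (Finset.abs_sum_le_sum_abs _ _).trans_eq (Finset.sum_congr rfl fun p _ => ?_)
  rw [smul_eq_mul, abs_mul, abs_of_nonneg (partWeight_nonneg hθ _), smul_eq_mul]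

lemma ewensSum_mono (hθ : 0 < θ) (n : ℕ) {F G : Multiset ℕ → ℝ} (h : ∀ s, F s ≤ G s) :
    ewensSum θ n F ≤ ewensSum θ n G :=
  Finset.sum_le_sum fun _ _ => mul_le_mul_of_nonneg_left (h _) (partWeight_nonneg hθ _)

lemma ewensSum_nonneg (hθ : 0 < θ) (n : ℕ) {F : Multiset ℕ → ℝ} (h : ∀ s, 0 ≤ F s) :
    0 ≤ ewensSum θ n F :=
  Finset.sum_nonneg fun _ _ => mul_nonneg (partWeight_nonneg hθ _) (h _)

lemma MixSummable.summable {F : Multiset ℕ → ℝ} (hF : MixSummable θ u F) (hθ : 0 < θ)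
    (hu : 0 < u) : Summable fun n : ℕ => u ^ n * ewensSum θ n F := by
  refine Summable.of_norm_bounded hF fun n => ?_
  rw [norm_mul, Real.norm_of_nonneg (by positivity : 0 ≤ u ^ n)]
  exact mul_le_mul_of_nonneg_left (abs_ewensSum_le hθ n F) (by positivity)

lemma MixSummable.mono {F G : Multiset ℕ → ℝ} (hG : MixSummable θ u G) (hθ : 0 < θ)
    (hu : 0 < u) (h : ∀ s, |F s| ≤ |G s|) : MixSummable θ u F :=
  Summable.of_nonneg_of_le
    (fun n => mul_nonneg (by positivity) (ewensSum_nonneg hθ n fun _ => abs_nonneg _))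
    (fun n => mul_le_mul_of_nonneg_left (ewensSum_mono hθ n h) (by positivity)) hG

lemma ewensSum_add {E : Type*} [NormedAddCommGroup E] [NormedSpace ℝ E] (n : ℕ)
    (F G : Multiset ℕ → E) :
    ewensSum θ n (fun s => F s + G s) = ewensSum θ n F + ewensSum θ n G := by
  simp [ewensSum, Finset.sum_add_distrib]

lemma ewensSum_const_mul (n : ℕ) (c : ℝ) (F : Multiset ℕ → ℝ) :
    ewensSum θ n (fun s => c * F s) = c * ewensSum θ n F := by
  simp only [ewensSum, Finset.mul_sum, smul_eq_mul]
  exact Finset.sum_congr rfl fun p _ => by ring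

lemma MixSummable.add {F G : Multiset ℕ → ℝ} (hF : MixSummable θ u F) (hG : MixSummable θ u G)
    (hθ : 0 < θ) (hu : 0 < u) : MixSummable θ u fun s => F s + G s := by
  have h : Summable fun n : ℕ => u ^ n * ewensSum θ n fun s => |F s| + |G s| := by
    simp only [ewensSum_add, mul_add]
    exact Summable.add hF hG
  exact Summable.of_nonneg_of_le
    (fun n => mul_nonneg (by positivity) (ewensSum_nonneg hθ n fun _ => abs_nonneg _))
    (fun n => mul_le_mul_of_nonneg_left (ewensSum_mono hθ n fun s => abs_add_le _ _)
      (by positivity)) h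

lemma MixSummable.const_mul {F : Multiset ℕ → ℝ} (hF : MixSummable θ u F) (c : ℝ) :
    MixSummable θ u fun s => c * F s := by
  have h : Summable fun n : ℕ => |c| * (u ^ n * ewensSum θ n fun s => |F s|) :=
    Summable.mul_left _ hF
  refine h.congr fun n => ?_
  rw [← mul_left_comm, ← ewensSum_const_mul]
  simp only [abs_mul]

lemma mixSummable_of_bounded (hθ : 0 < θ) (hu : 0 < u) (hu1 : u < 1) {F : Multiset ℕ → ℝ} {c : ℝ}
    (h : ∀ s, |F s| ≤ c) : MixSummable θ u F := by
  refine Summable.of_nonneg_of_le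
    (fun n => mul_nonneg (by positivity) (ewensSum_nonneg hθ n fun _ => abs_nonneg _))
    (fun n => ?_) ((summable_ewensMass hθ hu hu1).mul_left c)
  have := norm_ewensSum_le (n := n) (F := fun s => |F s|) hθ (c := c)
    (fun s => by rw [Real.norm_eq_abs, abs_abs]; exact h s)
  calc u ^ n * ewensSum θ n (fun s => |F s|) ≤ u ^ n * (c * ewensMass θ n) := by
        gcongr
        exact (le_abs_self _).trans this
    _ = _ := by ring

lemma mixMean_add {F G : Multiset ℕ → ℝ} (hF : MixSummable θ u F) (hG : MixSummable θ u G)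
    (hθ : 0 < θ) (hu : 0 < u) :
    mixMean θ u (fun s => F s + G s) = mixMean θ u F + mixMean θ u G := by
  unfold mixMean
  rw [← mul_add, ← (hF.summable hθ hu).tsum_add (hG.summable hθ hu)]
  simp only [ewensSum_add, mul_add]

lemma mixMean_const_mul (c : ℝ) (F : Multiset ℕ → ℝ) :
    mixMean θ u (fun s => c * F s) = c * mixMean θ u F := by
  unfold mixMean
  simp only [ewensSum_const_mul]
  rw [← tsum_mul_left, ← tsum_mul_left, ← tsum_mul_left]
  exact tsum_congr fun n => by ring

lemma mixMean_one (hθ : 0 < θ) (hu : 0 < u) (hu1 : u < 1) :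
    mixMean θ u (fun _ => 1) = 1 := by
  unfold mixMean
  simp only [ewensSum_one]
  exact inv_mul_cancel₀ (mixMass_pos hθ hu hu1).ne'

lemma hasSum_antidiagonal {f : ℕ × ℕ → ℝ} (hf : Summable f) :
    Summable (fun n => ∑ p ∈ Finset.HasAntidiagonal.antidiagonal n, f p) ∧
      ∑' n, ∑ p ∈ Finset.HasAntidiagonal.antidiagonal n, f p = ∑' m, ∑' k, f (m, k) := by
  have h1 : Summable fun x : Σ n : ℕ, Finset.HasAntidiagonal.antidiagonal n => f x.2 :=
    (Finset.HasAntidiagonal.sigmaAntidiagonalEquivProd (A := ℕ)).summable_iff.2 hf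
  have h2 : ∀ n, ∑' p : Finset.HasAntidiagonal.antidiagonal n, f p = ∑ p ∈ Finset.HasAntidiagonal.antidiagonal n, f p := fun n => by
    rw [tsum_fintype, Finset.sum_coe_sort]
  refine ⟨?_, ?_⟩
  · have := h1.sigma
    simpa only [h2] using this
  · rw [← hf.tsum_prod, ← (Finset.HasAntidiagonal.sigmaAntidiagonalEquivProd (A := ℕ)).tsum_eq, ← tsum_congr h2]
    exact h1.tsum_sigma.symm

/-- The size bias identity for the geometric mixture: the cycle counts behave as independent
Poisson variables with parameters `θ u ^ m / m`. -/
lemma mixMean_apply_sum {V : Type*} [NormedAddCommGroup V] [NormedSpace ℝ V] (hθ : 0 < θ)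
    (hu : 0 < u) (hu1 : u < 1) {H : Multiset ℕ → V →L[ℝ] ℝ} {a : ℕ → V} {K : ℝ}
    (hH : ∀ s, ‖H s‖ ≤ K) (ha : Summable fun m : ℕ => θ * u ^ m / m * ‖a m‖) :
    Summable (fun n : ℕ => u ^ n * ewensSum θ n fun s => H s (s.map a).sum) ∧
    mixMean θ u (fun s => H s (s.map a).sum) =
      ∑' m : ℕ, θ * u ^ m / m * mixMean θ u fun s => H (m ::ₘ s) (a m) := by
  set f : ℕ × ℕ → ℝ := fun p =>
    θ * u ^ p.1 / p.1 * (u ^ p.2 * ewensSum θ p.2 fun s => H (p.1 ::ₘ s) (a p.1)) with hf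
  have hbd : ∀ m k, ‖f (m, k)‖ ≤ (K * (θ * u ^ m / m * ‖a m‖)) * (u ^ k * ewensMass θ k) := by
    intro m k
    have h1 : ‖ewensSum θ k fun s => H (m ::ₘ s) (a m)‖ ≤ K * ‖a m‖ * ewensMass θ k :=
      norm_ewensSum_le hθ fun s => (H (m ::ₘ s)).le_of_opNorm_le (hH _) _
    simp only [hf]
    rw [norm_mul, norm_mul, Real.norm_of_nonneg (by positivity : 0 ≤ θ * u ^ m / m),
      Real.norm_of_nonneg (by positivity : 0 ≤ u ^ k)]
    calc θ * u ^ m / m * (u ^ k * ‖ewensSum θ k fun s => H (m ::ₘ s) (a m)‖)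
        ≤ θ * u ^ m / m * (u ^ k * (K * ‖a m‖ * ewensMass θ k)) := by gcongr
      _ = _ := by ring
  have hprod : Summable fun p : ℕ × ℕ =>
      (K * (θ * u ^ p.1 / p.1 * ‖a p.1‖)) * (u ^ p.2 * ewensMass θ p.2) := by
    have hK : 0 ≤ K := (norm_nonneg _).trans (hH 0)
    have h2 : ∀ m : ℕ, 0 ≤ K * (θ * u ^ m / m * ‖a m‖) := fun m => by positivity
    have h3 : ∀ k : ℕ, 0 ≤ u ^ k * ewensMass θ k := fun k => by
      have := ewensMass_pos hθ k
      positivity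
    exact Summable.mul_of_nonneg (f := fun m : ℕ => K * (θ * u ^ m / m * ‖a m‖))
      (g := fun k : ℕ => u ^ k * ewensMass θ k) (ha.mul_left K) (summable_ewensMass hθ hu hu1) h2 h3
  have hsum : Summable f := Summable.of_norm_bounded hprod fun p => hbd p.1 p.2
  -- The size bias identity at order n is a convolution over pairs (m, n - m), so the sum over n
  -- becomes a free double sum over m and the remaining order. The term m = 0 vanishes through
  -- division by zero.
  have hanti : ∀ n, u ^ n * ewensSum θ n (fun s => H s (s.map a).sum) =
      ∑ p ∈ Finset.HasAntidiagonal.antidiagonal n, f p := by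
    intro n
    rw [ewensSum_apply_sum, Finset.Nat.sum_antidiagonal_eq_sum_range_succ_mk,
      Finset.mul_sum, Finset.range_eq_Ico, Finset.sum_eq_sum_Ico_succ_bot (by omega)]
    simp only [hf, Nat.cast_zero, div_zero, zero_mul, zero_add]
    refine Finset.sum_congr rfl fun m hm => ?_
    have hm' := Finset.mem_Icc.1 hm
    have : u ^ n = u ^ m * u ^ (n - m) := by rw [← pow_add]; congr 1; omega
    rw [this, smul_eq_mul]
    ring
  obtain ⟨h1, h2⟩ := hasSum_antidiagonal hsum
  refine ⟨h1.congr fun n => (hanti n).symm, ?_⟩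
  unfold mixMean
  rw [tsum_congr hanti, h2, ← tsum_mul_left]
  refine tsum_congr fun m => ?_
  simp only [hf]
  rw [tsum_mul_left]
  ring

lemma mixSummable_sum {V : Type*} [NormedAddCommGroup V] [NormedSpace ℝ V] (hθ : 0 < θ)
    (hu : 0 < u) (hu1 : u < 1) {a : ℕ → V} (ha : Summable fun m : ℕ => θ * u ^ m / m * ‖a m‖) :
    MixSummable θ u fun s => ‖(s.map a).sum‖ := by
  have h := (mixMean_apply_sum hθ hu hu1 (H := fun _ => ContinuousLinearMap.id ℝ ℝ)
    (a := fun m => ‖a m‖) (K := 1) (fun _ => ContinuousLinearMap.norm_id_le)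
    (by simpa using ha)).1
  refine Summable.of_nonneg_of_le
    (fun n => mul_nonneg (by positivity) (ewensSum_nonneg hθ n fun _ => abs_nonneg _))
    (fun n => mul_le_mul_of_nonneg_left (ewensSum_mono hθ n fun s => ?_) (by positivity)) h
  rw [abs_norm]
  refine (Multiset.le_sum_of_subadditive (fun v : V => ‖v‖) norm_zero.le
    (fun x y => norm_add_le x y) _).trans_eq ?_
  simp [Multiset.map_map]

end MixtureMean

/-! ### The law of an additive functional under the mixture and its Stein identity. -/

section MixtureMeasure

variable {θ u : ℝ} {V : Type*} [MeasurableSpace V]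

/-- The law of `X` under the geometric mixture of the Ewens measures. -/
def mixMeasure (θ u : ℝ) (X : Multiset ℕ → V) : Measure V :=
  Measure.sum fun i : Σ n : ℕ, n.Partition =>
    ENNReal.ofReal ((mixMass θ u)⁻¹ * (u ^ i.1 * partWeight θ i.2.parts)) •
      Measure.dirac (X i.2.parts)

lemma mix_weight_nonneg (hθ : 0 < θ) (hu : 0 < u) (hu1 : u < 1) (i : Σ n : ℕ, n.Partition) :
    0 ≤ (mixMass θ u)⁻¹ * (u ^ i.1 * partWeight θ i.2.parts) := by
  have := mixMass_pos hθ hu hu1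
  have := partWeight_nonneg hθ i.2.parts
  positivity

lemma summable_mix (hθ : 0 < θ) (hu : 0 < u) {F : Multiset ℕ → ℝ} (hF : MixSummable θ u F) :
    Summable fun i : Σ n : ℕ, n.Partition =>
      ((mixMass θ u)⁻¹ * (u ^ i.1 * partWeight θ i.2.parts)) * |F i.2.parts| := by
  have h : Summable fun i : Σ n : ℕ, n.Partition =>
      (u ^ i.1 * partWeight θ i.2.parts) * |F i.2.parts| := by
    refine (summable_sigma_of_nonneg fun i => ?_).2 ⟨fun n => Summable.of_finite, ?_⟩
    · have := partWeight_nonneg hθ i.2.parts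
      positivity
    · refine Summable.congr hF fun n => ?_
      rw [tsum_fintype, ewensSum, Finset.mul_sum]
      exact Finset.sum_congr rfl fun p _ => by rw [smul_eq_mul]; ring
  refine (h.mul_left (mixMass θ u)⁻¹).congr fun i => ?_
  ring

lemma integrable_mixMeasure {E : Type*} [NormedAddCommGroup E] [MeasurableSingletonClass V]
    (hθ : 0 < θ) (hu : 0 < u) (hu1 : u < 1) {X : Multiset ℕ → V} {g : V → E}
    (hg : MixSummable θ u fun s => ‖g (X s)‖) : Integrable g (mixMeasure θ u X) := by
  refine (integrable_sum_dirac_iff fun i => by simp).2 ?_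
  refine (summable_mix hθ hu hg).congr fun i => ?_
  rw [ENNReal.toReal_ofReal (mix_weight_nonneg hθ hu hu1 i), abs_norm]

lemma integral_mixMeasure [MeasurableSingletonClass V] (hθ : 0 < θ) (hu : 0 < u) (hu1 : u < 1)
    {X : Multiset ℕ → V} {g : V → ℝ} (hg : MixSummable θ u fun s => g (X s)) :
    ∫ v, g v ∂(mixMeasure θ u X) = mixMean θ u fun s => g (X s) := by
  have hs := summable_mix hθ hu hg
  rw [mixMeasure, integral_sum_dirac fun i => by simp]
  have h1 : ∀ i : Σ n : ℕ, n.Partition,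
      (ENNReal.ofReal ((mixMass θ u)⁻¹ * (u ^ i.1 * partWeight θ i.2.parts))).toReal •
        g (X i.2.parts) =
      ((mixMass θ u)⁻¹ * (u ^ i.1 * partWeight θ i.2.parts)) * g (X i.2.parts) := fun i => by
    rw [ENNReal.toReal_ofReal (mix_weight_nonneg hθ hu hu1 i), smul_eq_mul]
  rw [tsum_congr h1]
  have h2 : Summable fun i : Σ n : ℕ, n.Partition =>
      ((mixMass θ u)⁻¹ * (u ^ i.1 * partWeight θ i.2.parts)) * g (X i.2.parts) :=
    Summable.of_norm_bounded hs fun i => by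
      rw [norm_mul, Real.norm_of_nonneg (mix_weight_nonneg hθ hu hu1 i), Real.norm_eq_abs]
  rw [h2.tsum_sigma, mixMean, ← tsum_mul_left]
  refine tsum_congr fun n => ?_
  rw [tsum_fintype, ewensSum, Finset.mul_sum, Finset.mul_sum]
  exact Finset.sum_congr rfl fun p _ => by rw [smul_eq_mul]; ring

lemma isProbabilityMeasure_mixMeasure [MeasurableSingletonClass V] (hθ : 0 < θ) (hu : 0 < u)
    (hu1 : u < 1) (X : Multiset ℕ → V) : IsProbabilityMeasure (mixMeasure θ u X) := by
  have hb : MixSummable θ u fun _ => 1 :=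
    mixSummable_of_bounded (c := 1) hθ hu hu1 fun _ => by simp
  have h1 : Integrable (fun _ : V => (1 : ℝ)) (mixMeasure θ u X) :=
    integrable_mixMeasure hθ hu hu1 (by simpa using hb)
  have h2 := integral_mixMeasure (X := X) (g := fun _ => 1) hθ hu hu1 hb
  rw [mixMean_one hθ hu hu1, integral_const, smul_eq_mul, mul_one] at h2
  rw [integrable_const_iff] at h1
  have hfin : IsFiniteMeasure (mixMeasure θ u X) := by simpa using h1
  exact ⟨by
    rw [← ENNReal.toReal_eq_one_iff]
    exact h2⟩

/-- The Stein identity of a centred additive functional of the cycle lengths under the geometric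
mixture of the Ewens measures. -/
lemma mixMeasure_stein [NormedAddCommGroup V] [NormedSpace ℝ V] [MeasurableSingletonClass V]
    [CompleteSpace V] (hθ : 0 < θ) (hu : 0 < u)
    (hu1 : u < 1) {a : ℕ → V} (ha : Summable fun m : ℕ => θ * u ^ m / m * ‖a m‖) (c : ℝ)
    {X : Multiset ℕ → V}
    (hX : ∀ s, X s = c • ((s.map a).sum - ∑' m : ℕ, (θ * u ^ m / m) • a m)) :
    Integrable (fun v => v) (mixMeasure θ u X) ∧
    ∀ (H : V → V →L[ℝ] ℝ) (K : ℝ), (∀ v, ‖H v‖ ≤ K) →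
      ∫ v, H v v ∂(mixMeasure θ u X) = ∑' m : ℕ, θ * u ^ m / m *
        ∫ v, (H (v + c • a m) - H v) (c • a m) ∂(mixMeasure θ u X) := by
  set κ := ∑' m : ℕ, (θ * u ^ m / m) • a m with hκ
  have hb : ∀ {F : Multiset ℕ → ℝ} {C : ℝ}, (∀ s, |F s| ≤ C) → MixSummable θ u F :=
    fun h => mixSummable_of_bounded hθ hu hu1 h
  have hA := mixSummable_sum hθ hu hu1 ha
  have hXn : MixSummable θ u fun s => ‖X s‖ := by
    have h1 : MixSummable θ u fun s => |c| * (‖(s.map a).sum‖ + ‖κ‖) :=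
      (hA.add (hb (F := fun _ => ‖κ‖) (C := ‖κ‖) fun _ => by simp) hθ hu).const_mul _
    refine h1.mono hθ hu fun s => ?_
    rw [abs_norm, hX, norm_smul, Real.norm_eq_abs, abs_mul, abs_abs,
      abs_of_nonneg (by positivity : 0 ≤ ‖(s.map a).sum‖ + ‖κ‖)]
    exact mul_le_mul_of_nonneg_left (norm_sub_le _ _) (abs_nonneg _)
  refine ⟨integrable_mixMeasure hθ hu hu1 hXn, fun H K hH => ?_⟩
  have hK : 0 ≤ K := (norm_nonneg _).trans (hH 0)
  have happ : ∀ v w, |H v w| ≤ K * ‖w‖ := fun v w => (H v).le_of_opNorm_le (hH v) w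
  have hsκ : Summable fun m : ℕ => (θ * u ^ m / m) • a m := by
    refine Summable.of_norm (ha.congr fun m => ?_)
    rw [norm_smul, Real.norm_of_nonneg (by positivity)]
  have hS : MixSummable θ u fun s => H (X s) (s.map a).sum :=
    (hA.const_mul K).mono hθ hu fun s => by
      rw [abs_of_nonneg (by positivity : 0 ≤ K * ‖(s.map a).sum‖)]
      exact happ _ _
  have hκs : ∀ w, MixSummable θ u fun s => H (X s) w := fun w => hb fun s => happ _ w
  have hκs' : ∀ m, MixSummable θ u fun s => H (X (m ::ₘ s)) (a m) :=
    fun m => hb fun s => happ _ (a m)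
  rw [integral_mixMeasure hθ hu hu1 ((hXn.const_mul K).mono hθ hu fun s => by
    rw [abs_of_nonneg (by positivity : 0 ≤ K * ‖X s‖)]
    exact happ _ _)]
  have e1 : mixMean θ u (fun s => H (X s) (X s)) =
      c * (mixMean θ u (fun s => H (X s) (s.map a).sum) +
        (-1) * mixMean θ u fun s => H (X s) κ) := by
    rw [← mixMean_const_mul (-1), ← mixMean_add hS ((hκs κ).const_mul _) hθ hu,
      ← mixMean_const_mul]
    congr 1
    ext s
    conv_lhs => rw [show H (X s) (X s) = H (X s) (c • ((s.map a).sum - κ)) by rw [← hX s]]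
    rw [map_smul, map_sub, smul_eq_mul]
    ring
  -- The centring κ is an infinite sum. The mean of H (X) w is a bounded linear functional of w, so
  -- it may be expanded termwise to match the size bias series.
  have e2 : mixMean θ u (fun s => H (X s) κ) =
      ∑' m : ℕ, θ * u ^ m / m * mixMean θ u fun s => H (X s) (a m) := by
    let Λ : V →L[ℝ] ℝ := LinearMap.mkContinuous
      { toFun := fun w => mixMean θ u fun s => H (X s) w
        map_add' := fun w w' => by
          simp only [map_add]
          exact mixMean_add (hκs w) (hκs w') hθ hu
        map_smul' := fun r w => by
          simp only [map_smul, smul_eq_mul, RingHom.id_apply]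
          exact mixMean_const_mul _ _ } K fun w => by
        have hZ := mixMass_pos hθ hu hu1
        simp only [LinearMap.coe_mk, AddHom.coe_mk, mixMean]
        rw [norm_mul, Real.norm_of_nonneg (inv_pos.2 hZ).le, inv_mul_le_iff₀ hZ]
        refine (tsum_of_norm_bounded (((summable_ewensMass hθ hu hu1).mul_left (K * ‖w‖)).hasSum)
          fun n => ?_).trans_eq (by rw [tsum_mul_left, ← mixMass]; ring)
        rw [norm_mul, Real.norm_of_nonneg (by positivity : 0 ≤ u ^ n)]
        calc u ^ n * ‖ewensSum θ n fun s => H (X s) w‖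
            ≤ u ^ n * (K * ‖w‖ * ewensMass θ n) := by
              gcongr
              exact norm_ewensSum_le hθ fun s => happ _ _
          _ = _ := by ring
    have h := Λ.map_tsum hsκ
    rw [← hκ] at h
    refine h.trans (tsum_congr fun m => ?_)
    rw [map_smul, smul_eq_mul]
    rfl
  have hbd : ∀ {F : Multiset ℕ → ℝ} {C : ℝ}, (∀ s, |F s| ≤ C) → |mixMean θ u F| ≤ C := by
    intro F C h
    have hZ := mixMass_pos hθ hu hu1
    rw [mixMean, abs_mul, abs_of_pos (inv_pos.2 hZ), inv_mul_le_iff₀ hZ]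
    refine (tsum_of_norm_bounded (f := fun n : ℕ => u ^ n * ewensSum θ n F)
      (((summable_ewensMass hθ hu hu1).mul_left C).hasSum)
      fun n => ?_).trans_eq (by rw [tsum_mul_left, ← mixMass]; ring)
    rw [norm_mul, Real.norm_of_nonneg (by positivity : 0 ≤ u ^ n)]
    calc u ^ n * ‖ewensSum θ n F‖ ≤ u ^ n * (C * ewensMass θ n) := by
          gcongr
          exact norm_ewensSum_le hθ h
      _ = _ := by ring
  have hsm : ∀ F : ℕ → Multiset ℕ → ℝ, (∀ m s, |F m s| ≤ K * ‖a m‖) →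
      Summable fun m : ℕ => θ * u ^ m / m * mixMean θ u (F m) := by
    intro F hF
    refine Summable.of_norm_bounded (ha.mul_left K) fun m => ?_
    rw [norm_mul, Real.norm_of_nonneg (by positivity : 0 ≤ θ * u ^ m / m), mul_left_comm]
    exact mul_le_mul_of_nonneg_left (hbd (hF m)) (by positivity)
  rw [e1, e2, (mixMean_apply_sum hθ hu hu1 (H := fun s => H (X s)) (fun s => hH _) ha).2,
    ← tsum_mul_left, ← (hsm (fun m s => H (X (m ::ₘ s)) (a m)) fun m s => happ _ _).tsum_add
      ((hsm (fun m s => H (X s) (a m)) fun m s => happ _ _).mul_left _), ← tsum_mul_left]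
  refine tsum_congr fun m => ?_
  -- Adding a cycle translates X by a jump, which turns the size bias identity into a difference
  -- operator.
  have hXm : ∀ s, X (m ::ₘ s) = X s + c • a m := fun s => by
    rw [hX, hX, Multiset.map_cons, Multiset.sum_cons, ← smul_add]
    congr 1
    abel
  have e3 : (fun s => (H (X s + c • a m) - H (X s)) (c • a m)) =
      fun s => c * (H (X (m ::ₘ s)) (a m) + (-1) * H (X s) (a m)) := by
    ext s
    rw [hXm, map_smul, _root_.sub_apply, smul_eq_mul]
    ring
  have hMS : MixSummable θ u fun s => c * (H (X (m ::ₘ s)) (a m) + (-1) * H (X s) (a m)) :=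
    ((hκs' m).add ((hκs (a m)).const_mul _) hθ hu).const_mul _
  rw [integral_mixMeasure hθ hu hu1 (by rw [e3]; exact hMS), e3, mixMean_const_mul,
    mixMean_add (hκs' m) ((hκs (a m)).const_mul _) hθ hu, mixMean_const_mul]
  ring

end MixtureMeasure

/-! ### The standard normal law on the line: translations and integration by parts. -/

section GaussianLine

/-- The standard normal distribution on the line. -/
abbrev stdNormal : Measure ℝ := gaussianReal 0 1

lemma gaussianPDFReal_shift (w x : ℝ) :
    gaussianPDFReal w 1 x = gaussianPDFReal 0 1 x * Real.exp (w * x - w ^ 2 / 2) := by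
  rw [gaussianPDFReal, gaussianPDFReal, mul_assoc _ (Real.exp _), ← Real.exp_add]
  congr 2
  simp
  ring

/-- The exponential is the density of the translated law with respect to the original one. -/
lemma integral_stdNormal_shift (k : ℝ → ℝ) (w : ℝ) :
    ∫ z, k (z + w) ∂stdNormal = ∫ z, Real.exp (w * z - w ^ 2 / 2) * k z ∂stdNormal := by
  have h1 : ∫ z, k (z + w) ∂stdNormal = ∫ z, k z ∂(gaussianReal w 1) := by
    have := gaussianReal_map_add_const (μ := 0) (v := 1) w
    rw [zero_add] at this
    rw [← this]
    exact ((measurableEmbedding_addRight w).integral_map k).symm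
  rw [h1, integral_gaussianReal_eq_integral_smul one_ne_zero,
    integral_gaussianReal_eq_integral_smul one_ne_zero]
  congr 1
  ext x
  rw [gaussianPDFReal_shift, smul_eq_mul, smul_eq_mul, mul_assoc]

lemma integrable_exp_abs_stdNormal (c : ℝ) :
    Integrable (fun z => Real.exp (c * |z|)) stdNormal := by
  have h1 := integrable_exp_mul_gaussianReal (μ := 0) (v := 1) c
  have h2 := integrable_exp_mul_gaussianReal (μ := 0) (v := 1) (-c)
  refine (h1.add h2).mono' (by fun_prop) (Eventually.of_forall fun z => ?_)
  rw [Real.norm_of_nonneg (Real.exp_pos _).le]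
  simp only [Pi.add_apply]
  rcases abs_cases z with ⟨h, _⟩ | ⟨h, _⟩
  · rw [h]; linarith [Real.exp_pos (-c * z)]
  · rw [h, mul_neg, ← neg_mul]; linarith [Real.exp_pos (c * z)]

lemma abs_exp_sub_one_le (y : ℝ) : |Real.exp y - 1| ≤ |y| * Real.exp |y| := by
  rcases le_total 0 y with h | h
  · rw [abs_of_nonneg h, abs_of_nonneg (by linarith [Real.one_le_exp h])]
    have h1 := Real.one_sub_le_exp_neg y
    have h2 : Real.exp (-y) * Real.exp y = 1 := by rw [← Real.exp_add]; simp
    nlinarith [Real.exp_pos y]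
  · rw [abs_of_nonpos h, abs_of_nonpos (by linarith [Real.exp_le_one_iff.2 h])]
    have h1 := Real.add_one_le_exp y
    have h2 := Real.one_le_exp (neg_nonneg.2 h)
    nlinarith

/-- A translation by `w` changes the standard normal law by `O(|w|)` in total variation. -/
lemma exists_abs_integral_shift_le : ∃ C : ℝ, 0 ≤ C ∧ ∀ (k : ℝ → ℝ) (M w : ℝ), Measurable k →
    (∀ z, |k z| ≤ M) →
    |∫ z, k (z + w) ∂stdNormal - ∫ z, k z ∂stdNormal| ≤ C * M * |w| := by
  set I : ℝ := ∫ z, Real.exp (2 * |z|) ∂stdNormal with hI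
  have hI0 : 0 ≤ I := integral_nonneg fun z => (Real.exp_pos _).le
  refine ⟨2 + Real.exp 2 * I, by positivity, fun k M w hk hM => ?_⟩
  have hM0 : 0 ≤ M := (abs_nonneg _).trans (hM 0)
  have hki : ∀ {f : ℝ → ℝ}, Measurable f → (∀ z, |f z| ≤ M) → |∫ z, f z ∂stdNormal| ≤ M := by
    intro f _ hf
    have := norm_integral_le_of_norm_le_const (μ := stdNormal) (f := f) (C := M)
      (Eventually.of_forall hf)
    simpa using this
  -- For |w| ≤ 1 the deviation of the density ratio from 1 is at most |w| times a multiple of exp (2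
  -- |z|). For |w| ≥ 1 the trivial bound 2 M suffices, whence the summand 2 in the constant.
  rcases le_total |w| 1 with hw | hw
  · have i1 : Integrable (fun z => Real.exp (w * z - w ^ 2 / 2) * k z) stdNormal := by
      refine Integrable.mul_bdd (c := M) ?_ hk.aestronglyMeasurable (Eventually.of_forall hM)
      simp only [sub_eq_add_neg, Real.exp_add]
      exact (integrable_exp_mul_gaussianReal w).mul_const _
    have i2 : Integrable k stdNormal :=
      Integrable.of_bound hk.aestronglyMeasurable M (Eventually.of_forall hM)
    rw [integral_stdNormal_shift, ← integral_sub i1 i2]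
    calc |∫ z, (Real.exp (w * z - w ^ 2 / 2) * k z - k z) ∂stdNormal|
        ≤ ∫ z, |w| * M * Real.exp 2 * Real.exp (2 * |z|) ∂stdNormal := by
          refine norm_integral_le_of_norm_le (f := fun z =>
            Real.exp (w * z - w ^ 2 / 2) * k z - k z) ((integrable_exp_abs_stdNormal 2).const_mul _)
            (Eventually.of_forall fun z => ?_)
          have e : Real.exp (w * z - w ^ 2 / 2) * k z - k z =
            (Real.exp (w * z - w ^ 2 / 2) - 1) * k z := by ring
          rw [e, norm_mul, Real.norm_eq_abs, Real.norm_eq_abs]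
          have h1 := abs_exp_sub_one_le (w * z - w ^ 2 / 2)
          have h2 : |w * z - w ^ 2 / 2| ≤ |w| * (|z| + 1) := by
            refine (abs_sub _ _).trans ?_
            rw [abs_mul, abs_of_nonneg (by positivity : 0 ≤ w ^ 2 / 2), ← sq_abs w]
            nlinarith [abs_nonneg w, abs_nonneg z]
          have h3 : |w * z - w ^ 2 / 2| ≤ |z| + 1 :=
            h2.trans (mul_le_of_le_one_left (by positivity) hw)
          have h4 : |z| + 1 ≤ Real.exp (|z| + 1) := by linarith [Real.add_one_le_exp (|z| + 1)]
          have h5 : Real.exp 2 * Real.exp (2 * |z|) = Real.exp (|z| + 1) * Real.exp (|z| + 1) := by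
            rw [← Real.exp_add, ← Real.exp_add]; congr 1; ring
          calc |Real.exp (w * z - w ^ 2 / 2) - 1| * |k z|
              ≤ (|w * z - w ^ 2 / 2| * Real.exp |w * z - w ^ 2 / 2|) * M := by
                gcongr
                exact hM z
            _ ≤ (|w| * (|z| + 1) * Real.exp (|z| + 1)) * M := by gcongr
            _ ≤ (|w| * Real.exp (|z| + 1) * Real.exp (|z| + 1)) * M := by gcongr
            _ = |w| * M * Real.exp 2 * Real.exp (2 * |z|) := by
                rw [mul_assoc (|w| * M), h5]; ring
      _ = |w| * M * Real.exp 2 * I := by rw [integral_const_mul]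
      _ ≤ (2 + Real.exp 2 * I) * M * |w| := by
          have : 0 ≤ 2 * M * |w| := by positivity
          nlinarith
  · have h1 := hki (f := fun z => k (z + w)) (by fun_prop) (fun z => hM _)
    have h2 := hki hk hM
    calc |∫ z, k (z + w) ∂stdNormal - ∫ z, k z ∂stdNormal| ≤ M + M :=
          (abs_sub _ _).trans (add_le_add h1 h2)
      _ ≤ 2 * M * |w| := by nlinarith
      _ ≤ (2 + Real.exp 2 * I) * M * |w| := by
          gcongr
          have : 0 ≤ Real.exp 2 * I := by positivity
          linarith

lemma hasDerivAt_gaussianPDFReal (x : ℝ) :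
    HasDerivAt (gaussianPDFReal 0 1) (-(x * gaussianPDFReal 0 1 x)) x := by
  have h : gaussianPDFReal 0 1 = fun x => (Real.sqrt (2 * Real.pi))⁻¹ * Real.exp (-x ^ 2 / 2) := by
    ext x
    simp [gaussianPDFReal]
  rw [h]
  have h1 : HasDerivAt (fun x : ℝ => -x ^ 2 / 2) (-x) x :=
    (((hasDerivAt_pow 2 x).neg).div_const 2).congr_deriv (by push_cast; ring)
  exact ((h1.exp).const_mul (Real.sqrt (2 * Real.pi))⁻¹).congr_deriv (by ring)

/-- Gaussian integration by parts on the line. -/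
lemma integral_mul_stdNormal {F F' : ℝ → ℝ} {A B : ℝ} (hF : ∀ x, HasDerivAt F (F' x) x)
    (hF' : Measurable F') (hA : ∀ x, |F x| ≤ A) (hB : ∀ x, |F' x| ≤ B) :
    ∫ z, z * F z ∂stdNormal = ∫ z, F' z ∂stdNormal := by
  have hFm : Measurable F :=
    (continuous_iff_continuousAt.2 fun x => (hF x).continuousAt).measurable
  rw [integral_gaussianReal_eq_integral_smul one_ne_zero,
    integral_gaussianReal_eq_integral_smul one_ne_zero]
  simp only [smul_eq_mul]
  have i0 := integrable_gaussianPDFReal 0 1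
  have i1 : Integrable (fun x => x * gaussianPDFReal 0 1 x) := by
    have h1 := (memLp_id_gaussianReal (μ := 0) (v := 1) 1).integrable le_rfl
    rw [gaussianReal_of_var_ne_zero _ one_ne_zero,
      integrable_withDensity_iff_integrable_smul₀'
        (measurable_gaussianPDF 0 1).aemeasurable (Eventually.of_forall fun _ =>
          gaussianPDF_lt_top)] at h1
    refine h1.congr (Eventually.of_forall fun x => ?_)
    simp only [id, smul_eq_mul, toReal_gaussianPDF]
    ring
  have h := integral_mul_deriv_eq_deriv_mul_of_integrable (u := F) (v := gaussianPDFReal 0 1)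
    (u' := F') (v' := fun x => -(x * gaussianPDFReal 0 1 x)) (fun x _ => hF x)
    (fun x _ => hasDerivAt_gaussianPDFReal x)
    (i1.neg.bdd_mul (c := A) hFm.aestronglyMeasurable (Eventually.of_forall hA))
    (i0.bdd_mul (c := B) hF'.aestronglyMeasurable (Eventually.of_forall hB))
    (i0.bdd_mul (c := A) hFm.aestronglyMeasurable (Eventually.of_forall hA))
  calc ∫ x, gaussianPDFReal 0 1 x * (x * F x)
      = - ∫ x, F x * -(x * gaussianPDFReal 0 1 x) := by
        rw [← integral_neg]
        congr 1
        ext x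
        ring
    _ = ∫ x, F' x * gaussianPDFReal 0 1 x := by rw [h, neg_neg]
    _ = _ := by
        congr 1
        ext x
        ring

end GaussianLine

/-! ### The standard normal law on the plane. -/

section GaussianPlane

/-- The standard normal distribution on the plane. -/
abbrev stdNormal₂ : Measure (ℝ × ℝ) := stdNormal.prod stdNormal

lemma integrable_stdNormal₂_of_bounded {E : Type*} [NormedAddCommGroup E] {k : ℝ × ℝ → E} {M : ℝ}
    (hk : AEStronglyMeasurable k stdNormal₂) (hM : ∀ z, ‖k z‖ ≤ M) : Integrable k stdNormal₂ :=
  Integrable.of_bound hk M (Eventually.of_forall hM)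

/-- One coordinate is translated at a time; after integrating out the second, the function of the
first is still bounded by M. -/
lemma exists_abs_integral_shift₂_le : ∃ C : ℝ, 0 ≤ C ∧ ∀ (k : ℝ × ℝ → ℝ) (M : ℝ) (b : ℝ × ℝ),
    Measurable k → (∀ z, |k z| ≤ M) →
    |∫ z, k (z + b) ∂stdNormal₂ - ∫ z, k z ∂stdNormal₂| ≤ C * M * (|b.1| + |b.2|) := by
  obtain ⟨C, hC0, hC⟩ := exists_abs_integral_shift_le
  refine ⟨C, hC0, fun k M b hk hM => ?_⟩
  have hint : ∀ {f : ℝ × ℝ → ℝ}, Measurable f → (∀ z, |f z| ≤ M) → Integrable f stdNormal₂ :=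
    fun hf h => integrable_stdNormal₂_of_bounded hf.aestronglyMeasurable h
  have m1 : Measurable fun z : ℝ × ℝ => k (z + b) := by fun_prop
  have m2 : Measurable fun z : ℝ × ℝ => k (z.1 + b.1, z.2) := by fun_prop
  have i1 := hint m1 fun z => hM _
  have i2 := hint m2 fun z => hM _
  have i3 := hint hk hM
  rw [integral_prod _ i1, integral_prod _ i3]
  have s1 : |∫ z₁, ∫ z₂, k ((z₁, z₂) + b) ∂stdNormal ∂stdNormal -
      ∫ z₁, ∫ z₂, k (z₁ + b.1, z₂) ∂stdNormal ∂stdNormal| ≤ C * M * |b.2| := by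
    rw [← integral_sub i1.integral_prod_left i2.integral_prod_left]
    have := norm_integral_le_of_norm_le_const (μ := stdNormal) (C := C * M * |b.2|)
      (f := fun z₁ => ∫ z₂, k ((z₁, z₂) + b) ∂stdNormal - ∫ z₂, k (z₁ + b.1, z₂) ∂stdNormal)
      (Eventually.of_forall fun z₁ => hC (fun z₂ => k (z₁ + b.1, z₂)) M b.2 (by fun_prop)
        fun z => hM _)
    simpa using this
  have s2 : |∫ z₁, ∫ z₂, k (z₁ + b.1, z₂) ∂stdNormal ∂stdNormal -
      ∫ z₁, ∫ z₂, k (z₁, z₂) ∂stdNormal ∂stdNormal| ≤ C * M * |b.1| := by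
    refine hC (fun z₁ => ∫ z₂, k (z₁, z₂) ∂stdNormal) M b.1 ?_ fun z => ?_
    · exact (StronglyMeasurable.integral_prod_right' (f := k) hk.stronglyMeasurable).measurable
    · have := norm_integral_le_of_norm_le_const (μ := stdNormal) (C := M)
        (f := fun z₂ => k (z, z₂)) (Eventually.of_forall fun z₂ => hM _)
      simpa using this
  calc _ ≤ C * M * |b.2| + C * M * |b.1| := (abs_sub_le _ _ _).trans (add_le_add s1 s2)
    _ = _ := by ring

lemma integral_fst_mul_stdNormal₂ {F F' : ℝ × ℝ → ℝ} {A B : ℝ} (hFm : Measurable F)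
    (hF : ∀ x y, HasDerivAt (fun t => F (t, y)) (F' (x, y)) x) (hF' : Measurable F')
    (hA : ∀ x, |F x| ≤ A) (hB : ∀ x, |F' x| ≤ B) :
    ∫ z, z.1 * F z ∂stdNormal₂ = ∫ z, F' z ∂stdNormal₂ := by
  have i1 : Integrable (fun z : ℝ × ℝ => z.1 * F z) stdNormal₂ := by
    have : Integrable (fun z : ℝ => z) stdNormal :=
      (memLp_id_gaussianReal (μ := 0) (v := 1) 1).integrable le_rfl
    exact (this.comp_fst stdNormal).mul_bdd (c := A) hFm.aestronglyMeasurable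
      (Eventually.of_forall hA)
  have i2 : Integrable F' stdNormal₂ :=
    integrable_stdNormal₂_of_bounded hF'.aestronglyMeasurable hB
  rw [integral_prod_symm _ i1, integral_prod_symm _ i2]
  congr 1
  ext y
  exact integral_mul_stdNormal (fun x => hF x y) (by fun_prop) (fun x => hA _) (fun x => hB _)

lemma integral_snd_mul_stdNormal₂ {F F' : ℝ × ℝ → ℝ} {A B : ℝ} (hFm : Measurable F)
    (hF : ∀ x y, HasDerivAt (fun t => F (x, t)) (F' (x, y)) y) (hF' : Measurable F')
    (hA : ∀ x, |F x| ≤ A) (hB : ∀ x, |F' x| ≤ B) :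
    ∫ z, z.2 * F z ∂stdNormal₂ = ∫ z, F' z ∂stdNormal₂ := by
  have h := integral_fst_mul_stdNormal₂ (F := F ∘ Prod.swap) (F' := F' ∘ Prod.swap) (A := A)
    (B := B) (hFm.comp measurable_swap) (fun x y => hF y x) (hF'.comp measurable_swap)
    (fun x => hA _) (fun x => hB _)
  have hs : ∀ k : ℝ × ℝ → ℝ, ∫ z, k z.swap ∂stdNormal₂ = ∫ z, k z ∂stdNormal₂ := fun k =>
    integral_prod_swap k
  rw [← hs fun z => z.2 * F z, ← hs F']
  exact h

end GaussianPlane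

/-! ### Gaussian smoothing of functions with two bounded derivatives. -/

section Smoothing

variable {V : Type*} [NormedAddCommGroup V] [NormedSpace ℝ V]

/-- The vector with coordinates `z` in the system `r₁, r₂`. -/
def comb (r₁ r₂ : V) (z : ℝ × ℝ) : V := z.1 • r₁ + z.2 • r₂

@[fun_prop]
lemma continuous_comb (r₁ r₂ : V) : Continuous (comb r₁ r₂) := by
  unfold comb
  fun_prop

lemma comb_add (r₁ r₂ : V) (z b : ℝ × ℝ) : comb r₁ r₂ (z + b) = comb r₁ r₂ z + comb r₁ r₂ b := by
  simp only [comb, Prod.fst_add, Prod.snd_add, add_smul]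
  abel

lemma comb_smul (r₁ r₂ : V) (t : ℝ) (b : ℝ × ℝ) :
    comb r₁ r₂ (t • b) = t • comb r₁ r₂ b := by
  simp [comb, mul_smul]

/-- Twice continuously differentiable functions with bounded first and second derivative. -/
structure HasBoundedDerivs (g : V → ℝ) (K₁ K₂ : ℝ) : Prop where
  contDiff : ContDiff ℝ 2 g
  norm_fderiv_le : ∀ v, ‖fderiv ℝ g v‖ ≤ K₁
  norm_fderiv_fderiv_le : ∀ v, ‖fderiv ℝ (fderiv ℝ g) v‖ ≤ K₂

variable {g : V → ℝ} {K₁ K₂ : ℝ}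

namespace HasBoundedDerivs

lemma hasFDerivAt (h : HasBoundedDerivs g K₁ K₂) (v : V) : HasFDerivAt g (fderiv ℝ g v) v :=
  (h.contDiff.differentiable (by norm_num) v).hasFDerivAt

lemma contDiff_fderiv (h : HasBoundedDerivs g K₁ K₂) : ContDiff ℝ 1 (fderiv ℝ g) :=
  h.contDiff.fderiv_right (by norm_num)

lemma continuous_fderiv (h : HasBoundedDerivs g K₁ K₂) : Continuous (fderiv ℝ g) :=
  h.contDiff_fderiv.continuous

lemma continuous_fderiv_fderiv (h : HasBoundedDerivs g K₁ K₂) :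
    Continuous (fderiv ℝ (fderiv ℝ g)) :=
  h.contDiff_fderiv.continuous_fderiv (by norm_num)

lemma hasFDerivAt_fderiv (h : HasBoundedDerivs g K₁ K₂) (v : V) :
    HasFDerivAt (fderiv ℝ g) (fderiv ℝ (fderiv ℝ g) v) v :=
  (h.contDiff_fderiv.differentiable (by norm_num) v).hasFDerivAt

lemma continuous_fderiv_apply (h : HasBoundedDerivs g K₁ K₂) {T : Type*} [TopologicalSpace T]
    {φ : T → V} (hφ : Continuous φ) (a : V) : Continuous fun t => fderiv ℝ g (φ t) a :=
  (h.continuous_fderiv.comp hφ).clm_apply continuous_const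

lemma continuous_fderiv_fderiv_apply (h : HasBoundedDerivs g K₁ K₂) {T : Type*}
    [TopologicalSpace T] {φ : T → V} (hφ : Continuous φ) (a b : V) :
    Continuous fun t => fderiv ℝ (fderiv ℝ g) (φ t) a b :=
  ((h.continuous_fderiv_fderiv.comp hφ).clm_apply continuous_const).clm_apply continuous_const

lemma nonneg₁ (h : HasBoundedDerivs g K₁ K₂) : 0 ≤ K₁ :=
  (norm_nonneg _).trans (h.norm_fderiv_le 0)

lemma nonneg₂ (h : HasBoundedDerivs g K₁ K₂) : 0 ≤ K₂ :=
  (norm_nonneg (fderiv ℝ (fderiv ℝ g) 0)).trans (h.norm_fderiv_fderiv_le 0)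

lemma abs_fderiv_apply_le (h : HasBoundedDerivs g K₁ K₂) (v a : V) :
    |fderiv ℝ g v a| ≤ K₁ * ‖a‖ :=
  (fderiv ℝ g v).le_of_opNorm_le (h.norm_fderiv_le v) a

lemma abs_fderiv_fderiv_apply_le (h : HasBoundedDerivs g K₁ K₂) (v a b : V) :
    |fderiv ℝ (fderiv ℝ g) v a b| ≤ K₂ * ‖a‖ * ‖b‖ :=
  (fderiv ℝ (fderiv ℝ g) v a).le_of_opNorm_le
    ((fderiv ℝ (fderiv ℝ g) v).le_of_opNorm_le (h.norm_fderiv_fderiv_le v) a) b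

lemma hasDerivAt_line (h : HasBoundedDerivs g K₁ K₂) (y a w : V) (r : ℝ) :
    HasDerivAt (fun t : ℝ => fderiv ℝ g (y + t • a) w)
      (fderiv ℝ (fderiv ℝ g) (y + r • a) a w) r := by
  have h1 : HasDerivAt (fun t : ℝ => y + t • a) a r := by
    simpa using ((hasDerivAt_id r).smul_const a).const_add y
  have h2 := (h.hasFDerivAt_fderiv (y + r • a)).comp_hasDerivAt r h1
  exact h2.clm_apply (hasDerivAt_const r w) |>.congr_deriv (by simp)

lemma abs_sub_le (h : HasBoundedDerivs g K₁ K₂) (x y : V) : |g x - g y| ≤ K₁ * ‖x - y‖ :=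
  Convex.norm_image_sub_le_of_norm_hasFDerivWithin_le (s := Set.univ)
    (fun v _ => (h.hasFDerivAt v).hasFDerivWithinAt) (fun v _ => h.norm_fderiv_le v)
    convex_univ (Set.mem_univ y) (Set.mem_univ x)

lemma norm_fderiv_sub_le (h : HasBoundedDerivs g K₁ K₂) (x y : V) :
    ‖fderiv ℝ g x - fderiv ℝ g y‖ ≤ K₂ * ‖x - y‖ :=
  Convex.norm_image_sub_le_of_norm_hasFDerivWithin_le (s := Set.univ)
    (fun v _ => (h.hasFDerivAt_fderiv v).hasFDerivWithinAt)
    (fun v _ => h.norm_fderiv_fderiv_le v)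
    convex_univ (Set.mem_univ y) (Set.mem_univ x)

end HasBoundedDerivs

/-- The constant in the total variation bound for translates of the standard normal law. -/
def shiftConst : ℝ := exists_abs_integral_shift₂_le.choose

lemma shiftConst_nonneg : 0 ≤ shiftConst := exists_abs_integral_shift₂_le.choose_spec.1

/-- Second order expansion of the Gaussian smoothing of `fderiv ℝ g`, in a direction in which the
Gaussian law is not degenerate: only two derivatives of `g` are needed. -/
lemma abs_smooth_taylor_le (h : HasBoundedDerivs g K₁ K₂)
    (r₁ r₂ y : V) (b : ℝ × ℝ) {c τ : ℝ} (hc : 0 < c) (hτ : 0 ≤ τ) :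
    |∫ z, (fderiv ℝ g (y + τ • comb r₁ r₂ b + c • comb r₁ r₂ z) (comb r₁ r₂ b) -
        fderiv ℝ g (y + c • comb r₁ r₂ z) (comb r₁ r₂ b)) ∂stdNormal₂ -
      τ * ∫ z, fderiv ℝ (fderiv ℝ g) (y + c • comb r₁ r₂ z) (comb r₁ r₂ b) (comb r₁ r₂ b)
        ∂stdNormal₂| ≤
      shiftConst * (K₂ * ‖comb r₁ r₂ b‖ * ‖comb r₁ r₂ b‖) * (τ / c * (|b.1| + |b.2|)) * τ := by
  have hC0 := shiftConst_nonneg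
  have hC := exists_abs_integral_shift₂_le.choose_spec.2
  change ∀ (k : ℝ × ℝ → ℝ) (M : ℝ) (b : ℝ × ℝ), Measurable k → (∀ z, |k z| ≤ M) →
    |∫ z, k (z + b) ∂stdNormal₂ - ∫ z, k z ∂stdNormal₂| ≤
      shiftConst * M * (|b.1| + |b.2|) at hC
  set C := shiftConst
  obtain ⟨a, ha⟩ : ∃ a, a = comb r₁ r₂ b := ⟨_, rfl⟩
  rw [← ha]
  set M := K₂ * ‖a‖ * ‖a‖ with hM
  have hM0 : 0 ≤ M := by have := h.nonneg₂; positivity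
  set φ : ℝ → ℝ := fun r => ∫ z, fderiv ℝ g (y + r • a + c • comb r₁ r₂ z) a ∂stdNormal₂ with hφ
  set ψ : ℝ → ℝ := fun r =>
    ∫ z, fderiv ℝ (fderiv ℝ g) (y + r • a + c • comb r₁ r₂ z) a a ∂stdNormal₂ with hψ
  have hint : ∀ r : ℝ, Integrable (fun z => fderiv ℝ g (y + r • a + c • comb r₁ r₂ z) a)
      stdNormal₂ := fun r => by
    refine integrable_stdNormal₂_of_bounded (M := K₁ * ‖a‖) ?_
      fun z => h.abs_fderiv_apply_le _ _
    exact (h.continuous_fderiv_apply (by fun_prop) _).aestronglyMeasurable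
  have hderiv : ∀ r, HasDerivAt φ (ψ r) r := by
    intro r
    refine (hasDerivAt_integral_of_dominated_loc_of_deriv_le (s := Set.univ) (bound := fun _ => M)
      (F' := fun r z => fderiv ℝ (fderiv ℝ g) (y + r • a + c • comb r₁ r₂ z) a a)
      Filter.univ_mem (Eventually.of_forall fun r => (hint r).aestronglyMeasurable) (hint r)
      (h.continuous_fderiv_fderiv_apply (by fun_prop) _ _).aestronglyMeasurable
      (Eventually.of_forall fun z r _ => h.abs_fderiv_fderiv_apply_le _ _ _)
      (integrable_const _) (Eventually.of_forall fun z r _ => ?_)).2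
    have h1 := h.hasDerivAt_line (y + c • comb r₁ r₂ z) a a r
    simpa only [add_right_comm] using h1
  -- Since a has coordinates b, a translation by r • a is a translation of the Gaussian variable by
  -- (r / c) • b. Its total variation cost takes the place of a third derivative of g.
  have hbound : ∀ r, 0 ≤ r → r ≤ τ → |ψ r - ψ 0| ≤ C * M * (τ / c * (|b.1| + |b.2|)) := by
    intro r hr0 hr
    have h1 := hC (fun z => fderiv ℝ (fderiv ℝ g) (y + c • comb r₁ r₂ z) a a) M ((r / c) • b)
      (h.continuous_fderiv_fderiv_apply (by fun_prop) _ _).measurable fun z => h.abs_fderiv_fderiv_apply_le _ _ _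
    have e1 : ∀ z, y + c • comb r₁ r₂ (z + (r / c) • b) = y + r • a + c • comb r₁ r₂ z := by
      intro z
      rw [comb_add, comb_smul, smul_add, smul_smul, mul_div_cancel₀ _ hc.ne', ← ha]
      abel
    simp only [e1] at h1
    have e2 : ψ 0 = ∫ z, fderiv ℝ (fderiv ℝ g) (y + c • comb r₁ r₂ z) a a ∂stdNormal₂ := by
      simp [hψ]
    rw [e2]
    refine h1.trans ?_
    have hrc : 0 ≤ r / c := by positivity
    simp only [Prod.smul_fst, Prod.smul_snd, smul_eq_mul, abs_mul, abs_of_nonneg hrc]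
    rw [← mul_add]
    gcongr
  -- Mean value inequality for φ r - r ψ 0, whose derivative ψ r - ψ 0 has just been bounded.
  have hfin := norm_image_sub_le_of_norm_deriv_le_segment' (f := fun r => φ r - r * ψ 0)
    (f' := fun r => ψ r - ψ 0) (a := 0) (b := τ) (C := C * M * (τ / c * (|b.1| + |b.2|)))
    (fun r _ => ((hderiv r).sub ((hasDerivAt_id r).mul_const (ψ 0))).hasDerivWithinAt.congr_deriv
      (by simp)) (fun r hr => hbound r hr.1 hr.2.le) τ ⟨hτ, le_rfl⟩
  have e3 : ∫ z, (fderiv ℝ g (y + τ • a + c • comb r₁ r₂ z) a -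
      fderiv ℝ g (y + c • comb r₁ r₂ z) a) ∂stdNormal₂ = φ τ - φ 0 := by
    have := integral_sub (hint τ) (hint 0)
    simp only [zero_smul, add_zero] at this
    rw [this]
    simp [hφ]
  have e4 : ∫ z, fderiv ℝ (fderiv ℝ g) (y + c • comb r₁ r₂ z) a a ∂stdNormal₂ = ψ 0 := by
    simp [hψ]
  rw [e3, e4]
  rw [Real.norm_eq_abs] at hfin
  convert hfin using 2
  · ring
  · ring

/-- The crude version of the expansion, in an arbitrary direction. -/
lemma abs_smooth_taylor_le_crude (h : HasBoundedDerivs g K₁ K₂)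
    (r₁ r₂ y a : V) (c : ℝ) {τ : ℝ} (hτ : 0 ≤ τ) :
    |∫ z, (fderiv ℝ g (y + τ • a + c • comb r₁ r₂ z) a -
        fderiv ℝ g (y + c • comb r₁ r₂ z) a) ∂stdNormal₂ -
      τ * ∫ z, fderiv ℝ (fderiv ℝ g) (y + c • comb r₁ r₂ z) a a ∂stdNormal₂| ≤
      2 * (K₂ * ‖a‖ * ‖a‖) * τ := by
  have h1 : |∫ z, (fderiv ℝ g (y + τ • a + c • comb r₁ r₂ z) a -
      fderiv ℝ g (y + c • comb r₁ r₂ z) a) ∂stdNormal₂| ≤ K₂ * ‖a‖ * ‖a‖ * τ := by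
    have := norm_integral_le_of_norm_le_const (μ := stdNormal₂) (C := K₂ * ‖a‖ * ‖a‖ * τ)
      (f := fun z => fderiv ℝ g (y + τ • a + c • comb r₁ r₂ z) a -
        fderiv ℝ g (y + c • comb r₁ r₂ z) a) (Eventually.of_forall fun z => by
        have h2 := h.norm_fderiv_sub_le (y + τ • a + c • comb r₁ r₂ z) (y + c • comb r₁ r₂ z)
        have e : y + τ • a + c • comb r₁ r₂ z - (y + c • comb r₁ r₂ z) = τ • a := by abel
        rw [e, norm_smul, Real.norm_of_nonneg hτ] at h2
        have h3 := (fderiv ℝ g (y + τ • a + c • comb r₁ r₂ z) -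
          fderiv ℝ g (y + c • comb r₁ r₂ z)).le_of_opNorm_le h2 a
        rw [_root_.sub_apply] at h3
        linarith)
    simpa using this
  have h2 : |τ * ∫ z, fderiv ℝ (fderiv ℝ g) (y + c • comb r₁ r₂ z) a a ∂stdNormal₂| ≤
      τ * (K₂ * ‖a‖ * ‖a‖) := by
    rw [abs_mul, abs_of_nonneg hτ]
    have := norm_integral_le_of_norm_le_const (μ := stdNormal₂) (C := K₂ * ‖a‖ * ‖a‖)
      (f := fun z => fderiv ℝ (fderiv ℝ g) (y + c • comb r₁ r₂ z) a a)
      (Eventually.of_forall fun z => h.abs_fderiv_fderiv_apply_le _ _ _)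
    gcongr
    simpa using this
  calc _ ≤ K₂ * ‖a‖ * ‖a‖ * τ + τ * (K₂ * ‖a‖ * ‖a‖) := (abs_sub _ _).trans (add_le_add h1 h2)
    _ = _ := by ring

/-- Gaussian integration by parts for a degenerate normal vector `comb r₁ r₂ z`. -/
lemma integral_fderiv_comb (h : HasBoundedDerivs g K₁ K₂) (r₁ r₂ y : V) (c : ℝ) :
    ∫ z, fderiv ℝ g (y + c • comb r₁ r₂ z) (comb r₁ r₂ z) ∂stdNormal₂ =
      c * (∫ z, fderiv ℝ (fderiv ℝ g) (y + c • comb r₁ r₂ z) r₁ r₁ ∂stdNormal₂ +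
        ∫ z, fderiv ℝ (fderiv ℝ g) (y + c • comb r₁ r₂ z) r₂ r₂ ∂stdNormal₂) := by
  have m1 : ∀ r, Measurable fun z : ℝ × ℝ => fderiv ℝ g (y + c • comb r₁ r₂ z) r :=
    fun r => (h.continuous_fderiv_apply (by fun_prop) _).measurable
  have m2 : ∀ r, Measurable fun z : ℝ × ℝ =>
      c * fderiv ℝ (fderiv ℝ g) (y + c • comb r₁ r₂ z) r r :=
    fun r => ((h.continuous_fderiv_fderiv_apply (by fun_prop) _ _).const_mul c).measurable
  have b2 : ∀ r v, |c * fderiv ℝ (fderiv ℝ g) v r r| ≤ |c| * (K₂ * ‖r‖ * ‖r‖) := fun r v => by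
    rw [abs_mul]
    gcongr
    exact h.abs_fderiv_fderiv_apply_le _ _ _
  have e1 := integral_fst_mul_stdNormal₂ (m1 r₁) (F' := fun z : ℝ × ℝ =>
      c * fderiv ℝ (fderiv ℝ g) (y + c • comb r₁ r₂ z) r₁ r₁) (fun x₁ x₂ => by
        have := h.hasDerivAt_line (y + c • x₂ • r₂) (c • r₁) r₁ x₁
        simp only [map_smul, _root_.smul_apply, smul_eq_mul] at this
        have e : ∀ t : ℝ, y + c • comb r₁ r₂ (t, x₂) = y + c • x₂ • r₂ + t • c • r₁ := fun t => by
          simp only [comb, smul_add]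
          rw [smul_comm t c]
          abel
        simpa only [e] using this) (m2 r₁)
    (fun z => h.abs_fderiv_apply_le _ _) (fun z => b2 _ _)
  have e2 := integral_snd_mul_stdNormal₂ (m1 r₂) (F' := fun z : ℝ × ℝ =>
      c * fderiv ℝ (fderiv ℝ g) (y + c • comb r₁ r₂ z) r₂ r₂) (fun x₁ x₂ => by
        have := h.hasDerivAt_line (y + c • x₁ • r₁) (c • r₂) r₂ x₂
        simp only [map_smul, _root_.smul_apply, smul_eq_mul] at this
        have e : ∀ t : ℝ, y + c • comb r₁ r₂ (x₁, t) = y + c • x₁ • r₁ + t • c • r₂ := fun t => by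
          simp only [comb, smul_add]
          rw [smul_comm t c]
          abel
        simpa only [e] using this) (m2 r₂)
    (fun z => h.abs_fderiv_apply_le _ _) (fun z => b2 _ _)
  rw [mul_add, ← integral_const_mul, ← integral_const_mul, ← e1, ← e2]
  have hid : Integrable (fun z : ℝ => z) stdNormal :=
    (memLp_id_gaussianReal (μ := 0) (v := 1) 1).integrable le_rfl
  rw [← integral_add]
  · congr 1
    ext z
    conv_lhs => rw [comb]
    simp [comb]
  · exact (hid.comp_fst stdNormal).mul_bdd (c := K₁ * ‖r₁‖) (m1 r₁).aestronglyMeasurable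
      (Eventually.of_forall fun z => h.abs_fderiv_apply_le _ _)
  · exact (hid.comp_snd stdNormal).mul_bdd (c := K₁ * ‖r₂‖) (m1 r₂).aestronglyMeasurable
      (Eventually.of_forall fun z => h.abs_fderiv_apply_le _ _)

end Smoothing

/-! ### Interpolation between a law with a Poisson type Stein identity and a normal law. -/

section Interpolation

lemma integrable_comb {V : Type*} [NormedAddCommGroup V] [NormedSpace ℝ V] (r₁ r₂ : V) : Integrable (comb r₁ r₂) stdNormal₂ := by
  have hid : Integrable (fun z : ℝ => z) stdNormal :=
    (memLp_id_gaussianReal (μ := 0) (v := 1) 1).integrable le_rfl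
  exact ((hid.comp_fst stdNormal).smul_const r₁).add ((hid.comp_snd stdNormal).smul_const r₂)

variable {V : Type*} [NormedAddCommGroup V] [NormedSpace ℝ V] [MeasurableSpace V] [BorelSpace V]
  [SecondCountableTopology V] {g : V → ℝ} {K₁ K₂ : ℝ} {ρ : Measure V} [IsProbabilityMeasure ρ]
  {lam : ℕ → ℝ} {a : ℕ → V} {r₁ r₂ : V} {e : ℕ → ℝ} {Δ : ℝ}

lemma abs_integral_le_of_abs_le {T : Type*} [MeasurableSpace T] {μ : Measure T}
    [IsProbabilityMeasure μ] {f : T → ℝ} {C : ℝ} (h : ∀ t, |f t| ≤ C) : |∫ t, f t ∂μ| ≤ C := by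
  have := norm_integral_le_of_norm_le_const (μ := μ) (f := f) (C := C) (Eventually.of_forall h)
  simpa using this

set_option maxSynthPendingDepth 3 in
/-- The derivative of the interpolation between `ρ` and the normal law, at the angle with sine `τ`
and cosine `c`. -/
lemma abs_integral_interpolation_le (hρ : Integrable (fun v => v) ρ) (hlam : ∀ m, 0 ≤ lam m)
    (hstein : ∀ (H : V → V →L[ℝ] ℝ) (K : ℝ), (∀ v, ‖H v‖ ≤ K) →
      ∫ v, H v v ∂ρ = ∑' m, lam m * ∫ v, (H (v + a m) - H v) (a m) ∂ρ)
    (he : ∀ m, (∃ b, comb r₁ r₂ b = a m ∧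
      shiftConst * (‖a m‖ * ‖a m‖ * (|b.1| + |b.2|)) ≤ e m) ∨ 2 * (‖a m‖ * ‖a m‖) ≤ e m)
    (hs1 : Summable fun m => lam m * ‖a m‖) (hs2 : Summable fun m => lam m * (‖a m‖ * ‖a m‖))
    (hse : Summable fun m => lam m * e m) (h : HasBoundedDerivs g K₁ K₂)
    (hΔ : ∀ B : V →L[ℝ] V →L[ℝ] ℝ, ‖B‖ ≤ K₂ →
      |∑' m, lam m * B (a m) (a m) - (B r₁ r₁ + B r₂ r₂)| ≤ K₂ * Δ)
    {c τ : ℝ} (hc : 0 < c) (hc1 : c ≤ 1) (hτ : 0 ≤ τ) (hτ1 : τ ≤ 1) :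
    |∫ p : V × (ℝ × ℝ), fderiv ℝ g (τ • p.1 + c • comb r₁ r₂ p.2)
      (c • p.1 - τ • comb r₁ r₂ p.2) ∂(ρ.prod stdNormal₂)| ≤ K₂ * (Δ + ∑' m, lam m * e m) := by
  have hK2 := h.nonneg₂
  have hcomb := integrable_comb (V := V) r₁ r₂
  -- Averaging out the Gaussian variable leaves a bounded field of functionals, to which the Stein
  -- identity of ρ applies. Below, Q is the mean Hessian along the interpolation.
  set H : V → V →L[ℝ] ℝ := fun v => ∫ z, fderiv ℝ g (τ • v + c • comb r₁ r₂ z) ∂stdNormal₂ with hH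
  have hY : Continuous fun p : V × (ℝ × ℝ) => τ • p.1 + c • comb r₁ r₂ p.2 := by fun_prop
  have hYv : ∀ v : V, Continuous fun z : ℝ × ℝ => τ • v + c • comb r₁ r₂ z := fun v => by fun_prop
  have iD : ∀ v, Integrable (fun z => fderiv ℝ g (τ • v + c • comb r₁ r₂ z)) stdNormal₂ :=
    fun v => integrable_stdNormal₂_of_bounded
      (h.continuous_fderiv.comp (hYv v)).aestronglyMeasurable fun z => h.norm_fderiv_le _
  have hHapp : ∀ v w, H v w = ∫ z, fderiv ℝ g (τ • v + c • comb r₁ r₂ z) w ∂stdNormal₂ :=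
    fun v w => ContinuousLinearMap.integral_apply (iD v) w
  have iDw : ∀ v w, Integrable (fun z => fderiv ℝ g (τ • v + c • comb r₁ r₂ z) w) stdNormal₂ :=
    fun v w => (iD v).apply_continuousLinearMap w
  have hHb : ∀ v, ‖H v‖ ≤ K₁ := fun v => by
    have := norm_integral_le_of_norm_le_const (μ := stdNormal₂) (C := K₁)
      (f := fun z => fderiv ℝ g (τ • v + c • comb r₁ r₂ z))
      (Eventually.of_forall fun z => h.norm_fderiv_le _)
    simpa using this
  have iD2 : Integrable (fun p : V × (ℝ × ℝ) =>
      fderiv ℝ (fderiv ℝ g) (τ • p.1 + c • comb r₁ r₂ p.2)) (ρ.prod stdNormal₂) :=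
    Integrable.of_bound (h.continuous_fderiv_fderiv.comp hY).aestronglyMeasurable K₂
      (Eventually.of_forall fun p => h.norm_fderiv_fderiv_le _)
  set Q : V →L[ℝ] V →L[ℝ] ℝ := ∫ p : V × (ℝ × ℝ),
    fderiv ℝ (fderiv ℝ g) (τ • p.1 + c • comb r₁ r₂ p.2) ∂(ρ.prod stdNormal₂) with hQ
  have hQb : ‖Q‖ ≤ K₂ := by
    have := norm_integral_le_of_norm_le_const (μ := ρ.prod stdNormal₂) (C := K₂)
      (f := fun p : V × (ℝ × ℝ) => fderiv ℝ (fderiv ℝ g) (τ • p.1 + c • comb r₁ r₂ p.2))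
      (Eventually.of_forall fun z => h.norm_fderiv_fderiv_le _)
    simpa using this
  have iD2w : ∀ w w' : V, Integrable (fun p : V × (ℝ × ℝ) =>
      fderiv ℝ (fderiv ℝ g) (τ • p.1 + c • comb r₁ r₂ p.2) w w') (ρ.prod stdNormal₂) :=
    fun w w' => (iD2.apply_continuousLinearMap w).apply_continuousLinearMap w'
  have hQapp : ∀ w w', Q w w' = ∫ v, ∫ z,
      fderiv ℝ (fderiv ℝ g) (τ • v + c • comb r₁ r₂ z) w w' ∂stdNormal₂ ∂ρ := by
    intro w w'
    rw [← integral_prod (f := fun p : V × (ℝ × ℝ) =>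
      fderiv ℝ (fderiv ℝ g) (τ • p.1 + c • comb r₁ r₂ p.2) w w') (iD2w w w'),
      hQ, ContinuousLinearMap.integral_apply iD2,
      ContinuousLinearMap.integral_apply (iD2.apply_continuousLinearMap w)]
  have hQint : ∀ w w', Integrable (fun v => ∫ z,
      fderiv ℝ (fderiv ℝ g) (τ • v + c • comb r₁ r₂ z) w w' ∂stdNormal₂) ρ :=
    fun w w' => (iD2w w w').integral_prod_left
  have iDv : Integrable (fun p : V × (ℝ × ℝ) =>
      fderiv ℝ g (τ • p.1 + c • comb r₁ r₂ p.2) p.1) (ρ.prod stdNormal₂) := by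
    refine Integrable.mono' (g := fun p : V × (ℝ × ℝ) => K₁ * ‖p.1‖)
      ((hρ.norm.comp_fst stdNormal₂).const_mul K₁) ?_
      (Eventually.of_forall fun p => h.abs_fderiv_apply_le _ _)
    exact ((h.continuous_fderiv.comp hY).clm_apply continuous_fst).aestronglyMeasurable
  have iDz : Integrable (fun p : V × (ℝ × ℝ) =>
      fderiv ℝ g (τ • p.1 + c • comb r₁ r₂ p.2) (comb r₁ r₂ p.2)) (ρ.prod stdNormal₂) := by
    refine Integrable.mono' (g := fun p : V × (ℝ × ℝ) => K₁ * ‖comb r₁ r₂ p.2‖)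
      ((hcomb.norm.comp_snd ρ).const_mul K₁) ?_
      (Eventually.of_forall fun p => h.abs_fderiv_apply_le _ _)
    exact ((h.continuous_fderiv.comp hY).clm_apply
      ((continuous_comb r₁ r₂).comp continuous_snd)).aestronglyMeasurable
  -- the total derivative, with the Gaussian part integrated by parts
  have hmain : ∫ p : V × (ℝ × ℝ), fderiv ℝ g (τ • p.1 + c • comb r₁ r₂ p.2)
      (c • p.1 - τ • comb r₁ r₂ p.2) ∂(ρ.prod stdNormal₂) =
      c * ∫ v, H v v ∂ρ - τ * (c * (Q r₁ r₁ + Q r₂ r₂)) := by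
    simp only [map_sub, map_smul, smul_eq_mul]
    rw [integral_sub (iDv.const_mul c) (iDz.const_mul τ), integral_const_mul, integral_const_mul,
      integral_prod _ iDv, integral_prod _ iDz]
    congr 2
    · congr 1
      ext v
      exact (hHapp v v).symm
    · simp only [integral_fderiv_comb h]
      rw [integral_const_mul, integral_add (hQint _ _) (hQint _ _), hQapp, hQapp]
  set t : ℕ → ℝ := fun m => ∫ v, (H (v + a m) - H v) (a m) ∂ρ with ht
  -- The jump terms are linearised to the Hessian; the two alternatives of `he` call for the
  -- smoothed and the crude expansion.
  have hterm : ∀ m, |c * t m - c * τ * Q (a m) (a m)| ≤ K₂ * e m := by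
    intro m
    have hTv : ∀ v, (H (v + a m) - H v) (a m) =
        ∫ z, (fderiv ℝ g (τ • v + τ • a m + c • comb r₁ r₂ z) (a m) -
          fderiv ℝ g (τ • v + c • comb r₁ r₂ z) (a m)) ∂stdNormal₂ := by
      intro v
      have i1 := iDw (v + a m) (a m)
      simp only [smul_add] at i1
      rw [_root_.sub_apply, hHapp, hHapp, integral_sub i1 (iDw v (a m))]
      simp only [smul_add]
    have iT : Integrable (fun v => (H (v + a m) - H v) (a m)) ρ := by
      have hcont : Continuous fun p : V × (ℝ × ℝ) =>
          fderiv ℝ g (τ • p.1 + τ • a m + c • comb r₁ r₂ p.2) (a m) -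
            fderiv ℝ g (τ • p.1 + c • comb r₁ r₂ p.2) (a m) :=
        (h.continuous_fderiv_apply (by fun_prop) _).sub (h.continuous_fderiv_apply hY _)
      have : Integrable (fun p : V × (ℝ × ℝ) =>
          fderiv ℝ g (τ • p.1 + τ • a m + c • comb r₁ r₂ p.2) (a m) -
            fderiv ℝ g (τ • p.1 + c • comb r₁ r₂ p.2) (a m)) (ρ.prod stdNormal₂) :=
        Integrable.of_bound hcont.aestronglyMeasurable (K₁ * ‖a m‖ + K₁ * ‖a m‖)
          (Eventually.of_forall fun p => (norm_sub_le _ _).trans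
            (add_le_add (h.abs_fderiv_apply_le _ _) (h.abs_fderiv_apply_le _ _)))
      simpa only [hTv] using this.integral_prod_left
    have e1 : c * t m - c * τ * Q (a m) (a m) = ∫ v, c * ((H (v + a m) - H v) (a m) -
        τ * ∫ z, fderiv ℝ (fderiv ℝ g) (τ • v + c • comb r₁ r₂ z) (a m) (a m) ∂stdNormal₂) ∂ρ := by
      rw [integral_const_mul, integral_sub iT ((hQint _ _).const_mul τ), integral_const_mul,
        ← hQapp]
      ring
    rw [e1]
    refine abs_integral_le_of_abs_le fun v => ?_
    rw [abs_mul, abs_of_pos hc, hTv]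
    have he0 : 0 ≤ e m := by
      rcases he m with ⟨b, _, hb2⟩ | hb2
      · refine le_trans ?_ hb2
        have := shiftConst_nonneg
        positivity
      · exact le_trans (by positivity) hb2
    rcases he m with ⟨b, hb, hb2⟩ | hb2
    · have h1 := abs_smooth_taylor_le h r₁ r₂ (τ • v) b hc hτ
      rw [hb] at h1
      calc c * _ ≤ c * (shiftConst * (K₂ * ‖a m‖ * ‖a m‖) * (τ / c * (|b.1| + |b.2|)) * τ) := by
            gcongr
        -- The prefactor c, the cosine from differentiating the path, cancels the singularity 1 / c
        -- of the smoothing bound.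
        _ = K₂ * (shiftConst * (‖a m‖ * ‖a m‖ * (|b.1| + |b.2|))) * (τ * τ) := by
            field_simp
        _ ≤ K₂ * e m * 1 := by
            gcongr
            exact mul_le_one₀ hτ1 hτ hτ1
        _ = _ := mul_one _
    · have h1 := abs_smooth_taylor_le_crude h r₁ r₂ (τ • v) (a m) c hτ
      calc c * _ ≤ 1 * (2 * (K₂ * ‖a m‖ * ‖a m‖) * τ) := by gcongr
        _ = K₂ * (2 * (‖a m‖ * ‖a m‖)) * τ := by ring
        _ ≤ K₂ * e m * 1 := by gcongr
        _ = _ := mul_one _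
  have htb : ∀ m, |t m| ≤ 2 * K₁ * ‖a m‖ := fun m => abs_integral_le_of_abs_le fun v => by
    rw [_root_.sub_apply]
    have h1 := (H (v + a m)).le_of_opNorm_le (hHb _) (a m)
    have h2 := (H v).le_of_opNorm_le (hHb _) (a m)
    rw [Real.norm_eq_abs] at h1 h2
    exact (abs_sub _ _).trans (by linarith)
  have st : Summable fun m => lam m * t m :=
    Summable.of_norm_bounded (hs1.mul_left (2 * K₁)) fun m => by
      rw [norm_mul, Real.norm_of_nonneg (hlam m), Real.norm_eq_abs, mul_left_comm]
      exact mul_le_mul_of_nonneg_left (htb m) (hlam m)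
  have sQ : Summable fun m => lam m * Q (a m) (a m) :=
    Summable.of_norm_bounded (hs2.mul_left K₂) fun m => by
      rw [norm_mul, Real.norm_of_nonneg (hlam m), mul_left_comm]
      refine mul_le_mul_of_nonneg_left ?_ (hlam m)
      rw [← mul_assoc]
      exact (Q (a m)).le_of_opNorm_le (Q.le_of_opNorm_le hQb _) _
  rw [hmain, hstein H K₁ hHb]
  -- What remains is the expansion error of the jumps plus the mismatch between their second moments
  -- and the covariance, tested on Q.
  have e2 : c * ∑' m, lam m * t m - τ * (c * (Q r₁ r₁ + Q r₂ r₂)) =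
      ∑' m, lam m * (c * t m - c * τ * Q (a m) (a m)) +
        c * τ * (∑' m, lam m * Q (a m) (a m) - (Q r₁ r₁ + Q r₂ r₂)) := by
    have : ∀ m, lam m * (c * t m - c * τ * Q (a m) (a m)) =
        c * (lam m * t m) - c * τ * (lam m * Q (a m) (a m)) := fun m => by ring
    rw [tsum_congr this, (st.mul_left c).tsum_sub (sQ.mul_left (c * τ)), tsum_mul_left,
      tsum_mul_left]
    ring
  rw [e2]
  have f1 : |∑' m, lam m * (c * t m - c * τ * Q (a m) (a m))| ≤ K₂ * ∑' m, lam m * e m := by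
    rw [← tsum_mul_left]
    refine tsum_of_norm_bounded (f := fun m => lam m * (c * t m - c * τ * Q (a m) (a m)))
      (hse.mul_left K₂).hasSum fun m => ?_
    rw [norm_mul, Real.norm_of_nonneg (hlam m), mul_left_comm]
    exact mul_le_mul_of_nonneg_left (hterm m) (hlam m)
  have f2 : |c * τ * (∑' m, lam m * Q (a m) (a m) - (Q r₁ r₁ + Q r₂ r₂))| ≤ 1 * (K₂ * Δ) := by
    rw [abs_mul, abs_of_nonneg (by positivity)]
    gcongr
    · exact mul_le_one₀ hc1 hτ hτ1
    · exact hΔ Q hQb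
  calc _ ≤ K₂ * ∑' m, lam m * e m + 1 * (K₂ * Δ) := (abs_add_le _ _).trans (add_le_add f1 f2)
    _ = _ := by ring

/-- Normal approximation of a law `ρ` that satisfies a Poisson type Stein identity, for test
functions with two bounded derivatives. -/
theorem abs_integral_sub_gaussian_le (hρ : Integrable (fun v => v) ρ) (hlam : ∀ m, 0 ≤ lam m)
    (hstein : ∀ (H : V → V →L[ℝ] ℝ) (K : ℝ), (∀ v, ‖H v‖ ≤ K) →
      ∫ v, H v v ∂ρ = ∑' m, lam m * ∫ v, (H (v + a m) - H v) (a m) ∂ρ)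
    (he : ∀ m, (∃ b, comb r₁ r₂ b = a m ∧
      shiftConst * (‖a m‖ * ‖a m‖ * (|b.1| + |b.2|)) ≤ e m) ∨ 2 * (‖a m‖ * ‖a m‖) ≤ e m)
    (hs1 : Summable fun m => lam m * ‖a m‖) (hs2 : Summable fun m => lam m * (‖a m‖ * ‖a m‖))
    (hse : Summable fun m => lam m * e m) (h : HasBoundedDerivs g K₁ K₂)
    (hΔ : ∀ B : V →L[ℝ] V →L[ℝ] ℝ, ‖B‖ ≤ K₂ →
      |∑' m, lam m * B (a m) (a m) - (B r₁ r₁ + B r₂ r₂)| ≤ K₂ * Δ) :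
    |∫ v, g v ∂ρ - ∫ z, g (comb r₁ r₂ z) ∂stdNormal₂| ≤
      Real.pi / 2 * (K₂ * (Δ + ∑' m, lam m * e m)) := by
  have hcomb := integrable_comb (V := V) r₁ r₂
  have hgc : Continuous g := h.contDiff.continuous
  have hK1 := h.nonneg₁
  -- The path runs from the normal vector at α = 0 to v at α = π / 2; as sin² + cos² = 1, it
  -- preserves the covariance when the two ends agree.
  set F : ℝ → V × (ℝ × ℝ) → ℝ := fun α p => g (Real.sin α • p.1 + Real.cos α • comb r₁ r₂ p.2)
    with hF
  set F' : ℝ → V × (ℝ × ℝ) → ℝ := fun α p =>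
    fderiv ℝ g (Real.sin α • p.1 + Real.cos α • comb r₁ r₂ p.2)
      (Real.cos α • p.1 - Real.sin α • comb r₁ r₂ p.2) with hF'
  have hnorm : ∀ (s c : ℝ) (x y : V), |s| ≤ 1 → |c| ≤ 1 → ‖s • x + c • y‖ ≤ ‖x‖ + ‖y‖ := by
    intro s c x y hs hc
    refine (norm_add_le _ _).trans ?_
    rw [norm_smul, norm_smul, Real.norm_eq_abs, Real.norm_eq_abs]
    exact add_le_add (mul_le_of_le_one_left (norm_nonneg _) hs)
      (mul_le_of_le_one_left (norm_nonneg _) hc)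
  have hbi : Integrable (fun p : V × (ℝ × ℝ) => K₁ * (‖p.1‖ + ‖comb r₁ r₂ p.2‖))
      (ρ.prod stdNormal₂) :=
    ((hρ.norm.comp_fst stdNormal₂).add (hcomb.norm.comp_snd ρ)).const_mul K₁
  have hFc : ∀ α, Continuous (F α) := fun α => hgc.comp (by fun_prop)
  have hFi : ∀ α, Integrable (F α) (ρ.prod stdNormal₂) := by
    intro α
    refine Integrable.mono' (g := fun p : V × (ℝ × ℝ) => K₁ * (‖p.1‖ + ‖comb r₁ r₂ p.2‖) + |g 0|)
      (hbi.add (integrable_const _)) (hFc α).aestronglyMeasurable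
      (Eventually.of_forall fun p => ?_)
    have h1 := h.abs_sub_le (Real.sin α • p.1 + Real.cos α • comb r₁ r₂ p.2) 0
    rw [sub_zero] at h1
    have h2 := hnorm (Real.sin α) (Real.cos α) p.1 (comb r₁ r₂ p.2) (Real.abs_sin_le_one α)
      (Real.abs_cos_le_one α)
    have h3 := abs_sub_abs_le_abs_sub (F α p) (g 0)
    have h4 := mul_le_mul_of_nonneg_left h2 hK1
    rw [Real.norm_eq_abs]
    linarith
  have hderiv : ∀ α, HasDerivAt (fun α => ∫ p, F α p ∂(ρ.prod stdNormal₂))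
      (∫ p, F' α p ∂(ρ.prod stdNormal₂)) α := by
    intro α
    refine (hasDerivAt_integral_of_dominated_loc_of_deriv_le (s := Set.univ)
      (bound := fun p : V × (ℝ × ℝ) => K₁ * (‖p.1‖ + ‖comb r₁ r₂ p.2‖)) (F' := F')
      Filter.univ_mem (Eventually.of_forall fun α => (hFc α).aestronglyMeasurable) (hFi α)
      ?_ (Eventually.of_forall fun p α _ => ?_) hbi (Eventually.of_forall fun p α _ => ?_)).2
    · exact ((h.continuous_fderiv.comp (by fun_prop)).clm_apply (by fun_prop)).aestronglyMeasurable
    · refine (h.abs_fderiv_apply_le _ _).trans (mul_le_mul_of_nonneg_left ?_ hK1)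
      rw [sub_eq_add_neg, ← neg_smul]
      exact hnorm _ _ _ _ (Real.abs_cos_le_one α) (by rw [abs_neg]; exact Real.abs_sin_le_one α)
    · have h1 : HasDerivAt (fun α : ℝ => Real.sin α • p.1 + Real.cos α • comb r₁ r₂ p.2)
          (Real.cos α • p.1 - Real.sin α • comb r₁ r₂ p.2) α := by
        have := ((Real.hasDerivAt_sin α).smul_const p.1).add
          ((Real.hasDerivAt_cos α).smul_const (comb r₁ r₂ p.2))
        rwa [neg_smul, ← sub_eq_add_neg] at this
      exact (h.hasFDerivAt _).comp_hasDerivAt α h1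
  have hπ := Real.pi_pos
  have hfin := norm_image_sub_le_of_norm_deriv_le_segment' (a := 0) (b := Real.pi / 2)
    (C := K₂ * (Δ + ∑' m, lam m * e m))
    (fun α _ => (hderiv α).hasDerivWithinAt) (fun α hα =>
      abs_integral_interpolation_le hρ hlam hstein he hs1 hs2 hse h hΔ
        (Real.cos_pos_of_mem_Ioo ⟨by linarith [hα.1], hα.2⟩) (Real.cos_le_one α)
        (Real.sin_nonneg_of_nonneg_of_le_pi hα.1 (by linarith [hα.2])) (Real.sin_le_one α))
    (Real.pi / 2) ⟨by linarith, le_rfl⟩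
  have e1 : ∫ p, F (Real.pi / 2) p ∂(ρ.prod stdNormal₂) = ∫ v, g v ∂ρ := by
    rw [integral_prod _ (hFi _)]
    simp [hF]
  have e0 : ∫ p, F 0 p ∂(ρ.prod stdNormal₂) = ∫ z, g (comb r₁ r₂ z) ∂stdNormal₂ := by
    rw [integral_prod _ (hFi _)]
    simp [hF]
  rw [e1, e0, Real.norm_eq_abs] at hfin
  linarith

end Interpolation

/-! ### Equidistribution of the multiples of an angle of finite type. -/

section Equidistribution

lemma endDist_fract_le (x : ℝ) (z : ℤ) : endDist (Int.fract x) ≤ |x - z| := by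
  rw [endDist, ← abs_sub_round_eq_min]
  exact round_le x z

lemma sum_range_zmod {q : ℕ} [NeZero q] (F : ZMod q → ℝ) :
    ∑ j ∈ Finset.range q, F (j : ZMod q) = ∑ k : ZMod q, F k := by
  refine Finset.sum_nbij' (fun j => (j : ZMod q)) (fun k => k.val) ?_ ?_ ?_ ?_ ?_
  · simp
  · intro k _
    simpa using ZMod.val_lt k
  · intro j hj
    exact ZMod.val_cast_of_lt (Finset.mem_range.1 hj)
  · intro k _
    simp
  · simp

/-- Multiplication by p permutes the residues modulo q, and by periodicity only the residue of the
numerator matters. -/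
lemma sum_range_periodic_coprime {φ : ℝ → ℝ} (hper : Function.Periodic φ 1) {q : ℕ} (hq : 0 < q)
    {p : ℤ} (hp : IsCoprime p (q : ℤ)) (y : ℝ) :
    ∑ j ∈ Finset.range q, φ (y + j * (p / q)) = ∑ i ∈ Finset.range q, φ (y + i / q) := by
  have : NeZero q := ⟨hq.ne'⟩
  have hq' : (q : ℝ) ≠ 0 := by positivity
  set ψ : ZMod q → ℝ := fun k => φ (y + k.val / q) with hψ
  have hcast : ∀ n : ℤ, φ (y + n / q) = ψ (n : ZMod q) := by
    intro n
    simp only [hψ]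
    have h1 : ((n : ZMod q).val : ℤ) = n % q := ZMod.val_intCast n
    have h2 : (n : ℝ) = (q : ℝ) * ((n / (q : ℤ) : ℤ) : ℝ) + ((n : ZMod q).val : ℝ) := by
      have := Int.mul_ediv_add_emod n q
      rw [← h1] at this
      exact_mod_cast this.symm
    have h3 : y + (n : ℝ) / q = y + ((n : ZMod q).val : ℝ) / q + ((n / (q : ℤ) : ℤ) : ℝ) * 1 := by
      rw [h2]
      field_simp
      ring
    rw [h3]
    exact hper.int_mul _ _
  have e1 : ∀ j : ℕ, φ (y + j * (p / q)) = ψ ((j : ZMod q) * (p : ZMod q)) := fun j => by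
    have := hcast (j * p)
    push_cast at this
    rw [← this]
    ring_nf
  have e2 : ∀ j : ℕ, φ (y + j / q) = ψ (j : ZMod q) := fun j => by
    have := hcast j
    push_cast at this
    exact this
  simp only [e1, e2]
  rw [sum_range_zmod (fun k => ψ (k * (p : ZMod q))), sum_range_zmod ψ]
  obtain ⟨u, v, huv⟩ := hp
  have hunit : (u : ZMod q) * (p : ZMod q) = 1 := by
    have := congrArg (Int.cast : ℤ → ZMod q) huv
    push_cast at this
    simpa using this
  have hunit' : (p : ZMod q) * (u : ZMod q) = 1 := by rw [mul_comm]; exact hunit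
  exact Fintype.sum_equiv ⟨fun k => k * (p : ZMod q), fun k => k * (u : ZMod q),
    fun k => by simp [mul_assoc, hunit'], fun k => by simp [mul_assoc, hunit]⟩ _ _ fun k => rfl

lemma continuous_of_abs_sub_le {φ : ℝ → ℝ} {L : ℝ} (hL : ∀ x y, |φ x - φ y| ≤ L * |x - y|) :
    Continuous φ := by
  have hL0 : 0 ≤ L := by
    have := (abs_nonneg _).trans (hL 1 0)
    simpa using this
  exact (LipschitzWith.of_dist_le_mul (K := ⟨L, hL0⟩) fun x y => hL x y).continuous

/-- A Riemann sum with q cells of length 1 / q: after multiplication by q each cell contributes an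
error of at most L / q. -/
lemma abs_sum_sub_integral_le {φ : ℝ → ℝ} {L : ℝ} (hper : Function.Periodic φ 1)
    (hL : ∀ x y, |φ x - φ y| ≤ L * |x - y|) {q : ℕ} (hq : 0 < q) (y : ℝ) :
    |∑ i ∈ Finset.range q, φ (y + i / q) - q * ∫ s in (0 : ℝ)..1, φ s| ≤ L := by
  have hL0 : 0 ≤ L := by
    have := (abs_nonneg _).trans (hL 1 0)
    simpa using this
  have hc := continuous_of_abs_sub_le hL
  have hcy : Continuous fun s => φ (y + s) := by fun_prop
  have hq' : (0 : ℝ) < q := by positivity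
  have h1 : ∫ s in (0 : ℝ)..1, φ s = ∫ s in (0 : ℝ)..1, φ (y + s) := by
    rw [intervalIntegral.integral_comp_add_left (fun s => φ s), add_zero]
    have := hper.intervalIntegral_add_eq 0 y
    rwa [zero_add] at this
  have h2 : ∫ s in (0 : ℝ)..1, φ (y + s) =
      ∑ i ∈ Finset.range q, ∫ s in ((i : ℝ) / q)..((i + 1 : ℕ) : ℝ) / q, φ (y + s) := by
    rw [intervalIntegral.sum_integral_adjacent_intervals (a := fun i : ℕ => (i : ℝ) / q)
      fun k _ => hcy.intervalIntegrable _ _]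
    simp [hq'.ne']
  rw [h1, h2, Finset.mul_sum, ← Finset.sum_sub_distrib]
  have h3 : ∀ i ∈ Finset.range q, |φ (y + i / q) -
      q * ∫ s in ((i : ℝ) / q)..((i + 1 : ℕ) : ℝ) / q, φ (y + s)| ≤ L / q := by
    intro i _
    have hle : (i : ℝ) / q ≤ ((i + 1 : ℕ) : ℝ) / q := by gcongr; simp
    have hlen : ((i + 1 : ℕ) : ℝ) / q - (i : ℝ) / q = 1 / q := by push_cast; field_simp; ring
    have e : φ (y + i / q) - q * ∫ s in ((i : ℝ) / q)..((i + 1 : ℕ) : ℝ) / q, φ (y + s) =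
        q * ∫ s in ((i : ℝ) / q)..((i + 1 : ℕ) : ℝ) / q, (φ (y + i / q) - φ (y + s)) := by
      rw [intervalIntegral.integral_sub (by simp) (hcy.intervalIntegrable _ _),
        intervalIntegral.integral_const, hlen, smul_eq_mul]
      field_simp
    rw [e, abs_mul, abs_of_pos hq']
    have h4 := intervalIntegral.norm_integral_le_of_norm_le_const (C := L / q)
      (f := fun s => φ (y + i / q) - φ (y + s)) (a := (i : ℝ) / q) (b := ((i + 1 : ℕ) : ℝ) / q)
      (fun s hs => by
        rw [Set.uIoc_of_le hle] at hs
        refine (hL _ _).trans ?_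
        rw [div_eq_mul_one_div L, ← hlen]
        gcongr
        rw [abs_le]
        constructor <;> linarith [hs.1, hs.2])
    rw [hlen, abs_of_pos (by positivity), Real.norm_eq_abs] at h4
    calc (q : ℝ) * _ ≤ q * (L / q * (1 / q)) := by gcongr
      _ = _ := by field_simp
  calc _ ≤ ∑ i ∈ Finset.range q, L / q :=
        (Finset.abs_sum_le_sum_abs _ _).trans (Finset.sum_le_sum h3)
    _ = L := by
        rw [Finset.sum_const, Finset.card_range, nsmul_eq_mul]
        field_simp

/-- During q steps the multiples of t stay within 1 / q of those of p / q, which costs L. The latter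
fill the grid of mesh 1 / q, whose Riemann sum costs another L. -/
lemma abs_block_sum_sub_le {φ : ℝ → ℝ} {L : ℝ} (hper : Function.Periodic φ 1)
    (hL : ∀ x y, |φ x - φ y| ≤ L * |x - y|) {q : ℕ} (hq : 0 < q)
    {p : ℤ} (hp : IsCoprime p (q : ℤ)) {t : ℝ} (ht : q * |t - p / q| ≤ 1 / q) (y : ℝ) :
    |∑ j ∈ Finset.range q, φ (y + j * t) - q * ∫ s in (0 : ℝ)..1, φ s| ≤ 2 * L := by
  have hL0 : 0 ≤ L := by
    have := (abs_nonneg _).trans (hL 1 0)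
    simpa using this
  have hq' : (0 : ℝ) < q := by positivity
  have h1 : |∑ j ∈ Finset.range q, φ (y + j * t) -
      ∑ j ∈ Finset.range q, φ (y + j * (p / q))| ≤ L := by
    rw [← Finset.sum_sub_distrib]
    calc _ ≤ ∑ j ∈ Finset.range q, L / q := by
          refine (Finset.abs_sum_le_sum_abs _ _).trans (Finset.sum_le_sum fun j hj => ?_)
          refine (hL _ _).trans ?_
          have hj' : (j : ℝ) ≤ q := by exact_mod_cast (Finset.mem_range.1 hj).le
          have e : y + j * t - (y + j * (p / q)) = j * (t - p / q) := by ring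
          rw [e, abs_mul, Nat.abs_cast, div_eq_mul_one_div L]
          gcongr
          exact (mul_le_mul_of_nonneg_right hj' (abs_nonneg _)).trans ht
      _ = L := by
          rw [Finset.sum_const, Finset.card_range, nsmul_eq_mul]
          field_simp
  rw [sum_range_periodic_coprime hper hq hp] at h1
  have h2 := abs_sum_sub_integral_le hper hL hq y
  calc _ ≤ L + L := (abs_sub_le _ _ _).trans (add_le_add h1 h2)
    _ = _ := by ring

/-- The range is cut into blocks of length q at a cost of 2 L each; the fewer than q leftover terms
cost L each. -/
lemma abs_orbit_sum_sub_le {φ : ℝ → ℝ} {L : ℝ} (hper : Function.Periodic φ 1)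
    (hL : ∀ x y, |φ x - φ y| ≤ L * |x - y|) {q : ℕ} (hq : 0 < q)
    {p : ℤ} (hp : IsCoprime p (q : ℤ)) {t : ℝ} (ht : q * |t - p / q| ≤ 1 / q) (N : ℕ) :
    ∀ y : ℝ, |∑ j ∈ Finset.range N, φ (y + j * t) - N * ∫ s in (0 : ℝ)..1, φ s| ≤
      2 * L * (N / q : ℕ) + L * q := by
  have hL0 : 0 ≤ L := by
    have := (abs_nonneg _).trans (hL 1 0)
    simpa using this
  induction N using Nat.strong_induction_on with
  | _ N ih =>
    intro y
    rcases lt_or_ge N q with h | h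
    · rw [Nat.div_eq_of_lt h, Nat.cast_zero, mul_zero, zero_add]
      have h1 : ∀ x, |φ x - ∫ s in (0 : ℝ)..1, φ s| ≤ L := fun x => by
        have := abs_sum_sub_integral_le hper hL one_pos x
        simpa using this
      have e : ∑ j ∈ Finset.range N, φ (y + j * t) - N * ∫ s in (0 : ℝ)..1, φ s =
          ∑ j ∈ Finset.range N, (φ (y + j * t) - ∫ s in (0 : ℝ)..1, φ s) := by
        rw [Finset.sum_sub_distrib]
        simp
      rw [e]
      calc _ ≤ ∑ j ∈ Finset.range N, L :=
            (Finset.abs_sum_le_sum_abs _ _).trans (Finset.sum_le_sum fun j _ => h1 _)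
        _ = L * N := by simp [mul_comm]
        _ ≤ L * q := by gcongr
    · obtain ⟨M, rfl⟩ := Nat.exists_eq_add_of_le h
      have h1 := ih M (by omega) (y + q * t)
      have h2 := abs_block_sum_sub_le hper hL hq hp ht y
      rw [Finset.sum_range_add, Nat.add_div_left _ hq]
      have e1 : ∀ j : ℕ, y + ((q + j : ℕ) : ℝ) * t = y + q * t + j * t := fun j => by
        push_cast; ring
      simp only [e1]
      push_cast
      rw [abs_le] at h1 h2 ⊢
      constructor <;> linarith [h1.1, h1.2, h2.1, h2.2]

/-- The finite type condition for the angle `t`. -/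
def FiniteTypeWith (t K γ : ℝ) : Prop :=
  ∀ m : ℤ, m ≠ 0 → K / |(m : ℝ)| ^ γ < endDist (Int.fract (m * t))

/-- Quantitative equidistribution of the multiples of an angle of finite type. -/
lemma exists_abs_sum_lipschitz_le {t K γ : ℝ} (hK : 0 < K) (hγ : 0 < γ)
    (ht : FiniteTypeWith t K γ) :
    ∃ η C : ℝ, 0 < η ∧ η < 1 ∧ 0 ≤ C ∧ ∀ (φ : ℝ → ℝ) (L : ℝ), Function.Periodic φ 1 →
      (∀ x y, |φ x - φ y| ≤ L * |x - y|) → ∀ N : ℕ,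
      |∑ m ∈ Finset.Icc 1 N, φ (m * t) - N * ∫ s in (0 : ℝ)..1, φ s| ≤
        C * L * (N : ℝ) ^ (1 - η) := by
  -- The exponent 1 / (2 γ) is the saving in the number N / q of blocks, and 1 / 2 the saving in the
  -- leftover q = O(√N).
  set η := min (1 / 2) (1 / (2 * γ)) with hη
  have hη0 : 0 < η := by positivity
  have hη2 : η ≤ 1 / 2 := min_le_left _ _
  refine ⟨η, 2 * K ^ (-(1 / γ)) + 2, hη0, by linarith, by positivity, ?_⟩
  intro φ L hper hL N
  have hL0 : 0 ≤ L := by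
    have := (abs_nonneg _).trans (hL 1 0)
    simpa using this
  rcases Nat.eq_zero_or_pos N with rfl | hN
  · simp
    positivity
  have hN1 : (1 : ℝ) ≤ N := by exact_mod_cast hN
  -- Dirichlet approximation at level √N bounds q from above; the finite type condition then forces
  -- q^γ ≥ K √N.
  set Q := ⌈√(N : ℝ)⌉₊ with hQ
  have hsq : 1 ≤ √(N : ℝ) := Real.one_le_sqrt.2 hN1
  have hQ1 : 0 < Q := Nat.ceil_pos.2 (by linarith)
  have hQle : √(N : ℝ) ≤ Q := Nat.le_ceil _
  have hQup : (Q : ℝ) ≤ 2 * √(N : ℝ) := by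
    have := Nat.ceil_lt_add_one (a := √(N : ℝ)) (by positivity)
    linarith
  obtain ⟨r, hr1, hr2⟩ := Real.exists_rat_abs_sub_le_and_den_le t hQ1
  set q := r.den with hqdef
  have hq : 0 < q := r.den_pos
  have hq' : (0 : ℝ) < q := by positivity
  have hqQ : (q : ℝ) ≤ Q := by exact_mod_cast hr2
  have hrq : (r : ℝ) = (r.num : ℝ) / q := by
    rw [hqdef]; exact_mod_cast (Rat.num_div_den r).symm
  have hcop : IsCoprime r.num (q : ℤ) := Rat.isCoprime_num_den r
  rw [hrq] at hr1
  have hblock : (q : ℝ) * |t - r.num / q| ≤ 1 / (Q + 1) := by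
    calc (q : ℝ) * |t - r.num / q| ≤ q * (1 / ((Q + 1) * q)) := by gcongr
      _ = _ := by field_simp
  have hblock' : (q : ℝ) * |t - r.num / q| ≤ 1 / q :=
    hblock.trans (by gcongr; linarith)
  have hmain := abs_orbit_sum_sub_le hper hL hq hcop hblock' N t
  have e : ∑ m ∈ Finset.Icc 1 N, φ (m * t) = ∑ j ∈ Finset.range N, φ (t + j * t) := by
    rw [Finset.range_eq_Ico, ← Finset.Ico_succ_right_eq_Icc, Finset.sum_Ico_eq_sum_range,
      Finset.sum_Ico_eq_sum_range]
    refine Finset.sum_congr (by simp) fun j _ => ?_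
    congr 1
    push_cast
    ring
  rw [e]
  refine hmain.trans ?_
  -- the lower bound for `q`
  have hlow : K * √(N : ℝ) ≤ (q : ℝ) ^ γ := by
    have h1 := ht q (by exact_mod_cast hq.ne')
    have h2 := endDist_fract_le (((q : ℤ) : ℝ) * t) r.num
    have h3 : |((q : ℤ) : ℝ) * t - r.num| = q * |t - r.num / q| := by
      conv_rhs => rw [← abs_of_pos hq', ← abs_mul]
      congr 1
      push_cast
      rw [abs_of_pos hq']
      field_simp
    rw [h3] at h2
    have h4 : K / (q : ℝ) ^ γ < 1 / (Q + 1) := by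
      have : |((q : ℤ) : ℝ)| = q := by simp
      rw [this] at h1
      exact h1.trans_le (h2.trans hblock)
    rw [div_lt_div_iff₀ (by positivity) (by positivity), one_mul] at h4
    calc K * √(N : ℝ) ≤ K * (Q + 1) := by gcongr; linarith
      _ ≤ _ := h4.le
  have hlow' : K ^ (1 / γ) * (N : ℝ) ^ η ≤ q := by
    have h1 := Real.rpow_le_rpow (by positivity) hlow (by positivity : 0 ≤ 1 / γ)
    rw [← Real.rpow_mul hq'.le, mul_one_div_cancel hγ.ne', Real.rpow_one,
      Real.mul_rpow hK.le (by positivity), Real.sqrt_eq_rpow, ← Real.rpow_mul (by positivity)] at h1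
    refine le_trans ?_ h1
    gcongr
    rw [div_mul_div_comm, one_mul]
    exact min_le_right _ _
  have hNpos : (0 : ℝ) < N := by positivity
  have t1 : ((N / q : ℕ) : ℝ) ≤ K ^ (-(1 / γ)) * (N : ℝ) ^ (1 - η) := by
    calc ((N / q : ℕ) : ℝ) ≤ N / q := Nat.cast_div_le
      _ ≤ N / (K ^ (1 / γ) * (N : ℝ) ^ η) := by gcongr
      _ = _ := by
          rw [Real.rpow_neg hK.le, Real.rpow_sub hNpos, Real.rpow_one]
          field_simp
  have t2 : (q : ℝ) ≤ 2 * (N : ℝ) ^ (1 - η) := by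
    calc (q : ℝ) ≤ 2 * √(N : ℝ) := hqQ.trans hQup
      _ ≤ _ := by
          rw [Real.sqrt_eq_rpow]
          gcongr
          linarith
  calc 2 * L * ((N / q : ℕ) : ℝ) + L * q
      ≤ 2 * L * (K ^ (-(1 / γ)) * (N : ℝ) ^ (1 - η)) + L * (2 * (N : ℝ) ^ (1 - η)) := by gcongr
    _ = _ := by ring

end Equidistribution

/-! ### Equidistribution for functions with logarithmic singularities. -/

section LogType

/-- A periodic Lipschitz function that vanishes on a small set only. -/
structure IsGauge (d : ℝ → ℝ) (L κ : ℝ) : Prop where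
  periodic : Function.Periodic d 1
  lipschitz : ∀ x y, |d x - d y| ≤ L * |x - y|
  nonneg : ∀ s, 0 ≤ d s
  ae_pos : ∀ᵐ s, 0 < d s
  exponent_pos : 0 < κ
  integrable : IntervalIntegrable (fun s => d s ^ (-κ)) volume 0 1

/-- Periodic functions with singularities of at most logarithmic type where the gauge `d` vanishes,
and that grow slowly along the multiples of `t`. -/
structure IsLogType (t : ℝ) (d φ : ℝ → ℝ) : Prop where
  periodic : Function.Periodic φ 1
  measurable : Measurable φ
  lipschitz : ∃ (A : ℕ) (C : ℝ), 0 ≤ C ∧ ∀ ε : ℝ, 0 < ε → ε ≤ 1 → ∀ s s' : ℝ, ε ≤ d s → ε ≤ d s' →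
    |φ s - φ s'| ≤ C / ε ^ A * |s - s'|
  singular : ∀ κ : ℝ, 0 < κ → ∃ C : ℝ, 0 ≤ C ∧ ∀ s : ℝ, 0 < d s → |φ s| ≤ C * d s ^ (-κ)
  orbit : ∀ δ : ℝ, 0 < δ → ∃ C : ℝ, 0 ≤ C ∧ ∀ m : ℕ, 1 ≤ m → |φ (m * t)| ≤ C * (m : ℝ) ^ δ

variable {t L κ : ℝ} {d φ ψ : ℝ → ℝ}

lemma IsLogType.abs_le_div (h : IsLogType t d φ) : ∃ C : ℝ, 0 ≤ C ∧ ∀ ε : ℝ, 0 < ε → ∀ s : ℝ, ε ≤ d s →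
    |φ s| ≤ C / ε := by
  obtain ⟨C, hC0, hC⟩ := h.singular 1 one_pos
  refine ⟨C, hC0, fun ε hε s hs => (hC s (hε.trans_le hs)).trans ?_⟩
  rw [Real.rpow_neg_one, ← div_eq_mul_inv]
  gcongr

/-- In the product rule the undifferenced factor costs one power of 1 / ε, and each factor is used
with half of the exponents κ and δ. Stability under products is what gives access to all moments. -/
lemma IsLogType.mul (h : IsLogType t d φ) (h' : IsLogType t d ψ) :
    IsLogType t d fun s => φ s * ψ s where
  periodic := fun s => by simp only [h.periodic s, h'.periodic s]
  measurable := h.measurable.mul h'.measurable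
  lipschitz := by
    obtain ⟨A, C, hC0, hC⟩ := h.lipschitz
    obtain ⟨A', C', hC0', hC'⟩ := h'.lipschitz
    obtain ⟨B, hB0, hB⟩ := h.abs_le_div
    obtain ⟨B', hB0', hB'⟩ := h'.abs_le_div
    refine ⟨A + A' + 1, C * B' + B * C', by positivity, fun ε hε hε1 s s' hs hs' => ?_⟩
    have e : φ s * ψ s - φ s' * ψ s' = (φ s - φ s') * ψ s + φ s' * (ψ s - ψ s') := by ring
    have p1 : ε ^ (A + A' + 1) ≤ ε ^ (A + 1) := pow_le_pow_of_le_one hε.le hε1 (by omega)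
    have p2 : ε ^ (A + A' + 1) ≤ ε ^ (A' + 1) := pow_le_pow_of_le_one hε.le hε1 (by omega)
    rw [e]
    refine (abs_add_le _ _).trans ?_
    rw [abs_mul, abs_mul]
    calc |φ s - φ s'| * |ψ s| + |φ s'| * |ψ s - ψ s'|
        ≤ (C / ε ^ A * |s - s'|) * (B' / ε) + (B / ε) * (C' / ε ^ A' * |s - s'|) := by
          gcongr
          · exact hC ε hε hε1 s s' hs hs'
          · exact hB' ε hε s hs
          · exact hB ε hε s' hs'
          · exact hC' ε hε hε1 s s' hs hs'
      _ = (C * B' / ε ^ (A + 1) + B * C' / ε ^ (A' + 1)) * |s - s'| := by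
          rw [pow_succ, pow_succ]; field_simp
      _ ≤ (C * B' / ε ^ (A + A' + 1) + B * C' / ε ^ (A + A' + 1)) * |s - s'| := by gcongr
      _ = _ := by ring
  singular := fun κ hκ => by
    obtain ⟨C, hC0, hC⟩ := h.singular (κ / 2) (by positivity)
    obtain ⟨C', hC0', hC'⟩ := h'.singular (κ / 2) (by positivity)
    refine ⟨C * C', by positivity, fun s hs => ?_⟩
    rw [abs_mul]
    calc |φ s| * |ψ s| ≤ (C * d s ^ (-(κ / 2))) * (C' * d s ^ (-(κ / 2))) := by
          have := hC s hs
          have := hC' s hs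
          gcongr
      _ = C * C' * (d s ^ (-(κ / 2)) * d s ^ (-(κ / 2))) := by ring
      _ = _ := by rw [← Real.rpow_add hs]; ring_nf
  orbit := fun δ hδ => by
    obtain ⟨C, hC0, hC⟩ := h.orbit (δ / 2) (by positivity)
    obtain ⟨C', hC0', hC'⟩ := h'.orbit (δ / 2) (by positivity)
    refine ⟨C * C', by positivity, fun m hm => ?_⟩
    have hm0 : (0 : ℝ) < m := by positivity
    rw [abs_mul]
    calc |φ (m * t)| * |ψ (m * t)| ≤ (C * (m : ℝ) ^ (δ / 2)) * (C' * (m : ℝ) ^ (δ / 2)) := by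
          have := hC m hm
          have := hC' m hm
          gcongr
      _ = C * C' * ((m : ℝ) ^ (δ / 2) * (m : ℝ) ^ (δ / 2)) := by ring
      _ = _ := by rw [← Real.rpow_add hm0]; ring_nf

lemma IsLogType.add (h : IsLogType t d φ) (h' : IsLogType t d ψ) :
    IsLogType t d fun s => φ s + ψ s where
  periodic := fun s => by simp only [h.periodic s, h'.periodic s]
  measurable := h.measurable.add h'.measurable
  lipschitz := by
    obtain ⟨A, C, hC0, hC⟩ := h.lipschitz
    obtain ⟨A', C', hC0', hC'⟩ := h'.lipschitz
    refine ⟨A + A', C + C', by positivity, fun ε hε hε1 s s' hs hs' => ?_⟩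
    have e : φ s + ψ s - (φ s' + ψ s') = (φ s - φ s') + (ψ s - ψ s') := by ring
    have p1 : ε ^ (A + A') ≤ ε ^ A := pow_le_pow_of_le_one hε.le hε1 (by omega)
    have p2 : ε ^ (A + A') ≤ ε ^ A' := pow_le_pow_of_le_one hε.le hε1 (by omega)
    rw [e]
    calc _ ≤ C / ε ^ A * |s - s'| + C' / ε ^ A' * |s - s'| :=
          (abs_add_le _ _).trans (add_le_add (hC ε hε hε1 s s' hs hs') (hC' ε hε hε1 s s' hs hs'))
      _ ≤ C / ε ^ (A + A') * |s - s'| + C' / ε ^ (A + A') * |s - s'| := by gcongr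
      _ = _ := by ring
  singular := fun κ hκ => by
    obtain ⟨C, hC0, hC⟩ := h.singular κ hκ
    obtain ⟨C', hC0', hC'⟩ := h'.singular κ hκ
    refine ⟨C + C', by positivity, fun s hs => (abs_add_le _ _).trans ?_⟩
    rw [add_mul]
    exact add_le_add (hC s hs) (hC' s hs)
  orbit := fun δ hδ => by
    obtain ⟨C, hC0, hC⟩ := h.orbit δ hδ
    obtain ⟨C', hC0', hC'⟩ := h'.orbit δ hδ
    refine ⟨C + C', by positivity, fun m hm => (abs_add_le _ _).trans ?_⟩
    rw [add_mul]
    exact add_le_add (hC m hm) (hC' m hm)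

lemma IsLogType.const_mul (h : IsLogType t d φ) (c : ℝ) : IsLogType t d fun s => c * φ s where
  periodic := fun s => by simp only [h.periodic s]
  measurable := h.measurable.const_mul c
  lipschitz := by
    obtain ⟨A, C, hC0, hC⟩ := h.lipschitz
    refine ⟨A, |c| * C, by positivity, fun ε hε hε1 s s' hs hs' => ?_⟩
    rw [← mul_sub, abs_mul, mul_div_assoc, mul_assoc]
    exact mul_le_mul_of_nonneg_left (hC ε hε hε1 s s' hs hs') (abs_nonneg c)
  singular := fun κ hκ => by
    obtain ⟨C, hC0, hC⟩ := h.singular κ hκ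
    refine ⟨|c| * C, by positivity, fun s hs => ?_⟩
    rw [abs_mul, mul_assoc]
    exact mul_le_mul_of_nonneg_left (hC s hs) (abs_nonneg c)
  orbit := fun δ hδ => by
    obtain ⟨C, hC0, hC⟩ := h.orbit δ hδ
    refine ⟨|c| * C, by positivity, fun m hm => ?_⟩
    rw [abs_mul, mul_assoc]
    exact mul_le_mul_of_nonneg_left (hC m hm) (abs_nonneg c)

lemma isLogType_one (hd : IsGauge d L κ) : IsLogType t d fun _ => 1 where
  periodic := fun _ => rfl
  measurable := measurable_const
  lipschitz := ⟨0, 0, le_rfl, by simp⟩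
  singular := fun κ' hκ' => by
    have hL0 : 0 ≤ L := by
      have := (abs_nonneg _).trans (hd.lipschitz 1 0)
      simpa using this
    have hbd : ∀ s, d s ≤ d 0 + L := fun s => by
      have h1 := hd.lipschitz (Int.fract s) 0
      have h2 : d (Int.fract s) = d s := by
        have := hd.periodic.sub_int_mul_eq (x := s) ⌊s⌋
        rwa [mul_one] at this
      rw [h2, sub_zero, abs_of_nonneg (Int.fract_nonneg s)] at h1
      have h3 := (abs_le.1 h1).2
      have h4 : L * Int.fract s ≤ L * 1 := by gcongr; exact (Int.fract_lt_one s).le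
      linarith
    have h0 : 0 ≤ d 0 + L := add_nonneg (hd.nonneg 0) hL0
    refine ⟨(d 0 + L) ^ κ', by positivity, fun s hs => ?_⟩
    rw [abs_one, Real.rpow_neg hs.le, ← div_eq_mul_inv, one_le_div (by positivity)]
    exact Real.rpow_le_rpow hs.le (hbd s) hκ'.le
  orbit := fun δ hδ => ⟨1, zero_le_one, fun m hm => by
    rw [abs_one, one_mul]
    exact Real.one_le_rpow (by exact_mod_cast hm) hδ.le⟩

lemma IsLogType.pow (hd : IsGauge d L κ) (h : IsLogType t d φ) (k : ℕ) :
    IsLogType t d fun s => φ s ^ k := by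
  induction k with
  | zero => simpa using isLogType_one hd
  | succ k ih =>
    simp only [pow_succ]
    exact ih.mul h

lemma IsLogType.intervalIntegrable (hd : IsGauge d L κ) (h : IsLogType t d φ) :
    IntervalIntegrable φ volume 0 1 := by
  obtain ⟨C, hC0, hC⟩ := h.singular κ hd.exponent_pos
  refine (hd.integrable.const_mul C).mono_fun h.measurable.aestronglyMeasurable ?_
  filter_upwards [ae_restrict_of_ae hd.ae_pos] with s hs
  refine (hC s hs).trans (le_abs_self _)

lemma abs_clamp_sub_le (x y : ℝ) : |max 0 (min 1 x) - max 0 (min 1 y)| ≤ |x - y| := by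
  have h := abs_max_sub_max_le_abs (min 1 x) (min 1 y) 0
  rw [max_comm, max_comm (min 1 y)] at h
  exact h.trans ((abs_min_sub_min_le_max _ _ _ _).trans (by simp))

set_option maxHeartbeats 2000000 in
/-- Quantitative equidistribution for functions with logarithmic singularities. -/
theorem IsLogType.exists_abs_sum_sub_le {K γ : ℝ} (hK : 0 < K) (hγ : 0 < γ)
    (ht : FiniteTypeWith t K γ) (hd : IsGauge d L κ) (h : IsLogType t d φ) :
    ∃ η C : ℝ, 0 < η ∧ η < 1 ∧ 0 ≤ C ∧ ∀ N : ℕ,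
      |∑ m ∈ Finset.Icc 1 N, φ (m * t) - N * ∫ s in (0 : ℝ)..1, φ s| ≤
        C * (N : ℝ) ^ (1 - η) := by
  obtain ⟨η, E, hη0, hη1, hE0, hE⟩ := exists_abs_sum_lipschitz_le hK hγ ht
  obtain ⟨A, C₁, hC₁0, hC₁⟩ := h.lipschitz
  obtain ⟨C₂, hC₂0, hC₂⟩ := h.abs_le_div
  have hκ := hd.exponent_pos
  obtain ⟨C₃, hC₃0, hC₃⟩ := h.singular (κ / 2) (by positivity)
  have hL0 : 0 ≤ L := by
    have := (abs_nonneg _).trans (hd.lipschitz 1 0)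
    simpa using this
  -- Truncation at scale ε = N^(-β) produces Lipschitz constants of order ε^(-(A + 2)) = N^(η / 2),
  -- half of the saving available.
  set β : ℝ := η / (2 * (A + 2)) with hβ
  have hβ0 : 0 < β := by positivity
  have hβη : β * (A + 2) = η / 2 := by rw [hβ]; field_simp
  have hβle : β ≤ η / 2 := by
    have : (0 : ℝ) ≤ A := Nat.cast_nonneg A
    nlinarith
  -- η' serves both as the growth exponent allowed along the orbit and as the final saving, so it
  -- enters twice: 2 η' ≤ β κ pays for the singular set, and 2 η' + β ≤ η for the error in counting
  -- its visits.
  set η' : ℝ := min (η / 4) (β * (κ / 2)) with hη'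
  have hη'0 : 0 < η' := by positivity
  have hη'1 : η' ≤ η / 4 := min_le_left _ _
  have hη'2 : η' ≤ β * (κ / 2) := min_le_right _ _
  obtain ⟨C₄, hC₄0, hC₄⟩ := h.orbit η' hη'0
  set D : ℝ := ∫ s in (0 : ℝ)..1, d s ^ (-κ) with hD
  have hD0 : 0 ≤ D := intervalIntegral.integral_nonneg zero_le_one fun s _ =>
    Real.rpow_nonneg (hd.nonneg s) _
  have hφi := h.intervalIntegrable hd
  refine ⟨η', E * (C₁ + C₂ * L) + C₃ * 2 ^ (κ / 2) * D + C₄ * (2 ^ κ * D + E * L), hη'0,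
    by linarith, by positivity, fun N => ?_⟩
  rcases Nat.eq_zero_or_pos N with rfl | hN
  · simp
    positivity
  have hN1 : (1 : ℝ) ≤ N := by exact_mod_cast hN
  have hN0 : (0 : ℝ) < N := by positivity
  set ε : ℝ := (N : ℝ) ^ (-β) with hε
  have hε0 : 0 < ε := by positivity
  have hε1 : ε ≤ 1 := Real.rpow_le_one_of_one_le_of_nonpos hN1 (by linarith)
  -- A cut-off that is 0 where d ≤ ε and 1 where d ≥ 2 ε. Both φ χ and 1 - χ are Lipschitz, and the
  -- latter counts the visits of the orbit near the singularities.
  set χ : ℝ → ℝ := fun s => max 0 (min 1 (d s / ε - 1)) with hχ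
  have hχ0 : ∀ s, 0 ≤ χ s := fun s => le_max_left _ _
  have hχ1 : ∀ s, χ s ≤ 1 := fun s => max_le zero_le_one (min_le_left _ _)
  have hχz : ∀ s, d s ≤ ε → χ s = 0 := fun s hs => by
    have : d s / ε - 1 ≤ 0 := by
      have := (div_le_one hε0).2 hs
      linarith
    exact max_eq_left ((min_le_right _ _).trans this)
  have hχo : ∀ s, 2 * ε ≤ d s → χ s = 1 := fun s hs => by
    have : 1 ≤ d s / ε - 1 := by
      have := (le_div_iff₀ hε0).2 hs
      linarith
    simp only [hχ]
    rw [min_eq_left this, max_eq_right zero_le_one]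
  have hχL : ∀ x y, |χ x - χ y| ≤ L / ε * |x - y| := fun x y => by
    refine (abs_clamp_sub_le _ _).trans ?_
    have e : d x / ε - 1 - (d y / ε - 1) = (d x - d y) / ε := by ring
    rw [e, abs_div, abs_of_pos hε0, div_mul_eq_mul_div]
    gcongr
    exact hd.lipschitz x y
  have hχper : Function.Periodic χ 1 := fun s => by simp only [hχ, hd.periodic s]
  have hχc : Continuous χ := continuous_of_abs_sub_le hχL
  -- the truncated function is Lipschitz
  have hφL : ∀ x y, |φ x * χ x - φ y * χ y| ≤ (C₁ + C₂ * L) / ε ^ (A + 2) * |x - y| := by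
    have hA : C₂ / ε * (L / ε) ≤ (C₁ + C₂ * L) / ε ^ (A + 2) := by
      have e : C₂ / ε * (L / ε) = C₂ * L / ε ^ 2 := by field_simp
      have p : ε ^ (A + 2) ≤ ε ^ 2 := pow_le_pow_of_le_one hε0.le hε1 (by omega)
      rw [e]
      gcongr
      linarith
    have key : ∀ x y, d y ≤ ε → |φ x * χ x - φ y * χ y| ≤
        (C₁ + C₂ * L) / ε ^ (A + 2) * |x - y| := by
      intro x y hy
      rw [hχz y hy, mul_zero, sub_zero]
      rcases le_total (d x) ε with hx | hx
      · rw [hχz x hx, mul_zero, abs_zero]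
        positivity
      · have h1 := hχL x y
        rw [hχz y hy, sub_zero] at h1
        rw [abs_mul]
        calc |φ x| * |χ x| ≤ C₂ / ε * (L / ε * |x - y|) := by
              gcongr
              exact hC₂ ε hε0 x hx
          _ = C₂ / ε * (L / ε) * |x - y| := by ring
          _ ≤ _ := by gcongr
    intro x y
    rcases le_total (d y) ε with hy | hy
    · exact key x y hy
    rcases le_total (d x) ε with hx | hx
    · rw [abs_sub_comm, abs_sub_comm x]
      exact key y x hx
    have e : φ x * χ x - φ y * χ y = (φ x - φ y) * χ x + φ y * (χ x - χ y) := by ring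
    have p1 : ε ^ (A + 2) ≤ ε ^ A := pow_le_pow_of_le_one hε0.le hε1 (by omega)
    have p2 : ε ^ (A + 2) ≤ ε ^ 2 := pow_le_pow_of_le_one hε0.le hε1 (by omega)
    rw [e]
    refine (abs_add_le _ _).trans ?_
    rw [abs_mul, abs_mul, abs_of_nonneg (hχ0 x)]
    calc |φ x - φ y| * χ x + |φ y| * |χ x - χ y|
        ≤ (C₁ / ε ^ A * |x - y|) * 1 + (C₂ / ε) * (L / ε * |x - y|) := by
          gcongr
          · exact hC₁ ε hε0 hε1 x y hx hy
          · exact hχ1 x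
          · exact hC₂ ε hε0 y hy
          · exact hχL x y
      _ = (C₁ / ε ^ A + C₂ * L / ε ^ 2) * |x - y| := by field_simp
      _ ≤ (C₁ / ε ^ (A + 2) + C₂ * L / ε ^ (A + 2)) * |x - y| := by gcongr
      _ = _ := by ring
  have hper : Function.Periodic (fun s => φ s * χ s) 1 := fun s => by
    simp only [h.periodic s, hχper s]
  have hi1 : IntervalIntegrable (fun s => φ s * χ s) volume 0 1 :=
    (continuous_of_abs_sub_le hφL).intervalIntegrable _ _
  have hi2 : IntervalIntegrable (fun s => 1 - χ s) volume 0 1 :=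
    (continuous_const.sub hχc).intervalIntegrable _ _
  have hi3 : IntervalIntegrable (fun s => φ s * (1 - χ s)) volume 0 1 := by
    have : (fun s => φ s * (1 - χ s)) = fun s => φ s - φ s * χ s := by ext s; ring
    rw [this]
    exact hφi.sub hi1
  -- the singular parts are small
  have hsmall1 : ∫ s in (0 : ℝ)..1, (1 - χ s) ≤ (2 * ε) ^ κ * D := by
    rw [hD, ← intervalIntegral.integral_const_mul]
    refine intervalIntegral.integral_mono_ae zero_le_one hi2 (hd.integrable.const_mul _) ?_
    filter_upwards [hd.ae_pos] with s hs
    rcases le_total (2 * ε) (d s) with hs2 | hs2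
    · rw [hχo s hs2, sub_self]
      positivity
    · have h1 : d s ^ κ ≤ (2 * ε) ^ κ := Real.rpow_le_rpow hs.le hs2 hκ.le
      calc 1 - χ s ≤ 1 := by linarith [hχ0 s]
        _ = d s ^ κ * d s ^ (-κ) := by rw [← Real.rpow_add hs, add_neg_cancel, Real.rpow_zero]
        _ ≤ _ := by gcongr
  have hsmall2 : |∫ s in (0 : ℝ)..1, φ s * (1 - χ s)| ≤ C₃ * (2 * ε) ^ (κ / 2) * D := by
    rw [hD, ← intervalIntegral.integral_const_mul]
    rw [← Real.norm_eq_abs]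
    refine intervalIntegral.norm_integral_le_of_norm_le zero_le_one ?_ (hd.integrable.const_mul _)
    filter_upwards [hd.ae_pos] with s hs _
    rcases le_total (2 * ε) (d s) with hs2 | hs2
    · rw [hχo s hs2, sub_self, mul_zero, norm_zero]
      positivity
    · have h1 : d s ^ (κ / 2) ≤ (2 * ε) ^ (κ / 2) := Real.rpow_le_rpow hs.le hs2 (by positivity)
      rw [norm_mul, Real.norm_eq_abs, Real.norm_of_nonneg (by linarith [hχ1 s] : 0 ≤ 1 - χ s)]
      calc |φ s| * (1 - χ s) ≤ (C₃ * d s ^ (-(κ / 2))) * 1 := by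
            gcongr
            · linarith [hχ1 s]
            · exact hC₃ s hs
            · linarith [hχ0 s]
        _ = C₃ * (d s ^ (κ / 2) * d s ^ (-κ)) := by rw [← Real.rpow_add hs]; ring_nf
        _ ≤ C₃ * ((2 * ε) ^ (κ / 2) * d s ^ (-κ)) := by gcongr
        _ = _ := by ring
  have b1 := hE (fun s => φ s * χ s) _ hper hφL N
  have b2 := hE (fun s => 1 - χ s) (L / ε) (fun s => by simp only [hχper s]) (fun x y => by
    have e : 1 - χ x - (1 - χ y) = -(χ x - χ y) := by ring
    rw [e, abs_neg]
    exact hχL x y) N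
  -- Near the singularities only the orbit growth bounds φ (m t), since d may be arbitrarily small
  -- there.
  have b3 : |∑ m ∈ Finset.Icc 1 N, φ (m * t) * (1 - χ (m * t))| ≤
      C₄ * (N : ℝ) ^ η' * ∑ m ∈ Finset.Icc 1 N, (1 - χ (m * t)) := by
    rw [Finset.mul_sum]
    refine (Finset.abs_sum_le_sum_abs _ _).trans (Finset.sum_le_sum fun m hm => ?_)
    have hm' := Finset.mem_Icc.1 hm
    have h1 : 0 ≤ 1 - χ (m * t) := by linarith [hχ1 (m * t)]
    rw [abs_mul, abs_of_nonneg h1]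
    have hmN : (m : ℝ) ≤ N := by exact_mod_cast hm'.2
    gcongr
    exact (hC₄ m hm'.1).trans (by gcongr)
  have b4 : ∑ m ∈ Finset.Icc 1 N, (1 - χ (m * t)) ≤
      N * ((2 * ε) ^ κ * D) + E * (L / ε) * (N : ℝ) ^ (1 - η) := by
    have h1 := (abs_le.1 b2).2
    have h2 := mul_le_mul_of_nonneg_left hsmall1 hN0.le
    linarith
  have split : ∑ m ∈ Finset.Icc 1 N, φ (m * t) - N * ∫ s in (0 : ℝ)..1, φ s =
      (∑ m ∈ Finset.Icc 1 N, φ (m * t) * χ (m * t) - N * ∫ s in (0 : ℝ)..1, φ s * χ s) +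
      (∑ m ∈ Finset.Icc 1 N, φ (m * t) * (1 - χ (m * t)) -
        N * ∫ s in (0 : ℝ)..1, φ s * (1 - χ s)) := by
    have e1 : ∫ s in (0 : ℝ)..1, φ s =
        (∫ s in (0 : ℝ)..1, φ s * χ s) + ∫ s in (0 : ℝ)..1, φ s * (1 - χ s) := by
      rw [← intervalIntegral.integral_add hi1 hi3]
      congr 1
      ext s
      ring
    have e2 : ∑ m ∈ Finset.Icc 1 N, φ (m * t) = ∑ m ∈ Finset.Icc 1 N, φ (m * t) * χ (m * t) +
        ∑ m ∈ Finset.Icc 1 N, φ (m * t) * (1 - χ (m * t)) := by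
      rw [← Finset.sum_add_distrib]
      exact Finset.sum_congr rfl fun m _ => by ring
    rw [e1, e2]
    ring
  -- the exponents
  have hpow : ∀ {x y : ℝ}, x ≤ y → (N : ℝ) ^ x ≤ (N : ℝ) ^ y := fun hxy =>
    Real.rpow_le_rpow_of_exponent_le hN1 hxy
  have x1 : 1 / ε ^ (A + 2) * (N : ℝ) ^ (1 - η) ≤ (N : ℝ) ^ (1 - η') := by
    rw [hε, ← Real.rpow_natCast, ← Real.rpow_mul hN0.le, one_div, ← Real.rpow_neg hN0.le,
      ← Real.rpow_add hN0]
    refine hpow ?_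
    push_cast
    linarith
  have x2 : (N : ℝ) * ε ^ (κ / 2) ≤ (N : ℝ) ^ (1 - η') := by
    nth_rewrite 1 [← Real.rpow_one (N : ℝ)]
    rw [hε, ← Real.rpow_mul hN0.le, ← Real.rpow_add hN0]
    refine hpow ?_
    linarith
  have x3 : (N : ℝ) ^ η' * ((N : ℝ) * ε ^ κ) ≤ (N : ℝ) ^ (1 - η') := by
    nth_rewrite 2 [← Real.rpow_one (N : ℝ)]
    rw [hε, ← Real.rpow_mul hN0.le, ← Real.rpow_add hN0, ← Real.rpow_add hN0]
    refine hpow ?_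
    linarith
  have x4 : (N : ℝ) ^ η' * (1 / ε * (N : ℝ) ^ (1 - η)) ≤ (N : ℝ) ^ (1 - η') := by
    rw [hε, one_div, ← Real.rpow_neg hN0.le, ← Real.rpow_add hN0, ← Real.rpow_add hN0]
    refine hpow ?_
    linarith
  rw [split]
  calc _ ≤ E * ((C₁ + C₂ * L) / ε ^ (A + 2)) * (N : ℝ) ^ (1 - η) +
        (C₄ * (N : ℝ) ^ η' * (N * ((2 * ε) ^ κ * D) + E * (L / ε) * (N : ℝ) ^ (1 - η)) +
          N * (C₃ * (2 * ε) ^ (κ / 2) * D)) := by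
        refine (abs_add_le _ _).trans (add_le_add b1 ((abs_sub _ _).trans (add_le_add ?_ ?_)))
        · exact b3.trans (by gcongr)
        · rw [abs_mul, abs_of_pos hN0]
          gcongr
    _ = E * (C₁ + C₂ * L) * (1 / ε ^ (A + 2) * (N : ℝ) ^ (1 - η)) +
        C₃ * 2 ^ (κ / 2) * D * (N * ε ^ (κ / 2)) +
        C₄ * (2 ^ κ * D * ((N : ℝ) ^ η' * (N * ε ^ κ)) +
          E * L * ((N : ℝ) ^ η' * (1 / ε * (N : ℝ) ^ (1 - η)))) := by
        rw [Real.mul_rpow zero_le_two hε0.le, Real.mul_rpow zero_le_two hε0.le]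
        ring
    _ ≤ E * (C₁ + C₂ * L) * (N : ℝ) ^ (1 - η') + C₃ * 2 ^ (κ / 2) * D * (N : ℝ) ^ (1 - η') +
        C₄ * (2 ^ κ * D * (N : ℝ) ^ (1 - η') + E * L * (N : ℝ) ^ (1 - η')) := by gcongr
    _ = _ := by ring

end LogType

/-! ### Analytic functions near their zeros. -/

section AnalyticGrowth

open scoped Topology

variable {E : Type*} [NormedAddCommGroup E] [NormedSpace ℝ E]

/-- By the identity theorem f does not vanish near z, so it factors as (s - z)^k g with g z ≠ 0. -/
lemma exists_local_growth {f : ℝ → E} (hf : AnalyticOnNhd ℝ f Set.univ) (hne : ∃ s, f s ≠ 0)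
    (z : ℝ) : ∃ (c : ℝ) (k : ℕ), 0 < c ∧ (f z ≠ 0 → k = 0) ∧
      ∀ᶠ s in 𝓝 z, c * |s - z| ^ k ≤ ‖f s‖ := by
  have h0 : ¬ ∀ᶠ s in 𝓝 z, f s = 0 := fun h => by
    obtain ⟨s, hs⟩ := hne
    exact hs (hf.eqOn_zero_of_preconnected_of_eventuallyEq_zero isPreconnected_univ
      (Set.mem_univ z) h (Set.mem_univ s))
  obtain ⟨k, g, hg, hgz, hfg⟩ :=
    (hf z (Set.mem_univ z)).exists_eventuallyEq_pow_smul_nonzero_iff.2 h0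
  refine ⟨‖g z‖ / 2, k, by positivity, fun hz => ?_, ?_⟩
  · by_contra hk
    apply hz
    rw [hfg.self_of_nhds, sub_self, zero_pow hk, zero_smul]
  · have hgc : ∀ᶠ s in 𝓝 z, ‖g z‖ / 2 < ‖g s‖ :=
      hg.continuousAt.norm.eventually_const_lt (half_lt_self (norm_pos_iff.2 hgz))
    filter_upwards [hfg, hgc] with s h1 h2
    rw [h1, norm_smul, norm_pow, Real.norm_eq_abs, mul_comm]
    gcongr

lemma exists_growth {f : ℝ → E} (hf : AnalyticOnNhd ℝ f Set.univ) (hne : ∃ s, f s ≠ 0) :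
    ∃ (Z : Finset ℝ) (c : ℝ) (k : ℕ), 0 < c ∧ (∀ z ∈ Z, f z = 0) ∧
      ∀ s ∈ Set.Icc (0 : ℝ) 1, c ≤ ‖f s‖ ∨ ∃ z ∈ Z, c * |s - z| ^ k ≤ ‖f s‖ := by
  -- The condition |s - z| ≤ 1 allows the exponents to be raised to their maximum when local
  -- statements are merged by compactness.
  suffices h : ∃ (Z : Finset ℝ) (c : ℝ) (k : ℕ), 0 < c ∧ (∀ z ∈ Z, f z = 0) ∧
      ∀ s ∈ Set.Icc (0 : ℝ) 1, c ≤ ‖f s‖ ∨ ∃ z ∈ Z, |s - z| ≤ 1 ∧ c * |s - z| ^ k ≤ ‖f s‖ by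
    obtain ⟨Z, c, k, hc, hZ, h⟩ := h
    exact ⟨Z, c, k, hc, hZ, fun s hs => (h s hs).imp_right fun ⟨z, hz, _, h2⟩ => ⟨z, hz, h2⟩⟩
  refine isCompact_Icc.induction_on (p := fun S => ∃ (Z : Finset ℝ) (c : ℝ) (k : ℕ), 0 < c ∧
      (∀ z ∈ Z, f z = 0) ∧
      ∀ s ∈ S, c ≤ ‖f s‖ ∨ ∃ z ∈ Z, |s - z| ≤ 1 ∧ c * |s - z| ^ k ≤ ‖f s‖) ?_ ?_ ?_ ?_
  · exact ⟨∅, 1, 0, one_pos, by simp, by simp⟩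
  · rintro S T hST ⟨Z, c, k, hc, hZ, h⟩
    exact ⟨Z, c, k, hc, hZ, fun s hs => h s (hST hs)⟩
  · rintro S T ⟨Z, c, k, hc, hZ, h⟩ ⟨Z', c', k', hc', hZ', h'⟩
    refine ⟨Z ∪ Z', min c c', max k k', lt_min hc hc', fun z hz => ?_, fun s hs => ?_⟩
    · exact (Finset.mem_union.1 hz).elim (hZ z) (hZ' z)
    rcases hs with hs | hs
    · refine (h s hs).imp (min_le_left _ _).trans ?_
      rintro ⟨z, hz, h1, h2⟩
      refine ⟨z, Finset.mem_union_left _ hz, h1, le_trans ?_ h2⟩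
      exact mul_le_mul (min_le_left _ _)
        (pow_le_pow_of_le_one (abs_nonneg _) h1 (le_max_left _ _)) (by positivity) hc.le
    · refine (h' s hs).imp (min_le_right _ _).trans ?_
      rintro ⟨z, hz, h1, h2⟩
      refine ⟨z, Finset.mem_union_right _ hz, h1, le_trans ?_ h2⟩
      exact mul_le_mul (min_le_right _ _)
        (pow_le_pow_of_le_one (abs_nonneg _) h1 (le_max_right _ _)) (by positivity) hc'.le
  · intro z _
    obtain ⟨c, k, hc, hk, h⟩ := exists_local_growth hf hne z
    by_cases hz : f z = 0
    · have h1 : ∀ᶠ s in 𝓝 z, |s - z| < 1 := Metric.ball_mem_nhds z one_pos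
      refine ⟨_, mem_nhdsWithin_of_mem_nhds (h1.and h), {z}, c, k, hc, by simpa using hz, ?_⟩
      exact fun s hs => Or.inr ⟨z, by simp, hs.1.le, hs.2⟩
    · refine ⟨_, mem_nhdsWithin_of_mem_nhds h, ∅, c, k, hc, by simp, fun s hs => Or.inl ?_⟩
      simpa [hk hz] using hs

lemma intervalIntegrable_abs_rpow {r : ℝ} (hr : -1 < r) (a b : ℝ) :
    IntervalIntegrable (fun s : ℝ => |s| ^ r) volume a b := by
  have h1 : ∀ c : ℝ, 0 ≤ c → IntervalIntegrable (fun s : ℝ => |s| ^ r) volume 0 c := fun c hc => by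
    refine (intervalIntegral.intervalIntegrable_rpow' hr).congr fun s hs => ?_
    rw [Set.uIoc_of_le hc] at hs
    simp only [abs_of_pos hs.1]
  have h2 : ∀ c : ℝ, IntervalIntegrable (fun s : ℝ => |s| ^ r) volume 0 c := fun c => by
    rcases le_total 0 c with hc | hc
    · exact h1 c hc
    · rw [IntervalIntegrable.iff_comp_neg]
      simpa using h1 (-c) (by linarith)
  exact (h2 a).symm.trans (h2 b)

lemma exists_integrable_rpow_neg {f : ℝ → E} (hf : AnalyticOnNhd ℝ f Set.univ)
    (hne : ∃ s, f s ≠ 0) :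
    ∃ κ : ℝ, 0 < κ ∧ IntervalIntegrable (fun s => ‖f s‖ ^ (-κ)) volume 0 1 := by
  obtain ⟨Z, c, k, hc, hZ, h⟩ := exists_growth hf hne
  have hfc : Continuous f := continuous_iff_continuousAt.2 fun s => (hf s trivial).continuousAt
  -- This makes k κ ≤ 1 / 2, so that |s - z|^(-k κ) is integrable.
  set κ : ℝ := 1 / (2 * (k + 1)) with hκ
  have hκ0 : 0 < κ := by positivity
  have hkκ : k * κ ≤ 1 / 2 := by
    rw [hκ, mul_one_div, div_le_div_iff₀ (by positivity) two_pos]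
    linarith
  have hi : IntervalIntegrable (fun s => c ^ (-κ) * (1 + ∑ z ∈ Z, |s - z| ^ (-(k * κ))))
      volume 0 1 := by
    have e : (fun s : ℝ => ∑ z ∈ Z, |s - z| ^ (-(k * κ))) =
        ∑ z ∈ Z, fun s : ℝ => |s - z| ^ (-(k * κ)) := by
      ext s
      rw [Finset.sum_apply]
    refine (IntervalIntegrable.add intervalIntegrable_const ?_).const_mul _
    rw [e]
    refine IntervalIntegrable.sum Z fun z _ => ?_
    simpa using (intervalIntegrable_abs_rpow (r := -(k * κ)) (by linarith)
      (0 - z) (1 - z)).comp_sub_right z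
  refine ⟨κ, hκ0, hi.mono_fun ?_ ?_⟩
  · exact (hfc.norm.measurable.pow_const _).aestronglyMeasurable
  · filter_upwards [ae_restrict_mem measurableSet_uIoc] with s hs
    rw [Set.uIoc_of_le zero_le_one] at hs
    refine le_trans ?_ (le_abs_self _)
    rw [Real.norm_of_nonneg (by positivity)]
    have hs0 : ∀ z ∈ Z, 0 ≤ |s - z| ^ (-(k * κ)) := fun z _ => by positivity
    rcases h s ⟨hs.1.le, hs.2⟩ with h1 | ⟨z, hz, h1⟩
    · calc ‖f s‖ ^ (-κ) ≤ c ^ (-κ) :=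
            Real.rpow_le_rpow_of_nonpos hc h1 (by linarith)
        _ ≤ _ := by
            refine le_mul_of_one_le_right (by positivity) ?_
            linarith [Finset.sum_nonneg hs0]
    · by_cases hfs : f s = 0
      · rw [hfs, norm_zero, Real.zero_rpow (by linarith)]
        have := Finset.sum_nonneg hs0
        positivity
      have hsz : s ≠ z := fun e => hfs (e ▸ hZ z hz)
      have hp : 0 < |s - z| := abs_pos.2 (sub_ne_zero.2 hsz)
      calc ‖f s‖ ^ (-κ) ≤ (c * |s - z| ^ k) ^ (-κ) :=
              Real.rpow_le_rpow_of_nonpos (by positivity) h1 (by linarith)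
          _ = c ^ (-κ) * |s - z| ^ (-(k * κ)) := by
              rw [Real.mul_rpow hc.le (by positivity), ← Real.rpow_natCast, ← Real.rpow_mul hp.le]
              ring_nf
          _ ≤ _ := by
              gcongr
              have := Finset.single_le_sum hs0 hz
              linarith

lemma finite_zeros_Icc {f : ℝ → E} (hf : AnalyticOnNhd ℝ f Set.univ) (hne : ∃ s, f s ≠ 0) :
    {s ∈ Set.Icc (0 : ℝ) 1 | f s = 0}.Finite := by
  obtain ⟨Z, c, k, hc, -, h⟩ := exists_growth hf hne
  refine Z.finite_toSet.subset fun s ⟨hs, hfs⟩ => ?_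
  rcases h s hs with h1 | ⟨z, hz, h1⟩
  · rw [hfs, norm_zero] at h1
    linarith
  · rw [hfs, norm_zero] at h1
    have h2 : |s - z| ^ k = 0 := by
      have : 0 ≤ |s - z| ^ k := by positivity
      nlinarith
    have h3 : s = z := by
      by_contra hsz
      exact (pow_pos (abs_pos.2 (sub_ne_zero.2 hsz)) k).ne' h2
    exact h3 ▸ hz

end AnalyticGrowth

/-! ### The principal logarithm of a periodic analytic function. -/

section LogOfAnalytic

open scoped Topology

lemma norm_log_sub_log_le_of_convex {S : Set ℂ} (hS : Convex ℝ S) {ε : ℝ} (hε : 0 < ε)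
    (hslit : S ⊆ Complex.slitPlane) (hnorm : ∀ z ∈ S, ε ≤ ‖z‖) {z w : ℂ} (hz : z ∈ S)
    (hw : w ∈ S) : ‖Complex.log z - Complex.log w‖ ≤ ‖z - w‖ / ε := by
  have := hS.norm_image_sub_le_of_norm_hasDerivWithin_le (f := Complex.log) (f' := fun z => z⁻¹)
    (C := ε⁻¹) (fun x hx => (Complex.hasDerivAt_log (hslit hx)).hasDerivWithinAt)
    (fun x hx => by rw [norm_inv]; exact inv_anti₀ hε (hnorm x hx)) hw hz
  rwa [inv_mul_eq_div] at this

/-- Two points at height at least ε lie in the same half-plane, where the logarithm has Lipschitz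
constant 1 / ε, or are 2 ε apart; so the branch cut does no harm. For real points the two half-lines
play this role, the logarithm on the negative one being that of -z plus the constant i π. -/
lemma norm_log_sub_log_le_or {ε : ℝ} (hε : 0 < ε) {z w : ℂ}
    (h : (ε ≤ |z.im| ∧ ε ≤ |w.im|) ∨ (z.im = 0 ∧ w.im = 0 ∧ ε ≤ |z.re| ∧ ε ≤ |w.re|)) :
    ‖Complex.log z - Complex.log w‖ ≤ ‖z - w‖ / ε ∨ 2 * ε ≤ ‖z - w‖ := by
  have him : ∀ {z w : ℂ}, ε ≤ z.im → w.im ≤ -ε → 2 * ε ≤ ‖z - w‖ := fun {z w} h1 h2 => by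
    have := Complex.abs_im_le_norm (z - w)
    rw [Complex.sub_im] at this
    linarith [le_abs_self (z.im - w.im)]
  have hre : ∀ {z w : ℂ}, ε ≤ z.re → w.re ≤ -ε → 2 * ε ≤ ‖z - w‖ := fun {z w} h1 h2 => by
    have := Complex.abs_re_le_norm (z - w)
    rw [Complex.sub_re] at this
    linarith [le_abs_self (z.re - w.re)]
  have hpos : ∀ {z w : ℂ}, ε ≤ z.re → ε ≤ w.re →
      ‖Complex.log z - Complex.log w‖ ≤ ‖z - w‖ / ε := fun {z w} h1 h2 => by
    refine norm_log_sub_log_le_of_convex (S := {z | ε ≤ z.re}) (convex_halfSpace_re_ge ε) hε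
      (fun x hx => Or.inl (hε.trans_le hx)) (fun x hx => ?_) h1 h2
    exact (show ε ≤ x.re from hx).trans ((le_abs_self _).trans (Complex.abs_re_le_norm x))
  rcases h with ⟨hz, hw⟩ | ⟨hz0, hw0, hz, hw⟩
  · rcases le_abs'.1 hz with hz | hz <;> rcases le_abs'.1 hw with hw | hw
    · left
      refine norm_log_sub_log_le_of_convex (S := {z | z.im ≤ -ε}) (convex_halfSpace_im_le _) hε
        (fun x hx => Or.inr ?_) (fun x hx => ?_) hz hw
      · exact ne_of_lt ((show x.im ≤ -ε from hx).trans_lt (neg_neg_of_pos hε))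
      · have : x.im ≤ -ε := hx
        exact (le_abs'.2 (Or.inl this)).trans (Complex.abs_im_le_norm x)
    · right
      rw [norm_sub_rev]
      exact him hw hz
    · exact Or.inr (him hz hw)
    · left
      refine norm_log_sub_log_le_of_convex (S := {z | ε ≤ z.im}) (convex_halfSpace_im_ge _) hε
        (fun x hx => Or.inr ?_) (fun x hx => ?_) hz hw
      · exact ne_of_gt (hε.trans_le hx)
      · have : ε ≤ x.im := hx
        exact (le_abs'.2 (Or.inr this)).trans (Complex.abs_im_le_norm x)
  · rcases le_abs'.1 hz with hz | hz <;> rcases le_abs'.1 hw with hw | hw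
    · left
      have hneg : ∀ {z : ℂ}, z.im = 0 → z.re ≤ -ε →
          Complex.log z = Complex.log (-z) + Real.pi * Complex.I := fun {z} h0 h1 => by
        have hz' : z = (z.re : ℂ) := Complex.ext rfl (by simpa using h0)
        have h2 : z.re < 0 := by linarith
        have h3 : -z = ((-z.re : ℝ) : ℂ) := by rw [Complex.ofReal_neg, ← hz']
        apply Complex.ext
        · rw [h3]
          simp only [Complex.add_re, Complex.log_ofReal_re, Real.log_neg_eq_log]
          rw [hz', Complex.log_ofReal_re]
          simp
        · rw [h3, Complex.add_im, Complex.log_im, Complex.log_im,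
            Complex.arg_ofReal_of_nonneg (by linarith), hz', Complex.arg_ofReal_of_neg h2]
          simp
      rw [hneg hz0 hz, hneg hw0 hw, add_sub_add_right_eq_sub]
      have := hpos (z := -z) (w := -w) (by simp; linarith) (by simp; linarith)
      rwa [neg_sub_neg, norm_sub_rev w z] at this
    · right
      rw [norm_sub_rev]
      exact hre hw hz
    · exact Or.inr (hre hz hw)
    · exact Or.inl (hpos hz hw)

variable {F : ℝ → ℂ} {t K γ : ℝ}

lemma exists_lipschitz_of_periodic (hF : AnalyticOnNhd ℝ F Set.univ)
    (hper : Function.Periodic F 1) :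
    ∃ L, 0 ≤ L ∧ ∀ s s', ‖F s - F s'‖ ≤ L * |s - s'| := by
  have hd : Continuous (deriv F) :=
    continuous_iff_continuousAt.2 fun s => (hF.deriv s trivial).continuousAt
  have hdp : Function.Periodic (deriv F) 1 := fun s => by
    rw [← deriv_comp_add_const]
    congr 1
    ext y
    exact hper y
  obtain ⟨L, hL⟩ := (hdp.isBounded_of_continuous one_ne_zero hd).exists_norm_le
  refine ⟨L, (norm_nonneg _).trans (hL _ ⟨0, rfl⟩), fun s s' => ?_⟩
  exact convex_univ.norm_image_sub_le_of_norm_deriv_le (𝕜 := ℝ)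
    (fun x _ => (hF x trivial).differentiableAt) (fun x _ => hL _ ⟨x, rfl⟩) trivial trivial

lemma exists_common_denominator (Z : Finset ℝ)
    (hZ : ∀ z ∈ Z, ∃ q : ℕ, 0 < q ∧ ∃ p : ℤ, (q : ℝ) * z = p) :
    ∃ Q : ℕ, 0 < Q ∧ ∀ z ∈ Z, ∃ p : ℤ, (Q : ℝ) * z = p := by
  induction Z using Finset.induction_on with
  | empty => exact ⟨1, one_pos, by simp⟩
  | insert a Z _ ih =>
    obtain ⟨Q, hQ, h⟩ := ih fun z hz => hZ z (Finset.mem_insert_of_mem hz)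
    obtain ⟨q, hq, p, hp⟩ := hZ a (Finset.mem_insert_self a Z)
    refine ⟨Q * q, Nat.mul_pos hQ hq, fun z hz => ?_⟩
    rcases Finset.mem_insert.1 hz with rfl | hz
    · exact ⟨Q * p, by push_cast; rw [mul_assoc, hp]⟩
    · obtain ⟨p', hp'⟩ := h z hz
      exact ⟨q * p', by push_cast; rw [← hp']; ring⟩

/-- With a common denominator Q of the relevant zeros, the distance of the fractional part of m t
from a zero is at least that of Q m t from the integers, divided by Q, and the finite type condition
bounds this below by a power of m. The order of vanishing converts it into a bound for |F|. -/
lemma exists_orbit_lower_bound (hK : 0 < K) (hγ : 0 < γ) (ht : FiniteTypeWith t K γ)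
    (hF : AnalyticOnNhd ℝ F Set.univ) (hper : Function.Periodic F 1) (hne : ∃ s, F s ≠ 0)
    (hzero : ∀ s, F s = 0 → ∃ q : ℕ, 0 < q ∧ ∃ p : ℤ, (q : ℝ) * s = p) :
    ∃ c Γ : ℝ, 0 < c ∧ 0 ≤ Γ ∧ ∀ m : ℕ, 1 ≤ m → c * (m : ℝ) ^ (-Γ) ≤ ‖F (m * t)‖ := by
  obtain ⟨Z, c, k, hc, hZ, h⟩ := exists_growth hF hne
  obtain ⟨Q, hQ, hQZ⟩ := exists_common_denominator Z fun z hz => hzero z (hZ z hz)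
  have hQ0 : (0 : ℝ) < Q := by exact_mod_cast hQ
  set b : ℝ := K / ((Q : ℝ) ^ γ * Q) with hb
  have hb0 : 0 < b := by positivity
  refine ⟨c * min 1 (b ^ k), γ * k, by positivity, by positivity, fun m hm => ?_⟩
  have hm1 : (1 : ℝ) ≤ m := by exact_mod_cast hm
  have hm0 : (0 : ℝ) < m := by linarith
  have hfr : F (Int.fract (m * t)) = F (m * t) := by
    have := hper.sub_int_mul_eq (x := m * t) ⌊m * t⌋
    rwa [mul_one] at this
  rw [← hfr]
  rcases h (Int.fract (m * t)) ⟨Int.fract_nonneg _, (Int.fract_lt_one _).le⟩ with h1 | ⟨z, hz, h1⟩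
  · have h2 : (m : ℝ) ^ (-(γ * k)) ≤ 1 :=
      Real.rpow_le_one_of_one_le_of_nonpos hm1 (by simp; positivity)
    calc c * min 1 (b ^ k) * (m : ℝ) ^ (-(γ * k)) ≤ c * 1 * 1 := by
          gcongr
          exact min_le_left _ _
      _ ≤ _ := by linarith
  · obtain ⟨p, hp⟩ := hQZ z hz
    have h2 : b * (m : ℝ) ^ (-γ) ≤ |Int.fract (m * t) - z| := by
      have h3 := ht (Q * m) (by positivity)
      have h4 := endDist_fract_le (((Q * m : ℤ) : ℝ) * t) (Q * ⌊m * t⌋ + p)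
      have e : ((Q * m : ℤ) : ℝ) * t - ((Q * ⌊m * t⌋ + p : ℤ) : ℝ) =
          Q * (Int.fract (m * t) - z) := by
        push_cast
        rw [← hp, Int.fract]
        ring
      rw [e, abs_mul, abs_of_pos hQ0] at h4
      have e2 : |((Q * m : ℤ) : ℝ)| = Q * m := by
        push_cast
        exact abs_of_pos (by positivity)
      rw [e2, Real.mul_rpow hQ0.le hm0.le] at h3
      have h5 := h3.le.trans h4
      rw [hb, Real.rpow_neg hm0.le]
      rw [div_le_iff₀ (by positivity)] at h5
      rw [← div_eq_mul_inv, div_div, div_le_iff₀ (by positivity)]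
      linarith
    refine le_trans ?_ h1
    calc c * min 1 (b ^ k) * (m : ℝ) ^ (-(γ * k)) ≤ c * b ^ k * (m : ℝ) ^ (-(γ * k)) := by
          gcongr
          exact min_le_right _ _
      _ = c * (b * (m : ℝ) ^ (-γ)) ^ k := by
          rw [mul_pow, ← Real.rpow_natCast ((m : ℝ) ^ (-γ)), ← Real.rpow_mul hm0.le]
          ring_nf
      _ ≤ _ := by gcongr

lemma norm_log_le_of_bounds {z : ℂ} {a M : ℝ} (ha : 0 < a) (haz : a ≤ ‖z‖) (hz : ‖z‖ ≤ M)
    (hM : 1 ≤ M) (ha1 : a ≤ 1) : ‖Complex.log z‖ ≤ Real.log M - Real.log a + Real.pi := by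
  have h1 : |(Complex.log z).im| ≤ Real.pi := by
    rw [Complex.log_im]
    exact Complex.abs_arg_le_pi z
  have h2 : |(Complex.log z).re| ≤ Real.log M - Real.log a := by
    rw [Complex.log_re, abs_le]
    have := Real.log_le_log ha haz
    have := Real.log_le_log (ha.trans_le haz) hz
    have := Real.log_nonneg hM
    have := Real.log_nonpos ha.le ha1
    constructor <;> linarith
  exact (Complex.norm_le_abs_re_add_abs_im _).trans (add_le_add h2 h1)

lemma neg_log_le_rpow {a κ : ℝ} (ha : 0 < a) (hκ : 0 < κ) : -Real.log a ≤ 1 / κ * a ^ (-κ) := by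
  have := Real.log_le_rpow_div (inv_nonneg.2 ha.le) hκ
  rwa [Real.log_inv, Real.inv_rpow ha.le, ← Real.rpow_neg ha.le, div_eq_mul_one_div, mul_comm] at this

/-- The logarithm of a periodic analytic function all of whose zeros are rational has components
of logarithmic type along the multiples of a number of finite type. -/
theorem exists_isLogType_log (hK : 0 < K) (hγ : 0 < γ) (ht : FiniteTypeWith t K γ)
    (hF : AnalyticOnNhd ℝ F Set.univ) (hper : Function.Periodic F 1) (hne : ∃ s, F s ≠ 0)
    (hzero : ∀ s, F s = 0 → ∃ q : ℕ, 0 < q ∧ ∃ p : ℤ, (q : ℝ) * s = p) :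
    ∃ (d : ℝ → ℝ) (L κ : ℝ), IsGauge d L κ ∧
      IsLogType t d (fun s => (Complex.log (F s)).re) ∧
      IsLogType t d (fun s => (Complex.log (F s)).im) ∧
      {s ∈ Set.Icc (0 : ℝ) 1 | d s = 0}.Finite := by
  obtain ⟨L, hL0, hL⟩ := exists_lipschitz_of_periodic hF hper
  obtain ⟨c, Γ, hc, hΓ, horb⟩ := exists_orbit_lower_bound hK hγ ht hF hper hne hzero
  have hFc : Continuous F := continuous_iff_continuousAt.2 fun s => (hF s trivial).continuousAt
  obtain ⟨M', hM'⟩ := (hper.isBounded_of_continuous one_ne_zero hFc).exists_norm_le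
  set M := max M' 1 with hMdef
  have hM1 : 1 ≤ M := le_max_right _ _
  have hM : ∀ s, ‖F s‖ ≤ M := fun s => (hM' _ ⟨s, rfl⟩).trans (le_max_left _ _)
  have hlogM := Real.log_nonneg hM1
  -- the gauge
  obtain ⟨h, hhan, hhne, hhper, hhle, hhL, hhpair⟩ : ∃ h : ℝ → ℝ, AnalyticOnNhd ℝ h Set.univ ∧
      (∃ s, h s ≠ 0) ∧ Function.Periodic h 1 ∧ (∀ s, |h s| ≤ ‖F s‖) ∧
      (∀ s s', |h s - h s'| ≤ ‖F s - F s'‖) ∧ ∀ ε s s', 0 < ε → ε ≤ |h s| → ε ≤ |h s'| →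
        ‖Complex.log (F s) - Complex.log (F s')‖ ≤ ‖F s - F s'‖ / ε ∨
          2 * ε ≤ ‖F s - F s'‖ := by
    -- The gauge must vanish at the zeros of F and wherever F may cross the branch cut. |Im F| does
    -- so, unless F is real; then |Re F| = |F| works, as F changes sign only at its zeros.
    by_cases hreal : ∃ s, (F s).im ≠ 0
    · refine ⟨fun s => (F s).im, ?_, hreal, fun s => by simp only [hper s],
        fun s => Complex.abs_im_le_norm _, fun s s' => ?_, fun ε s s' hε h1 h2 => ?_⟩
      · exact fun s hs => (Complex.imCLM.analyticAt _).comp (hF s hs)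
      · rw [← Complex.sub_im]
        exact Complex.abs_im_le_norm _
      · exact norm_log_sub_log_le_or hε (Or.inl ⟨h1, h2⟩)
    · push Not at hreal
      refine ⟨fun s => (F s).re, ?_, ?_, fun s => by simp only [hper s],
        fun s => Complex.abs_re_le_norm _, fun s s' => ?_, fun ε s s' hε h1 h2 => ?_⟩
      · exact fun s hs => (Complex.reCLM.analyticAt _).comp (hF s hs)
      · obtain ⟨s, hs⟩ := hne
        exact ⟨s, fun h0 => hs (Complex.ext h0 (hreal s))⟩
      · rw [← Complex.sub_re]
        exact Complex.abs_re_le_norm _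
      · exact norm_log_sub_log_le_or hε (Or.inr ⟨hreal s, hreal s', h1, h2⟩)
  set d : ℝ → ℝ := fun s => |h s| with hd
  have hdper : Function.Periodic d 1 := fun s => by simp only [hd, hhper s]
  have hfin : {s ∈ Set.Icc (0 : ℝ) 1 | d s = 0}.Finite := by
    simpa [hd] using finite_zeros_Icc hhan hhne
  obtain ⟨κ, hκ0, hκ⟩ := exists_integrable_rpow_neg hhan hhne
  have hgauge : IsGauge d L κ :=
    { periodic := hdper
      lipschitz := fun x y => (abs_abs_sub_abs_le_abs_sub _ _).trans ((hhL x y).trans (hL x y))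
      nonneg := fun s => abs_nonneg _
      ae_pos := by
        -- By periodicity the zeros are the integer translates of finitely many.
        have hcount : {s | d s = 0}.Countable := by
          refine (Set.countable_iUnion fun n : ℤ =>
            (hfin.countable.image fun s => s + n)).mono fun s hs => ?_
          refine Set.mem_iUnion.2 ⟨⌊s⌋, Int.fract s, ⟨⟨Int.fract_nonneg _,
            (Int.fract_lt_one _).le⟩, ?_⟩, Int.fract_add_floor s⟩
          have := hdper.sub_int_mul_eq (x := s) ⌊s⌋
          rw [mul_one] at this
          exact this.trans hs
        filter_upwards [hcount.ae_notMem volume] with s hs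
        exact lt_of_le_of_ne (abs_nonneg _) (Ne.symm hs)
      exponent_pos := hκ0
      integrable := by simpa only [Real.norm_eq_abs] using hκ }
  have hsing : ∀ κ' : ℝ, 0 < κ' → ∃ C : ℝ, 0 ≤ C ∧ ∀ s : ℝ, 0 < d s →
      ‖Complex.log (F s)‖ ≤ C * d s ^ (-κ') := by
    intro κ' hκ'
    refine ⟨(Real.log M + Real.pi) * M ^ κ' + 1 / κ', by positivity, fun s hs => ?_⟩
    have h1 : 1 ≤ M ^ κ' * d s ^ (-κ') := by
      rw [Real.rpow_neg hs.le, ← div_eq_mul_inv, one_le_div (by positivity)]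
      exact Real.rpow_le_rpow hs.le ((hhle s).trans (hM s)) hκ'.le
    have h2 := neg_log_le_rpow hs hκ'
    have h0 : 0 ≤ 1 / κ' * d s ^ (-κ') := by positivity
    have hπ := Real.pi_pos
    have h3 : Real.log M + Real.pi ≤ (Real.log M + Real.pi) * (M ^ κ' * d s ^ (-κ')) :=
      le_mul_of_one_le_right (by positivity) h1
    rcases le_total (d s) 1 with hd1 | hd1
    · have := norm_log_le_of_bounds hs (hhle s) (hM s) hM1 hd1
      linarith
    · have := norm_log_le_of_bounds one_pos (hd1.trans (hhle s)) (hM s) hM1 le_rfl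
      rw [Real.log_one] at this
      linarith
  have horb' : ∀ δ : ℝ, 0 < δ → ∃ C : ℝ, 0 ≤ C ∧ ∀ m : ℕ, 1 ≤ m →
      ‖Complex.log (F (m * t))‖ ≤ C * (m : ℝ) ^ δ := by
    intro δ hδ
    -- Here |F| and not the gauge matters: the argument is bounded by π, and log |F (m t)| ≥ log c'
    -- - Γ log m.
    set c' := min c 1 with hc'
    have hc'0 : 0 < c' := lt_min hc one_pos
    have hc'1 : c' ≤ 1 := min_le_right _ _
    have hlogc := Real.log_nonpos hc'0.le hc'1
    refine ⟨Real.log M - Real.log c' + Real.pi + Γ / δ, ?_, fun m hm => ?_⟩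
    · have : 0 ≤ Γ / δ := by positivity
      linarith [Real.pi_pos]
    have hm1 : (1 : ℝ) ≤ m := by exact_mod_cast hm
    have hm0 : (0 : ℝ) < m := by linarith
    have h1 : (m : ℝ) ^ (-Γ) ≤ 1 :=
      Real.rpow_le_one_of_one_le_of_nonpos hm1 (by linarith)
    have h2 : c' * (m : ℝ) ^ (-Γ) ≤ ‖F (m * t)‖ :=
      le_trans (by gcongr; exact min_le_left _ _) (horb m hm)
    have h3 := norm_log_le_of_bounds (by positivity) h2 (hM _) hM1
      (mul_le_one₀ hc'1 (by positivity) h1)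
    rw [Real.log_mul hc'0.ne' (by positivity), Real.log_rpow hm0] at h3
    have h4 := Real.log_le_rpow_div hm0.le hδ
    have h5 : 1 ≤ (m : ℝ) ^ δ := Real.one_le_rpow hm1 hδ.le
    have h6 : Γ * Real.log m ≤ Γ * ((m : ℝ) ^ δ / δ) := by gcongr
    have h7 : Real.log M - Real.log c' + Real.pi ≤
        (Real.log M - Real.log c' + Real.pi) * (m : ℝ) ^ δ :=
      le_mul_of_one_le_right (by linarith [Real.pi_pos]) h5
    calc _ ≤ (Real.log M - Real.log c' + Real.pi) + Γ * Real.log m := by linarith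
      _ ≤ (Real.log M - Real.log c' + Real.pi) * (m : ℝ) ^ δ + Γ * ((m : ℝ) ^ δ / δ) := by
          linarith
      _ = _ := by ring
  have hlip : ∃ (A : ℕ) (C : ℝ), 0 ≤ C ∧ ∀ ε : ℝ, 0 < ε → ε ≤ 1 → ∀ s s' : ℝ, ε ≤ d s →
      ε ≤ d s' → ‖Complex.log (F s) - Complex.log (F s')‖ ≤ C / ε ^ A * |s - s'| := by
    obtain ⟨C, hC0, hC⟩ := hsing 1 one_pos
    refine ⟨2, L + C * L, by positivity, fun ε hε hε1 s s' hs hs' => ?_⟩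
    have hCε : ∀ s, ε ≤ d s → ‖Complex.log (F s)‖ ≤ C / ε := fun s hs => by
      refine (hC s (hε.trans_le hs)).trans ?_
      rw [Real.rpow_neg_one, ← div_eq_mul_inv]
      gcongr
    have hp : ε ^ 2 ≤ ε := by nlinarith
    rcases hhpair ε s s' hε hs hs' with h1 | h1
    · calc _ ≤ ‖F s - F s'‖ / ε := h1
        _ ≤ L * |s - s'| / ε := by gcongr; exact hL s s'
        _ = L / ε * |s - s'| := by ring
        _ ≤ (L + C * L) / ε ^ 2 * |s - s'| := by
            gcongr
            linarith [mul_nonneg hC0 hL0]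
    -- Values 2 ε apart force L |s - s'| ≥ 2 ε, so the size bound C / ε of both logarithms already
    -- is a Lipschitz bound.
    · have h2 : 2 * ε ≤ L * |s - s'| := h1.trans (hL s s')
      calc _ ≤ C / ε + C / ε := (norm_sub_le _ _).trans (add_le_add (hCε s hs) (hCε s' hs'))
        _ = C / ε ^ 2 * (2 * ε) := by field_simp; ring
        _ ≤ C / ε ^ 2 * (L * |s - s'|) := by gcongr
        _ = (C * L) / ε ^ 2 * |s - s'| := by ring
        _ ≤ (L + C * L) / ε ^ 2 * |s - s'| := by
            gcongr
            linarith
  refine ⟨d, L, κ, hgauge, ?_, ?_, hfin⟩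
  · refine ⟨fun s => by simp only [hper s],
      Complex.measurable_re.comp (Complex.measurable_log.comp hFc.measurable), ?_,
      fun κ' hκ' => ?_, fun δ hδ => ?_⟩
    · obtain ⟨A, C, hC0, hC⟩ := hlip
      refine ⟨A, C, hC0, fun ε hε hε1 s s' hs hs' => le_trans ?_ (hC ε hε hε1 s s' hs hs')⟩
      rw [← Complex.sub_re]
      exact Complex.abs_re_le_norm _
    · obtain ⟨C, hC0, hC⟩ := hsing κ' hκ'
      exact ⟨C, hC0, fun s hs => (Complex.abs_re_le_norm _).trans (hC s hs)⟩
    · obtain ⟨C, hC0, hC⟩ := horb' δ hδ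
      exact ⟨C, hC0, fun m hm => (Complex.abs_re_le_norm _).trans (hC m hm)⟩
  · refine ⟨fun s => by simp only [hper s],
      Complex.measurable_im.comp (Complex.measurable_log.comp hFc.measurable), ?_,
      fun κ' hκ' => ?_, fun δ hδ => ?_⟩
    · obtain ⟨A, C, hC0, hC⟩ := hlip
      refine ⟨A, C, hC0, fun ε hε hε1 s s' hs hs' => le_trans ?_ (hC ε hε hε1 s s' hs hs')⟩
      rw [← Complex.sub_im]
      exact Complex.abs_im_le_norm _
    · obtain ⟨C, hC0, hC⟩ := hsing κ' hκ'
      exact ⟨C, hC0, fun s hs => (Complex.abs_im_le_norm _).trans (hC s hs)⟩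
    · obtain ⟨C, hC0, hC⟩ := horb' δ hδ
      exact ⟨C, hC0, fun m hm => (Complex.abs_im_le_norm _).trans (hC m hm)⟩

end LogOfAnalytic

/-! ### Averages with a power rate and Abel summation. -/

section PowerMeans

open scoped Topology

/-- The averages of `φ` converge to `μ` with a power rate. -/
def HasPowerMean (φ : ℕ → ℝ) (μ : ℝ) : Prop :=
  ∃ η C : ℝ, 0 < η ∧ η < 1 ∧ 0 ≤ C ∧ ∀ N : ℕ,
    |∑ m ∈ Finset.Icc 1 N, φ m - N * μ| ≤ C * (N : ℝ) ^ (1 - η)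

variable {φ ψ : ℕ → ℝ} {μ ν : ℝ}

lemma HasPowerMean.congr (h : HasPowerMean φ μ) (hφ : ∀ m, 1 ≤ m → ψ m = φ m) :
    HasPowerMean ψ μ := by
  obtain ⟨η, C, h1, h2, h3, h4⟩ := h
  refine ⟨η, C, h1, h2, h3, fun N => ?_⟩
  rw [Finset.sum_congr rfl fun m hm => hφ m (Finset.mem_Icc.1 hm).1]
  exact h4 N

lemma HasPowerMean.add (h : HasPowerMean φ μ) (h' : HasPowerMean ψ ν) :
    HasPowerMean (fun m => φ m + ψ m) (μ + ν) := by
  obtain ⟨η, C, h1, h2, h3, h4⟩ := h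
  obtain ⟨η', C', h1', h2', h3', h4'⟩ := h'
  refine ⟨min η η', C + C', lt_min h1 h1', (min_le_left _ _).trans_lt h2, by positivity,
    fun N => ?_⟩
  rcases Nat.eq_zero_or_pos N with rfl | hN
  · simp
    positivity
  have hN1 : (1 : ℝ) ≤ N := by exact_mod_cast hN
  have e : ∑ m ∈ Finset.Icc 1 N, (φ m + ψ m) - N * (μ + ν) =
      (∑ m ∈ Finset.Icc 1 N, φ m - N * μ) + (∑ m ∈ Finset.Icc 1 N, ψ m - N * ν) := by
    rw [Finset.sum_add_distrib]
    ring
  rw [e, add_mul]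
  refine (abs_add_le _ _).trans (add_le_add ((h4 N).trans ?_) ((h4' N).trans ?_))
  · gcongr
    exact min_le_left _ _
  · gcongr
    exact min_le_right _ _

lemma HasPowerMean.const_mul (h : HasPowerMean φ μ) (c : ℝ) :
    HasPowerMean (fun m => c * φ m) (c * μ) := by
  obtain ⟨η, C, h1, h2, h3, h4⟩ := h
  refine ⟨η, |c| * C, h1, h2, by positivity, fun N => ?_⟩
  rw [← Finset.mul_sum, show (N : ℝ) * (c * μ) = c * (N * μ) by ring, ← mul_sub, abs_mul, mul_assoc]
  exact mul_le_mul_of_nonneg_left (h4 N) (abs_nonneg c)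

lemma HasPowerMean.tendsto (h : HasPowerMean φ μ) :
    Tendsto (fun N : ℕ => (∑ m ∈ Finset.Icc 1 N, φ m) / N) atTop (𝓝 μ) := by
  obtain ⟨η, C, h1, h2, h3, h4⟩ := h
  rw [tendsto_iff_norm_sub_tendsto_zero]
  have h5 : Tendsto (fun N : ℕ => C * (N : ℝ) ^ (-η)) atTop (𝓝 0) := by
    simpa using ((tendsto_rpow_neg_atTop h1).comp tendsto_natCast_atTop_atTop).const_mul C
  refine squeeze_zero' (Eventually.of_forall fun _ => norm_nonneg _) ?_ h5
  filter_upwards [eventually_ge_atTop 1] with N hN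
  have hN0 : (0 : ℝ) < N := by exact_mod_cast hN
  have e : (∑ m ∈ Finset.Icc 1 N, φ m) / N - μ = (∑ m ∈ Finset.Icc 1 N, φ m - N * μ) / N := by
    field_simp
  rw [e, Real.norm_eq_abs, abs_div, abs_of_pos hN0, div_le_iff₀ hN0]
  refine (h4 N).trans_eq ?_
  rw [mul_assoc, ← Real.rpow_add_one hN0.ne']
  ring_nf

lemma HasPowerMean.unique (h : HasPowerMean φ μ) (h' : HasPowerMean φ ν) : μ = ν :=
  tendsto_nhds_unique h.tendsto h'.tendsto

lemma HasPowerMean.nonneg (h : HasPowerMean φ μ) (hφ : ∀ m, 0 ≤ φ m) : 0 ≤ μ :=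
  ge_of_tendsto' h.tendsto fun N =>
    div_nonneg (Finset.sum_nonneg fun m _ => hφ m) (Nat.cast_nonneg N)

lemma hasPowerMean_const (c : ℝ) : HasPowerMean (fun _ => c) c :=
  ⟨1 / 2, 0, by norm_num, by norm_num, le_rfl, fun N => by simp⟩

lemma HasPowerMean.exists_sum_le (h : HasPowerMean φ μ) :
    ∃ C, 0 ≤ C ∧ ∀ N : ℕ, |∑ m ∈ Finset.Icc 1 N, φ m| ≤ C * N := by
  obtain ⟨η, C, h1, h2, h3, h4⟩ := h
  refine ⟨C + |μ|, by positivity, fun N => ?_⟩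
  rcases Nat.eq_zero_or_pos N with rfl | hN
  · simp
  have hN1 : (1 : ℝ) ≤ N := by exact_mod_cast hN
  have h5 : (N : ℝ) ^ (1 - η) ≤ N := by
    conv_rhs => rw [← Real.rpow_one (N : ℝ)]
    exact Real.rpow_le_rpow_of_exponent_le hN1 (by linarith)
  calc |∑ m ∈ Finset.Icc 1 N, φ m| = |(∑ m ∈ Finset.Icc 1 N, φ m - N * μ) + N * μ| := by ring_nf
    _ ≤ C * (N : ℝ) ^ (1 - η) + N * |μ| := by
        refine (abs_add_le _ _).trans (add_le_add (h4 N) ?_)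
        rw [abs_mul, Nat.abs_cast]
    _ ≤ C * N + N * |μ| := by gcongr
    _ = _ := by ring

lemma HasPowerMean.exists_abs_le (h : HasPowerMean φ μ) :
    ∃ C, 0 ≤ C ∧ ∀ m : ℕ, 1 ≤ m → |φ m| ≤ C * m := by
  obtain ⟨C, hC0, hC⟩ := h.exists_sum_le
  refine ⟨2 * C, by positivity, fun m hm => ?_⟩
  obtain ⟨k, rfl⟩ : ∃ k, m = k + 1 := ⟨m - 1, by omega⟩
  have e : φ (k + 1) = ∑ m ∈ Finset.Icc 1 (k + 1), φ m - ∑ m ∈ Finset.Icc 1 k, φ m := by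
    rw [Finset.sum_Icc_succ_top (by omega)]
    ring
  rw [e]
  have h1 := hC (k + 1)
  have h2 := hC k
  push_cast at h1 ⊢
  calc _ ≤ C * (k + 1) + C * k := (abs_sub _ _).trans (add_le_add h1 h2)
    _ ≤ _ := by nlinarith

lemma HasPowerMean.summable (h : HasPowerMean φ μ) {u : ℝ} (hu : 0 < u) (hu1 : u < 1) :
    Summable fun m : ℕ => u ^ m / m * φ m := by
  obtain ⟨C, hC0, hC⟩ := h.exists_abs_le
  refine Summable.of_norm_bounded ((summable_geometric_of_lt_one hu.le hu1).mul_left C)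
    fun m => ?_
  rcases Nat.eq_zero_or_pos m with rfl | hm
  · simpa using hC0
  have hm0 : (0 : ℝ) < m := by exact_mod_cast hm
  rw [Real.norm_eq_abs, abs_mul, abs_of_pos (by positivity)]
  calc u ^ m / m * |φ m| ≤ u ^ m / m * (C * m) := by
        gcongr
        exact hC m hm
    _ = _ := by field_simp

lemma sum_Icc_mul_by_parts (v g : ℕ → ℝ) (N : ℕ) :
    ∑ m ∈ Finset.Icc 1 N, v m * g m = v N * ∑ m ∈ Finset.Icc 1 N, g m +
      ∑ k ∈ Finset.Icc 1 (N - 1), (v k - v (k + 1)) * ∑ m ∈ Finset.Icc 1 k, g m := by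
  induction N with
  | zero => simp
  | succ N ih =>
    rw [Finset.sum_Icc_succ_top (by omega), ih, Finset.sum_Icc_succ_top (by omega),
      Nat.add_sub_cancel]
    rcases Nat.eq_zero_or_pos N with rfl | hN
    · simp
    obtain ⟨k, rfl⟩ : ∃ k, N = k + 1 := ⟨N - 1, by omega⟩
    rw [Nat.add_sub_cancel, Finset.sum_Icc_succ_top (by omega : 1 ≤ k + 1)
      (fun k => (v k - v (k + 1)) * ∑ m ∈ Finset.Icc 1 k, g m)]
    ring

lemma abel_weight_sub_nonneg {u : ℝ} (hu : 0 < u) (hu1 : u < 1) {m : ℕ} (hm : 1 ≤ m) :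
    0 ≤ u ^ m / m - u ^ (m + 1) / (m + 1 : ℕ) := by
  have hm0 : (0 : ℝ) < m := by exact_mod_cast hm
  rw [sub_nonneg]
  refine div_le_div₀ (by positivity) (pow_le_pow_of_le_one hu.le hu1.le (by omega)) hm0 ?_
  push_cast
  linarith

/-- The change of 1 / m costs 1 / m² and the change of u^m costs (1 - u) u^m / m. Summed against
m^(1 - η), both stay bounded uniformly in u. -/
lemma abel_weight_sub_le {u : ℝ} (hu : 0 < u) (hu1 : u < 1) {m : ℕ} (hm : 1 ≤ m) :
    u ^ m / m - u ^ (m + 1) / (m + 1 : ℕ) ≤ 1 / (m : ℝ) ^ 2 + (1 - u) * u ^ m / m := by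
  have hm0 : (0 : ℝ) < m := by exact_mod_cast hm
  have hum : u ^ m ≤ 1 := pow_le_one₀ hu.le hu1.le
  have hum0 : 0 < u ^ m := by positivity
  have h1 : u ^ (m + 1) / (m : ℝ) - u ^ (m + 1) / (m + 1 : ℕ) ≤ 1 / (m : ℝ) ^ 2 := by
    have hle : u ^ (m + 1) ≤ 1 := pow_le_one₀ hu.le hu1.le
    push_cast
    rw [div_sub_div _ _ hm0.ne' (by positivity), div_le_div_iff₀ (by positivity) (by positivity)]
    have : u ^ (m + 1) * (m + 1) - m * u ^ (m + 1) ≤ 1 := by linarith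
    nlinarith [sq_nonneg (m : ℝ)]
  have h2 : (1 - u) * u ^ m / m = u ^ m / m - u ^ (m + 1) / m := by
    rw [pow_succ]
    ring
  rw [h2]
  linarith

/-- The series of the weights u^m / m is -log (1 - u) and carries the mean. The partial sums of φ -
μ are O(N^(1 - η)), and summation by parts against the decreasing weights leaves a bounded error. -/
lemma HasPowerMean.exists_abel (h : HasPowerMean φ μ) :
    ∃ C, 0 ≤ C ∧ ∀ u : ℝ, 0 < u → u < 1 →
      |∑' m : ℕ, u ^ m / m * φ m - -Real.log (1 - u) * μ| ≤ C := by
  have hs : ∀ u : ℝ, 0 < u → u < 1 → _ := fun u hu hu1 => h.summable hu hu1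
  obtain ⟨η, C, h1, h2, h3, h4⟩ := h
  have hS : Summable fun m : ℕ => 1 / (m : ℝ) ^ (1 + η) :=
    Real.summable_one_div_nat_rpow.2 (by linarith)
  refine ⟨C + (C * ∑' m : ℕ, 1 / (m : ℝ) ^ (1 + η) + C), by positivity, fun u hu hu1 => ?_⟩
  have hlog : HasSum (fun m : ℕ => u ^ m / m) (-Real.log (1 - u)) := by
    simpa using hasSum_pow_div (θ := 1) hu hu1
  have e : ∑' m : ℕ, u ^ m / m * φ m - -Real.log (1 - u) * μ =
      ∑' m : ℕ, u ^ m / m * (φ m - μ) := by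
    rw [← hlog.tsum_eq, ← tsum_mul_right, ← (hs u hu hu1).tsum_sub (hlog.summable.mul_right μ)]
    exact tsum_congr fun m => by ring
  have hsum : Summable fun m : ℕ => u ^ m / m * (φ m - μ) := by
    simp only [mul_sub]
    exact (hs u hu hu1).sub (hlog.summable.mul_right μ)
  rw [e]
  have hD : ∀ N : ℕ, |∑ m ∈ Finset.Icc 1 N, (φ m - μ)| ≤ C * (N : ℝ) ^ (1 - η) := fun N => by
    rw [Finset.sum_sub_distrib]
    simpa using h4 N
  have ht := hsum.hasSum.tendsto_sum_nat.comp (tendsto_add_atTop_nat 1)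
  refine le_of_tendsto' ht.abs fun N => ?_
  have e2 : ∑ m ∈ Finset.range (N + 1), u ^ m / m * (φ m - μ) =
      ∑ m ∈ Finset.Icc 1 N, u ^ m / m * (φ m - μ) := by
    clear ht
    induction N with
    | zero => simp
    | succ N ih => rw [Finset.sum_range_succ, ih, Finset.sum_Icc_succ_top (by omega)]
  simp only [Function.comp_apply]
  rw [e2, sum_Icc_mul_by_parts (fun m : ℕ => u ^ m / (m : ℝ))]
  refine (abs_add_le _ _).trans (add_le_add ?_ ?_)
  · rcases Nat.eq_zero_or_pos N with rfl | hN
    · simpa using h3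
    have hN1 : (1 : ℝ) ≤ N := by exact_mod_cast hN
    have hN0 : (0 : ℝ) < N := by linarith
    rw [abs_mul, abs_of_pos (by positivity)]
    have h5 : (N : ℝ) ^ (1 - η) ≤ N := by
      conv_rhs => rw [← Real.rpow_one (N : ℝ)]
      exact Real.rpow_le_rpow_of_exponent_le hN1 (by linarith)
    calc u ^ N / N * _ ≤ 1 / N * (C * N) := by
          gcongr
          · exact pow_le_one₀ hu.le hu1.le
          · exact (hD N).trans (by gcongr)
      _ = C := by field_simp
  · have hgeo := (summable_geometric_of_lt_one hu.le hu1).mul_left (C * (1 - u))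
    calc _ ≤ ∑ k ∈ Finset.Icc 1 (N - 1),
          (C * (1 / (k : ℝ) ^ (1 + η)) + C * (1 - u) * u ^ k) := by
          refine (Finset.abs_sum_le_sum_abs _ _).trans (Finset.sum_le_sum fun k hk => ?_)
          have hk1 := (Finset.mem_Icc.1 hk).1
          have hkr : (1 : ℝ) ≤ k := by exact_mod_cast hk1
          have hk0 : (0 : ℝ) < k := by linarith
          rw [abs_mul, abs_of_nonneg (abel_weight_sub_nonneg hu hu1 hk1)]
          have h5 : (k : ℝ) ^ (1 - η) ≤ k := by
            conv_rhs => rw [← Real.rpow_one (k : ℝ)]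
            exact Real.rpow_le_rpow_of_exponent_le hkr (by linarith)
          have h6 : 1 / (k : ℝ) ^ 2 * (k : ℝ) ^ (1 - η) = 1 / (k : ℝ) ^ (1 + η) := by
            rw [one_div, one_div, ← Real.rpow_natCast, ← Real.rpow_neg hk0.le,
              ← Real.rpow_neg hk0.le, ← Real.rpow_add hk0]
            push_cast
            ring_nf
          calc _ ≤ (1 / (k : ℝ) ^ 2 + (1 - u) * u ^ k / k) * (C * (k : ℝ) ^ (1 - η)) := by
                have := sub_pos.2 hu1
                gcongr
                · exact abel_weight_sub_le hu hu1 hk1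
                · exact hD k
            _ = C * (1 / (k : ℝ) ^ 2 * (k : ℝ) ^ (1 - η)) +
                C * (1 - u) * u ^ k * ((k : ℝ) ^ (1 - η) / k) := by ring
            _ ≤ C * (1 / (k : ℝ) ^ (1 + η)) + C * (1 - u) * u ^ k * 1 := by
                rw [h6]
                have := sub_pos.2 hu1
                gcongr
                exact (div_le_one hk0).2 h5
            _ = _ := by ring
      _ ≤ ∑' k : ℕ, (C * (1 / (k : ℝ) ^ (1 + η)) + C * (1 - u) * u ^ k) := by
          refine ((hS.mul_left C).add hgeo).sum_le_tsum _ fun k _ => ?_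
          have := sub_pos.2 hu1
          positivity
      _ = C * ∑' m : ℕ, 1 / (m : ℝ) ^ (1 + η) + C := by
          rw [(hS.mul_left C).tsum_add hgeo, tsum_mul_left, tsum_mul_left,
            tsum_geometric_of_lt_one hu.le hu1, mul_assoc,
            mul_inv_cancel₀ (by linarith : 1 - u ≠ 0), mul_one]

end PowerMeans

/-! ### Moments of log f along the powers of x, and degenerate directions. -/

section PairMeans

open scoped Topology

/-- A pair of sequences with power rates for the means of all its relevant monomials, that is
degenerate in the directions in which the matrix of second moments is, up to finitely many
exceptions. -/
structure HasPairMeans (α β : ℕ → ℝ) (a b A B D : ℝ) : Prop where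
  fst : HasPowerMean α a
  snd : HasPowerMean β b
  fst_sq : HasPowerMean (fun m => α m ^ 2) A
  mul : HasPowerMean (fun m => α m * β m) B
  snd_sq : HasPowerMean (fun m => β m ^ 2) D
  even_moments : ∀ k : ℕ, ∃ μ, HasPowerMean (fun m => (α m ^ 2 + β m ^ 2) ^ k) μ
  degenerate : ∃ E : Finset ℕ, ∀ m, 1 ≤ m → m ∉ E → ∀ c₁ c₂ : ℝ,
    c₁ ^ 2 * A + 2 * c₁ * c₂ * B + c₂ ^ 2 * D = 0 → c₁ * α m + c₂ * β m = 0

variable {α β : ℕ → ℝ} {A B D : ℝ}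

lemma hasPowerMean_quadratic (hA : HasPowerMean (fun m => α m ^ 2) A)
    (hB : HasPowerMean (fun m => α m * β m) B) (hD : HasPowerMean (fun m => β m ^ 2) D)
    (c₁ c₂ : ℝ) : HasPowerMean (fun m => (c₁ * α m + c₂ * β m) ^ 2)
      (c₁ ^ 2 * A + 2 * c₁ * c₂ * B + c₂ ^ 2 * D) :=
  (((hA.const_mul (c₁ ^ 2)).add (hB.const_mul (2 * c₁ * c₂))).add (hD.const_mul (c₂ ^ 2))).congr
    fun m _ => by ring

/-- The deviation of the partial sums from the mean is itself periodic, hence bounded, so any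
exponent below 1 serves. -/
lemma hasPowerMean_of_periodic {φ : ℕ → ℝ} {p : ℕ} (hp : 0 < p) (hφ : ∀ m, φ (m + p) = φ m) :
    HasPowerMean φ ((p : ℝ)⁻¹ * ∑ m ∈ Finset.Icc 1 p, φ m) := by
  set μ := (p : ℝ)⁻¹ * ∑ m ∈ Finset.Icc 1 p, φ m with hμ
  have hp0 : (p : ℝ) ≠ 0 := by positivity
  set G : ℕ → ℝ := fun N => ∑ m ∈ Finset.Icc 1 N, φ m - N * μ with hG
  have hsucc : ∀ N, G (N + 1) = G N + (φ (N + 1) - μ) := fun N => by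
    simp only [hG]
    rw [Finset.sum_Icc_succ_top (by omega)]
    push_cast
    ring
  have hper : Function.Periodic G p := fun N => by
    induction N with
    | zero =>
      simp only [hG, hμ, zero_add]
      field_simp
      simp
    | succ N ih =>
      rw [show N + 1 + p = N + p + 1 by ring, hsucc, ih, hsucc,
        show N + p + 1 = N + 1 + p by ring, hφ]
  refine ⟨1 / 2, ∑ k ∈ Finset.range p, |G k|, by norm_num, by norm_num,
    Finset.sum_nonneg fun _ _ => abs_nonneg _, fun N => ?_⟩
  rcases Nat.eq_zero_or_pos N with rfl | hN
  · have : 0 ≤ ∑ k ∈ Finset.range p, |G k| := Finset.sum_nonneg fun _ _ => abs_nonneg _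
    simp
    positivity
  have hN1 : (1 : ℝ) ≤ (N : ℝ) ^ (1 - 1 / 2 : ℝ) :=
    Real.one_le_rpow (by exact_mod_cast hN) (by norm_num)
  change |G N| ≤ _
  rw [← hper.map_mod_nat N]
  refine (Finset.single_le_sum (f := fun k => |G k|) (fun _ _ => abs_nonneg _)
    (Finset.mem_range.2 (Nat.mod_lt N hp))).trans ?_
  exact le_mul_of_one_le_right (Finset.sum_nonneg fun _ _ => abs_nonneg _) hN1

/-- All sequences are periodic. Where the quadratic form vanishes, a sum of squares over one period
is zero, hence every term is. -/
lemma hasPairMeans_of_isOfFinOrder {x : Circle} (hx : IsOfFinOrder x) (v w : Circle → ℝ) :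
    HasPairMeans (fun m => v (x ^ m)) (fun m => w (x ^ m)) (powerMean x v) (powerMean x w)
      (powerMean x fun z => v z ^ 2) (powerMean x fun z => v z * w z)
      (powerMean x fun z => w z ^ 2) := by
  have key : ∀ g : Circle → ℝ, HasPowerMean (fun m => g (x ^ m)) (powerMean x g) := fun g => by
    rw [powerMean, if_pos hx, smul_eq_mul]
    exact hasPowerMean_of_periodic hx.orderOf_pos fun m => by
      rw [pow_add, pow_orderOf_eq_one, mul_one]
  have k1 := key fun z => v z ^ 2
  have k2 := key fun z => v z * w z
  have k3 := key fun z => w z ^ 2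
  refine ⟨key v, key w, k1, k2, k3,
    fun k => ⟨_, key fun z => (v z ^ 2 + w z ^ 2) ^ k⟩, ∅, fun m hm _ c₁ c₂ h => ?_⟩
  have h1 := (hasPowerMean_quadratic k1 k2 k3 c₁ c₂).unique
    (key fun z => (c₁ * v z + c₂ * w z) ^ 2)
  rw [h, powerMean, if_pos hx, smul_eq_mul] at h1
  have h2 := (mul_eq_zero.1 h1.symm).resolve_left
    (inv_ne_zero (by exact_mod_cast hx.orderOf_pos.ne'))
  rw [Finset.sum_eq_zero_iff_of_nonneg fun _ _ => sq_nonneg _] at h2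
  -- The period runs over 1, …, p and not 0, …, p - 1, hence the shift by one in the residue.
  have h3 : ∃ m' ∈ Finset.Icc 1 (orderOf x), x ^ m' = x ^ m := by
    refine ⟨(m - 1) % orderOf x + 1, ?_, ?_⟩
    · rw [Finset.mem_Icc]
      have := Nat.mod_lt (m - 1) hx.orderOf_pos
      omega
    · rw [pow_succ, pow_mod_orderOf, ← pow_succ, Nat.sub_add_cancel hm]
  obtain ⟨m', hm', e⟩ := h3
  have := h2 m' hm'
  rw [e] at this
  exact pow_eq_zero_iff two_ne_zero |>.1 this

/-- Where d > 0 the function is continuous, so a nonzero value would persist on a set of positive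
measure. -/
lemma IsLogType.eq_zero_of_integral_eq_zero {t L κ : ℝ} {d φ : ℝ → ℝ} (hd : IsGauge d L κ)
    (h : IsLogType t d φ) (hφ : ∀ s, 0 ≤ φ s) (h0 : ∫ s in (0 : ℝ)..1, φ s = 0) (s : ℝ)
    (hs : 0 < d s) : φ s = 0 := by
  by_contra hne
  obtain ⟨A, C, hC0, hC⟩ := h.lipschitz
  have hdc : Continuous d := continuous_of_abs_sub_le hd.lipschitz
  set ε := min (d s / 2) 1 with hε
  have hε0 : 0 < ε := by positivity
  have hcont : ContinuousAt φ s := by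
    rw [ContinuousAt, tendsto_iff_norm_sub_tendsto_zero]
    have hlim : Tendsto (fun y => C / ε ^ A * |y - s|) (𝓝 s) (𝓝 0) := by
      have : Continuous fun y => C / ε ^ A * |y - s| := by fun_prop
      simpa using this.tendsto s
    refine squeeze_zero' (Eventually.of_forall fun _ => norm_nonneg _) ?_ hlim
    have h1 : ∀ᶠ y in 𝓝 s, d s / 2 < d y := hdc.continuousAt.eventually_const_lt (half_lt_self hs)
    filter_upwards [h1] with y hy
    exact hC ε hε0 (min_le_right _ _) y s ((min_le_left _ _).trans hy.le)
      ((min_le_left _ _).trans (by linarith))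
  -- A period centred at s has s in its interior.
  have hper : ∫ y in (s - 1 / 2)..(s - 1 / 2) + 1, φ y = 0 := by
    rw [h.periodic.intervalIntegral_add_eq (s - 1 / 2) 0, zero_add]
    exact h0
  have hint : IntervalIntegrable φ volume (s - 1 / 2) (s - 1 / 2 + 1) :=
    h.periodic.intervalIntegrable (t := 0) one_ne_zero
      (by simpa using h.intervalIntegrable hd) _ _
  rw [intervalIntegral.integral_of_le (by linarith)] at hper
  have hae := (integral_eq_zero_iff_of_nonneg (fun y => hφ y) hint.1).1 hper
  rw [EventuallyEq, ae_restrict_iff' measurableSet_Ioc] at hae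
  have hev : ∀ᶠ y in 𝓝 s, φ y ≠ 0 ∧ y ∈ Set.Ioc (s - 1 / 2) (s - 1 / 2 + 1) :=
    (hcont.eventually_ne hne).and (Ioc_mem_nhds (by linarith) (by linarith))
  obtain ⟨y, hy, hy1, hy2⟩ :=
    ((Measure.dense_of_ae hae).inter_nhds_nonempty hev)
  exact hy1 (hy hy2)

/-- Equal fractional parts would make (m - m') t an integer, which the finite type condition
excludes. -/
lemma FiniteTypeWith.injective_fract {t K γ : ℝ} (hK : 0 < K) (ht : FiniteTypeWith t K γ) :
    Function.Injective fun m : ℕ => Int.fract (m * t) := fun m m' h => by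
  by_contra hne
  have h1 : (m : ℤ) - m' ≠ 0 := by omega
  have h2 := ht _ h1
  obtain ⟨z, hz⟩ := Int.fract_eq_fract.1 h
  have h3 := endDist_fract_le (((m - m' : ℤ) : ℝ) * t) z
  have e : ((m - m' : ℤ) : ℝ) * t - z = 0 := by
    push_cast
    linarith
  rw [e, abs_zero] at h3
  have h4 : (0 : ℝ) < |((m - m' : ℤ) : ℝ)| := abs_pos.2 (by exact_mod_cast h1)
  have h5 : 0 < K / |((m - m' : ℤ) : ℝ)| ^ γ := by positivity
  linarith

/-- Functions of logarithmic type form an algebra on which equidistribution holds. In a degenerate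
direction a square has integral zero, so it vanishes off the zeros of d, and the orbit meets those
for finitely many m only. -/
lemma hasPairMeans_of_isLogType {t K γ L κ : ℝ} {d v w : ℝ → ℝ} (hK : 0 < K) (hγ : 0 < γ)
    (ht : FiniteTypeWith t K γ) (hd : IsGauge d L κ) (hv : IsLogType t d v)
    (hw : IsLogType t d w) (hfin : {s ∈ Set.Icc (0 : ℝ) 1 | d s = 0}.Finite) :
    HasPairMeans (fun m => v (m * t)) (fun m => w (m * t)) (∫ s in (0 : ℝ)..1, v s)
      (∫ s in (0 : ℝ)..1, w s) (∫ s in (0 : ℝ)..1, v s ^ 2) (∫ s in (0 : ℝ)..1, v s * w s)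
      (∫ s in (0 : ℝ)..1, w s ^ 2) := by
  have key : ∀ g : ℝ → ℝ, IsLogType t d g →
      HasPowerMean (fun m => g (m * t)) (∫ s in (0 : ℝ)..1, g s) := fun g hg =>
    hg.exists_abs_sum_sub_le hK hγ ht hd
  have k1 := key (fun s => v s ^ 2) (hv.pow hd 2)
  have k2 := key (fun s => v s * w s) (hv.mul hw)
  have k3 := key (fun s => w s ^ 2) (hw.pow hd 2)
  have hE : {m : ℕ | d (m * t) = 0}.Finite := by
    refine (hfin.preimage (ht.injective_fract hK).injOn).subset fun m hm => ?_
    refine ⟨⟨Int.fract_nonneg _, (Int.fract_lt_one _).le⟩, ?_⟩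
    have := hd.periodic.sub_int_mul_eq (x := m * t) ⌊m * t⌋
    rw [mul_one] at this
    exact this.trans hm
  refine ⟨key v hv, key w hw, k1, k2, k3, fun k => ⟨_, key (fun s => (v s ^ 2 + w s ^ 2) ^ k)
    (((hv.pow hd 2).add (hw.pow hd 2)).pow hd k)⟩, hE.toFinset, fun m _ hm c₁ c₂ h => ?_⟩
  have hψ := ((hv.const_mul c₁).add (hw.const_mul c₂)).pow hd 2
  have h1 := (hasPowerMean_quadratic k1 k2 k3 c₁ c₂).unique
    (key (fun s => (c₁ * v s + c₂ * w s) ^ 2) hψ)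
  rw [h] at h1
  have hdm : 0 < d (m * t) := lt_of_le_of_ne (hd.nonneg _) fun e => hm (by simpa using e.symm)
  have := hψ.eq_zero_of_integral_eq_zero hd (fun s => sq_nonneg _) h1.symm _ hdm
  exact pow_eq_zero_iff two_ne_zero |>.1 this

/-- In the coordinate s ↦ exp (2 π i s) roots of unity become rational numbers. The function is not
identically zero, since x has infinite order and so cannot be a zero of f. -/
lemma exists_isLogType_of_isFiniteType {f : Circle → ℂ} (hf : IsRealAnalytic f) {x : Circle}
    (hx : ¬ IsOfFinOrder x) (hxf : IsFiniteType x) (hz : ∀ z : Circle, f z = 0 → IsOfFinOrder z) :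
    ∃ (t K γ : ℝ) (d : ℝ → ℝ) (L κ : ℝ), 0 < K ∧ 0 < γ ∧ FiniteTypeWith t K γ ∧
      (∀ m : ℕ, Circle.exp (2 * Real.pi * (m * t)) = x ^ m) ∧ IsGauge d L κ ∧
      IsLogType t d (fun s => (Complex.log (f (Circle.exp (2 * Real.pi * s)))).re) ∧
      IsLogType t d (fun s => (Complex.log (f (Circle.exp (2 * Real.pi * s)))).im) ∧
      {s ∈ Set.Icc (0 : ℝ) 1 | d s = 0}.Finite := by
  obtain ⟨t, htx, K, γ, hK, hγ, ht⟩ := hxf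
  have htF : FiniteTypeWith t K γ := ht
  set F : ℝ → ℂ := fun s => f (Circle.exp (2 * Real.pi * s)) with hF
  have hFan : AnalyticOnNhd ℝ F Set.univ := fun s _ =>
    (hf (2 * Real.pi * s) trivial).comp (analyticAt_const.mul analyticAt_id)
  have hFper : Function.Periodic F 1 := fun s => by
    simp only [hF, mul_add, mul_one, Circle.exp_add, Circle.exp_two_pi]
  have hm : ∀ m : ℕ, Circle.exp (2 * Real.pi * (m * t)) = x ^ m := fun m => by
    rw [show 2 * Real.pi * (m * t) = m * (2 * Real.pi * t) by ring, Circle.exp_natCast_mul, htx]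
  have hFne : ∃ s, F s ≠ 0 := by
    refine ⟨t, fun h0 => hx (hz x ?_)⟩
    rw [← htx]
    exact h0
  have hF0 : ∀ s, F s = 0 → ∃ q : ℕ, 0 < q ∧ ∃ p : ℤ, (q : ℝ) * s = p := fun s hs => by
    obtain ⟨q, hq, h1⟩ := isOfFinOrder_iff_pow_eq_one.1 (hz _ hs)
    rw [← Circle.exp_natCast_mul] at h1
    obtain ⟨p, hp⟩ := Circle.exp_eq_one.1 h1
    refine ⟨q, hq, p, ?_⟩
    have : (2 * Real.pi) * (q * s) = (2 * Real.pi) * p := by linarith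
    exact mul_left_cancel₀ Real.two_pi_pos.ne' this
  obtain ⟨d, L, κ, hd, hv, hw, hfin⟩ := exists_isLogType_log hK hγ htF hFan hFper hFne hF0
  exact ⟨t, K, γ, d, L, κ, hK, hγ, htF, hm, hd, hv, hw, hfin⟩

/-- The logarithm of an analytic function has power means along the powers of `x`. -/
theorem hasPairMeans_log {f : Circle → ℂ} (hf : IsRealAnalytic f) {x : Circle}
    (hx : (¬ IsOfFinOrder x ∧ IsFiniteType x ∧ ∀ z : Circle, f z = 0 → IsOfFinOrder z) ∨
      IsOfFinOrder x) :
    HasPairMeans (fun m => (Complex.log (f (x ^ m))).re) (fun m => (Complex.log (f (x ^ m))).im)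
      (powerMean x fun z => (Complex.log (f z)).re) (powerMean x fun z => (Complex.log (f z)).im)
      (powerMean x fun z => (Complex.log (f z)).re ^ 2)
      (powerMean x fun z => (Complex.log (f z)).re * (Complex.log (f z)).im)
      (powerMean x fun z => (Complex.log (f z)).im ^ 2) := by
  rcases hx with ⟨h1, h2, h3⟩ | h
  · obtain ⟨t, K, γ, d, L, κ, hK, hγ, ht, hm, hd, hv, hw, hfin⟩ :=
      exists_isLogType_of_isFiniteType hf h1 h2 h3
    have := hasPairMeans_of_isLogType hK hγ ht hd hv hw hfin
    simp only [hm] at this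
    simpa only [powerMean, if_neg h1] using this
  · exact hasPairMeans_of_isOfFinOrder h (fun z => (Complex.log (f z)).re)
      fun z => (Complex.log (f z)).im

/-- The components of the complex Mahler measure are the means of the components of the
logarithm. -/
theorem mahler_eq {f : Circle → ℂ} (hf : IsRealAnalytic f) {x : Circle}
    (hx : (¬ IsOfFinOrder x ∧ IsFiniteType x ∧ ∀ z : Circle, f z = 0 → IsOfFinOrder z) ∨
      IsOfFinOrder x) :
    (mahler f x).re = powerMean x (fun z => (Complex.log (f z)).re) ∧
      (mahler f x).im = powerMean x (fun z => (Complex.log (f z)).im) := by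
  rcases hx with ⟨h1, h2, h3⟩ | h
  · obtain ⟨t, K, γ, d, L, κ, -, -, -, -, hd, hv, hw, -⟩ :=
      exists_isLogType_of_isFiniteType hf h1 h2 h3
    have hi : IntervalIntegrable (fun s => Complex.log (f (Circle.exp (2 * Real.pi * s))))
        volume 0 1 := by
      have h4 := hv.intervalIntegrable hd
      have h5 := hw.intervalIntegrable hd
      refine ⟨?_, ?_⟩
      · exact (Integrable.re_im_iff (𝕜 := ℂ)).1 ⟨h4.1, h5.1⟩
      · exact (Integrable.re_im_iff (𝕜 := ℂ)).1 ⟨h4.2, h5.2⟩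
    simp only [mahler, powerMean, if_neg h1]
    exact ⟨(Complex.reCLM.intervalIntegral_comp_comm hi).symm,
      (Complex.imCLM.intervalIntegral_comp_comm hi).symm⟩
  · simp only [mahler, powerMean, if_pos h, Complex.smul_re, Complex.smul_im, Complex.re_sum,
      Complex.im_sum, and_self]

end PairMeans

/-! ### The square root of the covariance and its range. -/

section SquareRoot

open scoped MatrixOrder

/-- The Euclidean plane. -/
abbrev Plane : Type := EuclideanSpace ℝ (Fin 2)

/-- The standard basis of the plane. -/
abbrev basisVec (i : Fin 2) : Plane := EuclideanSpace.single i 1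

lemma plane_eq (v : Plane) : v = v 0 • basisVec 0 + v 1 • basisVec 1 := by
  ext i
  fin_cases i <;> simp

lemma map_finTwo_stdGaussian :
    stdNormal₂.map (fun z : ℝ × ℝ => (!₂[z.1, z.2] : Plane)) = stdGaussian Plane := by
  have h := (measurePreserving_finTwoArrow stdNormal).symm
  rw [← map_pi_eq_stdGaussian, ← h.map_eq, Measure.map_map (by fun_prop) (by fun_prop)]
  congr 1

lemma integral_multivariateGaussian_eq (S : Matrix (Fin 2) (Fin 2) ℝ) {g : Plane → ℝ}
    (hg : Continuous g) :
    ∫ v, g v ∂multivariateGaussian 0 S =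
      ∫ z, g (comb (Matrix.toEuclideanCLM (𝕜 := ℝ) (CFC.sqrt S) (basisVec 0))
        (Matrix.toEuclideanCLM (𝕜 := ℝ) (CFC.sqrt S) (basisVec 1)) z) ∂stdNormal₂ := by
  set R := Matrix.toEuclideanCLM (𝕜 := ℝ) (CFC.sqrt S)
  have hm : Measurable fun z : ℝ × ℝ => (!₂[z.1, z.2] : Plane) := by fun_prop
  have hgR : Continuous fun x : Plane => g (0 + R x) := hg.comp (by fun_prop)
  rw [multivariateGaussian, integral_map (by fun_prop) hg.aestronglyMeasurable,
    ← map_finTwo_stdGaussian, integral_map hm.aemeasurable hgR.aestronglyMeasurable]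
  refine integral_congr_ae (Eventually.of_forall fun z => ?_)
  simp only [zero_add]
  congr 1
  rw [plane_eq !₂[z.1, z.2], map_add, map_smul, map_smul]
  simp [comb]

variable {A B D : ℝ}

lemma posSemidef_of_quadratic_nonneg
    (h : ∀ c₁ c₂ : ℝ, 0 ≤ c₁ ^ 2 * A + 2 * c₁ * c₂ * B + c₂ ^ 2 * D) :
    (!![A, B; B, D] : Matrix (Fin 2) (Fin 2) ℝ).PosSemidef := by
  refine Matrix.PosSemidef.of_dotProduct_mulVec_nonneg ?_ fun c => ?_
  · ext i j
    fin_cases i <;> fin_cases j <;> simp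
  · have := h (c 0) (c 1)
    simp [Matrix.mulVec, dotProduct, Fin.sum_univ_two]
    linarith

/-- A square root of a positive semidefinite quadratic form represents the normal distribution,
and its columns span the vectors orthogonal to the degenerate directions. -/
theorem exists_gaussian_system (h : ∀ c₁ c₂ : ℝ, 0 ≤ c₁ ^ 2 * A + 2 * c₁ * c₂ * B + c₂ ^ 2 * D) :
    ∃ (r₁ r₂ : Plane) (C : ℝ), 0 ≤ C ∧
      (∀ g : Plane → ℝ, Continuous g →
        ∫ v, g v ∂multivariateGaussian 0 !![A, B; B, D] = ∫ z, g (comb r₁ r₂ z) ∂stdNormal₂) ∧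
      (∀ T : Plane →L[ℝ] Plane →L[ℝ] ℝ, T r₁ r₁ + T r₂ r₂ = A * T (basisVec 0) (basisVec 0) +
        B * (T (basisVec 0) (basisVec 1) + T (basisVec 1) (basisVec 0)) +
        D * T (basisVec 1) (basisVec 1)) ∧
      ∀ v : Plane, (∀ c₁ c₂ : ℝ, c₁ ^ 2 * A + 2 * c₁ * c₂ * B + c₂ ^ 2 * D = 0 →
        c₁ * v 0 + c₂ * v 1 = 0) → ∃ b, comb r₁ r₂ b = v ∧ |b.1| + |b.2| ≤ C * ‖v‖ := by
  have hS := posSemidef_of_quadratic_nonneg h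
  set S : Matrix (Fin 2) (Fin 2) ℝ := !![A, B; B, D] with hSdef
  set M := CFC.sqrt S with hM
  have hMM : M * M = S := CFC.sqrt_mul_sqrt_self S (Matrix.nonneg_iff_posSemidef.2 hS)
  have hMs : M.IsHermitian := (Matrix.nonneg_iff_posSemidef.1 (CFC.sqrt_nonneg S)).isHermitian
  set R := Matrix.toEuclideanCLM (𝕜 := ℝ) M with hR
  have h01 : M 1 0 = M 0 1 := by
    have := congrFun (congrFun hMs 0) 1
    simpa using this
  have hA : M 0 0 * M 0 0 + M 0 1 * M 0 1 = A := by
    have := congrFun (congrFun hMM 0) 0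
    simpa [Matrix.mul_apply, Fin.sum_univ_two, h01, hSdef] using this
  have hB : M 0 0 * M 0 1 + M 0 1 * M 1 1 = B := by
    have := congrFun (congrFun hMM 0) 1
    simpa [Matrix.mul_apply, Fin.sum_univ_two, h01, hSdef] using this
  have hD : M 0 1 * M 0 1 + M 1 1 * M 1 1 = D := by
    have := congrFun (congrFun hMM 1) 1
    simpa [Matrix.mul_apply, Fin.sum_univ_two, h01, hSdef] using this
  have hr0 : R (basisVec 0) = M 0 0 • basisVec 0 + M 0 1 • basisVec 1 := by
    ext i
    fin_cases i <;> simp [hR, Matrix.mulVec, dotProduct, h01]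
  have hr1 : R (basisVec 1) = M 0 1 • basisVec 0 + M 1 1 • basisVec 1 := by
    ext i
    fin_cases i <;> simp [hR, Matrix.mulVec, dotProduct]
  have hRcomb : ∀ b : Plane, comb (R (basisVec 0)) (R (basisVec 1)) (b 0, b 1) = R b := fun b => by
    conv_rhs => rw [plane_eq b, map_add, map_smul, map_smul]
    rfl
  have hsymm : (R : Plane →ₗ[ℝ] Plane).IsSymmetric := fun x y => by
    change inner ℝ (R x) y = inner ℝ x (R y)
    rw [← hRcomb x, ← hRcomb y, comb, comb, hr0, hr1]
    simp [PiLp.inner_apply, Fin.sum_univ_two]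
    ring
  -- A linear right inverse of R on its range gives coordinates b that are linear in v, hence
  -- bounded by a multiple of its norm.
  obtain ⟨G, hG⟩ := (R : Plane →ₗ[ℝ] Plane).rangeRestrict.exists_rightInverse_of_surjective
    (LinearMap.range_rangeRestrict _)
  set G' := LinearMap.toContinuousLinearMap G
  refine ⟨R (basisVec 0), R (basisVec 1), 2 * ‖G'‖, by positivity,
    fun g hg => integral_multivariateGaussian_eq S hg, fun T => ?_, fun v hv => ?_⟩
  · rw [hr0, hr1, ← hA, ← hB, ← hD]
    simp only [map_add, map_smul, add_apply, smul_apply,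
      smul_eq_mul]
    ring
  -- R is symmetric, so its range is the orthogonal complement of its kernel, and the quadratic form
  -- is |R c|², which vanishes on the kernel.
  · have hmem : v ∈ (R : Plane →ₗ[ℝ] Plane).range := by
      rw [← Submodule.orthogonal_orthogonal (R : Plane →ₗ[ℝ] Plane).range,
        hsymm.orthogonal_range, Submodule.mem_orthogonal]
      intro c hc
      have hc0 : R c = 0 := hc
      rw [← hRcomb, comb, hr0, hr1] at hc0
      have e0 := congrArg (fun w : Plane => w 0) hc0
      have e1 := congrArg (fun w : Plane => w 1) hc0
      simp at e0 e1
      have := hv (c 0) (c 1) (by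
        rw [← hA, ← hB, ← hD]
        linear_combination (c 0 * M 0 0 + c 1 * M 0 1) * e0 + (c 0 * M 0 1 + c 1 * M 1 1) * e1)
      simp [PiLp.inner_apply, Fin.sum_univ_two]
      linarith
    refine ⟨((G' ⟨v, hmem⟩) 0, (G' ⟨v, hmem⟩) 1), ?_, ?_⟩
    · rw [hRcomb]
      have := congrArg Subtype.val (LinearMap.congr_fun hG ⟨v, hmem⟩)
      exact this
    · have h1 : ‖G' ⟨v, hmem⟩‖ ≤ ‖G'‖ * ‖v‖ := G'.le_opNorm _
      have h2 : ∀ i, |(G' ⟨v, hmem⟩) i| ≤ ‖G' ⟨v, hmem⟩‖ := fun i =>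
        PiLp.norm_apply_le (G' ⟨v, hmem⟩) i
      linarith [h2 0, h2 1]

end SquareRoot

/-! ### Moments of the jumps under the mixture. -/

section MixtureEstimate

variable {θ : ℝ} {α β : ℕ → ℝ} {a b A B D : ℝ}

lemma HasPowerMean.exists_abel_mul {φ : ℕ → ℝ} {μ : ℝ} (h : HasPowerMean φ μ) (hθ : 0 < θ) :
    ∃ C, 0 ≤ C ∧ ∀ u : ℝ, 0 < u → u < 1 → Summable (fun m : ℕ => θ * u ^ m / m * φ m) ∧
      |∑' m : ℕ, θ * u ^ m / m * φ m - θ * -Real.log (1 - u) * μ| ≤ C := by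
  obtain ⟨C, hC0, hC⟩ := h.exists_abel
  have e : ∀ (u : ℝ) (m : ℕ), θ * u ^ m / m * φ m = θ * (u ^ m / m * φ m) := fun u m => by ring
  refine ⟨θ * C, by positivity, fun u hu hu1 => ⟨?_, ?_⟩⟩
  · simp only [e]
    exact (h.summable hu hu1).mul_left θ
  · simp only [e]
    rw [tsum_mul_left, mul_assoc, ← mul_sub, abs_mul, abs_of_pos hθ]
    exact mul_le_mul_of_nonneg_left (hC u hu hu1) hθ.le

/-- The sequence in the plane with given coordinates. -/
def planeSeq (α β : ℕ → ℝ) (m : ℕ) : Plane := !₂[α m, β m]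

lemma norm_planeSeq_sq (α β : ℕ → ℝ) (m : ℕ) : ‖planeSeq α β m‖ ^ 2 = α m ^ 2 + β m ^ 2 := by
  rw [EuclideanSpace.real_norm_sq_eq, Fin.sum_univ_two]
  simp [planeSeq]

lemma pow_le_one_add_pow {x : ℝ} (hx : 0 ≤ x) {k l : ℕ} (hkl : k ≤ l) : x ^ k ≤ 1 + x ^ l := by
  rcases le_total x 1 with h | h
  · have := pow_le_one₀ (n := k) hx h
    have := pow_nonneg hx l
    linarith
  · have := pow_le_pow_right₀ h hkl
    linarith

/-- Only even powers of the norm are polynomials in α and β; the k-th power is dominated by 1 plus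
the 2k-th. -/
lemma HasPairMeans.exists_moment_bound (h : HasPairMeans α β a b A B D) (k : ℕ) :
    ∃ C, ∀ N : ℕ, ∑ m ∈ Finset.Icc 1 N, ‖planeSeq α β m‖ ^ k ≤ C * N := by
  obtain ⟨μ, hμ⟩ := h.even_moments k
  obtain ⟨C, hC0, hC⟩ := hμ.exists_sum_le
  refine ⟨1 + C, fun N => ?_⟩
  calc ∑ m ∈ Finset.Icc 1 N, ‖planeSeq α β m‖ ^ k
      ≤ ∑ m ∈ Finset.Icc 1 N, (1 + (α m ^ 2 + β m ^ 2) ^ k) := by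
        refine Finset.sum_le_sum fun m _ => ?_
        rw [← norm_planeSeq_sq, ← pow_mul]
        exact pow_le_one_add_pow (norm_nonneg _) (by omega)
    _ = N + ∑ m ∈ Finset.Icc 1 N, (α m ^ 2 + β m ^ 2) ^ k := by
        rw [Finset.sum_add_distrib]
        simp
    _ ≤ _ := by
        have := (le_abs_self _).trans (hC N)
        linarith

/-- Powers up to the fourth are dominated by 1 plus the fourth, whose Abel sum is known up to O(1);
the lower bound 1 on -log (1 - u) absorbs this error. -/
lemma HasPairMeans.exists_mix_moment_bound (h : HasPairMeans α β a b A B D) (hθ : 0 < θ) :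
    ∃ C, 0 ≤ C ∧ ∀ u : ℝ, 0 < u → u < 1 → 1 ≤ -Real.log (1 - u) → ∀ k : ℕ, k ≤ 4 →
      Summable (fun m : ℕ => θ * u ^ m / m * ‖planeSeq α β m‖ ^ k) ∧
      ∑' m : ℕ, θ * u ^ m / m * ‖planeSeq α β m‖ ^ k ≤ C * -Real.log (1 - u) := by
  obtain ⟨μ, hμ⟩ := h.even_moments 2
  obtain ⟨C, hC0, hC⟩ := ((hasPowerMean_const 1).add hμ).exists_abel_mul hθ
  refine ⟨θ * (1 + μ) + C, ?_, fun u hu hu1 hlog k hk => ?_⟩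
  · have := hμ.nonneg fun m => by positivity
    positivity
  obtain ⟨hs, hb⟩ := hC u hu hu1
  have hle : ∀ m : ℕ, θ * u ^ m / m * ‖planeSeq α β m‖ ^ k ≤
      θ * u ^ m / m * (1 + (α m ^ 2 + β m ^ 2) ^ 2) := fun m => by
    rw [← norm_planeSeq_sq, ← pow_mul]
    gcongr
    exact pow_le_one_add_pow (norm_nonneg _) hk
  have hs' := Summable.of_nonneg_of_le (fun m => by positivity) hle hs
  refine ⟨hs', (hs'.tsum_le_tsum hle hs).trans ?_⟩
  have h1 := (abs_le.1 hb).2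
  nlinarith

lemma abs_apply_le_of_norm_le {T : Plane →L[ℝ] Plane →L[ℝ] ℝ} {K : ℝ} (hT : ‖T‖ ≤ K)
    (i j : Fin 2) : |T (basisVec i) (basisVec j)| ≤ K := by
  have h1 : ‖T (basisVec i) (basisVec j)‖ ≤ ‖T‖ * ‖basisVec i‖ * ‖basisVec j‖ :=
    T.le_opNorm₂ _ _
  have h2 : ∀ i : Fin 2, ‖basisVec i‖ = 1 := fun i => by simp
  rw [h2, h2, mul_one, mul_one] at h1
  exact h1.trans hT

lemma bilin_planeSeq (T : Plane →L[ℝ] Plane →L[ℝ] ℝ) (m : ℕ) :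
    T (planeSeq α β m) (planeSeq α β m) = α m ^ 2 * T (basisVec 0) (basisVec 0) +
      α m * β m * (T (basisVec 0) (basisVec 1) + T (basisVec 1) (basisVec 0)) +
      β m ^ 2 * T (basisVec 1) (basisVec 1) := by
  have h1 : planeSeq α β m = α m • basisVec 0 + β m • basisVec 1 := by
    simpa [planeSeq] using plane_eq (planeSeq α β m)
  rw [h1]
  simp only [map_add, map_smul, add_apply, smul_apply, smul_eq_mul]
  ring

/-- The second moments of the mixture approximate the covariance. -/
lemma HasPairMeans.exists_cov_bound (h : HasPairMeans α β a b A B D) (hθ : 0 < θ) :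
    ∃ C, 0 ≤ C ∧ ∀ u c : ℝ, 0 < u → u < 1 → c ^ 2 * -Real.log (1 - u) = 1 →
      ∀ (T : Plane →L[ℝ] Plane →L[ℝ] ℝ) (K : ℝ), ‖T‖ ≤ K →
      |∑' m : ℕ, θ * u ^ m / m * T (c • planeSeq α β m) (c • planeSeq α β m) -
        (θ * A * T (basisVec 0) (basisVec 0) +
          θ * B * (T (basisVec 0) (basisVec 1) + T (basisVec 1) (basisVec 0)) +
          θ * D * T (basisVec 1) (basisVec 1))| ≤ K * (c ^ 2 * C) := by
  obtain ⟨C₁, hC₁0, hC₁⟩ := h.fst_sq.exists_abel_mul hθ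
  obtain ⟨C₂, hC₂0, hC₂⟩ := h.mul.exists_abel_mul hθ
  obtain ⟨C₃, hC₃0, hC₃⟩ := h.snd_sq.exists_abel_mul hθ
  refine ⟨C₁ + 2 * C₂ + C₃, by positivity, fun u c hu hu1 hc T K hT => ?_⟩
  obtain ⟨s₁, b₁⟩ := hC₁ u hu hu1
  obtain ⟨s₂, b₂⟩ := hC₂ u hu hu1
  obtain ⟨s₃, b₃⟩ := hC₃ u hu hu1
  set T₁ := T (basisVec 0) (basisVec 0) with hT₁
  set T₂ := T (basisVec 0) (basisVec 1) + T (basisVec 1) (basisVec 0) with hT₂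
  set T₃ := T (basisVec 1) (basisVec 1) with hT₃
  have e : ∀ m : ℕ, θ * u ^ m / m * T (c • planeSeq α β m) (c • planeSeq α β m) =
      c ^ 2 * T₁ * (θ * u ^ m / m * α m ^ 2) + c ^ 2 * T₂ * (θ * u ^ m / m * (α m * β m)) +
        c ^ 2 * T₃ * (θ * u ^ m / m * β m ^ 2) := fun m => by
    simp only [map_smul, smul_apply, smul_eq_mul]
    rw [bilin_planeSeq]
    ring
  rw [tsum_congr e, ((s₁.mul_left _).add (s₂.mul_left _)).tsum_add (s₃.mul_left _),
    (s₁.mul_left _).tsum_add (s₂.mul_left _), tsum_mul_left, tsum_mul_left, tsum_mul_left]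
  set S₁ := ∑' m : ℕ, θ * u ^ m / m * α m ^ 2
  set S₂ := ∑' m : ℕ, θ * u ^ m / m * (α m * β m)
  set S₃ := ∑' m : ℕ, θ * u ^ m / m * β m ^ 2
  set l := -Real.log (1 - u)
  have e2 : c ^ 2 * T₁ * S₁ + c ^ 2 * T₂ * S₂ + c ^ 2 * T₃ * S₃ -
      (θ * A * T₁ + θ * B * T₂ + θ * D * T₃) =
      c ^ 2 * (T₁ * (S₁ - θ * l * A)) + c ^ 2 * (T₂ * (S₂ - θ * l * B)) +
        c ^ 2 * (T₃ * (S₃ - θ * l * D)) := by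
    linear_combination (-(θ * A * T₁ + θ * B * T₂ + θ * D * T₃)) * (-hc)
  have hK1 : |T₁| ≤ K := abs_apply_le_of_norm_le hT 0 0
  have hK3 : |T₃| ≤ K := abs_apply_le_of_norm_le hT 1 1
  have hK2 : |T₂| ≤ 2 * K := by
    have h1 := abs_apply_le_of_norm_le hT 0 1
    have h2 := abs_apply_le_of_norm_le hT 1 0
    exact (abs_add_le _ _).trans (by linarith)
  have hK0 : 0 ≤ K := (abs_nonneg _).trans hK1
  have bd : ∀ {x y X Y : ℝ}, |x| ≤ X → |y| ≤ Y → |c ^ 2 * (x * y)| ≤ c ^ 2 * (X * Y) :=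
    fun {x y X Y} hx hy => by
      rw [abs_mul, abs_mul, abs_of_nonneg (sq_nonneg c)]
      have := (abs_nonneg _).trans hx
      gcongr
  rw [e2]
  refine (abs_add_le _ _).trans ((add_le_add (abs_add_le _ _) le_rfl).trans ?_)
  refine (add_le_add (add_le_add (bd hK1 b₁) (bd hK2 b₂)) (bd hK3 b₃)).trans_eq ?_
  ring

/-- The centring of the mixture approximates the mean. -/
lemma HasPairMeans.exists_center_bound (h : HasPairMeans α β a b A B D) (hθ : 0 < θ) :
    ∃ C, 0 ≤ C ∧ ∀ u : ℝ, 0 < u → u < 1 → 1 ≤ -Real.log (1 - u) →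
      ‖∑' m : ℕ, (θ * u ^ m / m) • planeSeq α β m -
        (θ * -Real.log (1 - u)) • (!₂[a, b] : Plane)‖ ≤ C := by
  obtain ⟨C₁, hC₁0, hC₁⟩ := h.fst.exists_abel_mul hθ
  obtain ⟨C₂, hC₂0, hC₂⟩ := h.snd.exists_abel_mul hθ
  obtain ⟨C₃, hC₃0, hC₃⟩ := h.exists_mix_moment_bound hθ
  refine ⟨C₁ + C₂, by positivity, fun u hu hu1 hl => ?_⟩
  have hs : Summable fun m : ℕ => (θ * u ^ m / m) • planeSeq α β m := by
    refine Summable.of_norm_bounded (hC₃ u hu hu1 hl 1 (by norm_num)).1 fun m => ?_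
    rw [norm_smul, pow_one, Real.norm_of_nonneg (by positivity)]
  set v := ∑' m : ℕ, (θ * u ^ m / m) • planeSeq α β m -
        (θ * -Real.log (1 - u)) • (!₂[a, b] : Plane) with hv
  have hv0 : v 0 = ∑' m : ℕ, θ * u ^ m / m * α m - θ * -Real.log (1 - u) * a := by
    have := (EuclideanSpace.proj (𝕜 := ℝ) (0 : Fin 2) : Plane →L[ℝ] ℝ).map_tsum hs
    change (∑' m : ℕ, (θ * u ^ m / m) • planeSeq α β m) 0 =
      ∑' m : ℕ, ((θ * u ^ m / m) • planeSeq α β m) 0 at this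
    rw [hv, PiLp.sub_apply, this]
    simp [planeSeq]
  have hv1 : v 1 = ∑' m : ℕ, θ * u ^ m / m * β m - θ * -Real.log (1 - u) * b := by
    have := (EuclideanSpace.proj (𝕜 := ℝ) (1 : Fin 2) : Plane →L[ℝ] ℝ).map_tsum hs
    change (∑' m : ℕ, (θ * u ^ m / m) • planeSeq α β m) 1 =
      ∑' m : ℕ, ((θ * u ^ m / m) • planeSeq α β m) 1 at this
    rw [hv, PiLp.sub_apply, this]
    simp [planeSeq]
  have b₁ := (hC₁ u hu hu1).2
  have b₂ := (hC₂ u hu hu1).2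
  rw [← hv0] at b₁
  rw [← hv1] at b₂
  calc ‖v‖ = ‖v 0 • basisVec 0 + v 1 • basisVec 1‖ := by rw [← plane_eq v]
    _ ≤ |v 0| + |v 1| := by
        refine (norm_add_le _ _).trans ?_
        simp [norm_smul]
    _ ≤ _ := add_le_add b₁ b₂

end MixtureEstimate

/-! ### Normal approximation for the mixture and for the Ewens measure. -/

section EwensEstimate

variable {θ : ℝ} {α β : ℕ → ℝ} {a b A B D : ℝ}

/-- The normal approximation under the geometric mixture of the Ewens measures. -/
theorem HasPairMeans.exists_mixture_bound (h : HasPairMeans α β a b A B D) (hθ : 0 < θ)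
    (K₁ K₂ : ℝ) :
    ∃ C, ∀ u c : ℝ, 0 < u → u < 1 → 1 ≤ -Real.log (1 - u) → 0 < c →
      c ^ 2 * -Real.log (1 - u) = 1 → ∀ g : Plane → ℝ, HasBoundedDerivs g K₁ K₂ →
      |mixMean θ u (fun s => g (c • ((s.map (planeSeq α β)).sum -
          ∑' m : ℕ, (θ * u ^ m / m) • planeSeq α β m))) -
        ∫ v, g v ∂multivariateGaussian 0 !![θ * A, θ * B; θ * B, θ * D]| ≤ C * c := by
  obtain ⟨E, hE⟩ := h.degenerate
  have hquad := hasPowerMean_quadratic h.fst_sq h.mul h.snd_sq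
  have hnn : ∀ c₁ c₂ : ℝ, 0 ≤ c₁ ^ 2 * (θ * A) + 2 * c₁ * c₂ * (θ * B) + c₂ ^ 2 * (θ * D) :=
    fun c₁ c₂ => by
      have := mul_nonneg hθ.le ((hquad c₁ c₂).nonneg fun m => sq_nonneg _)
      linarith
  obtain ⟨r₁, r₂, C₁, hC₁0, hgauss, hcov, hrange⟩ := exists_gaussian_system hnn
  obtain ⟨C₂, hC₂0, hC₂⟩ := h.exists_cov_bound hθ
  obtain ⟨C₃, hC₃0, hC₃⟩ := h.exists_mix_moment_bound hθ
  have hsc := shiftConst_nonneg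
  set v := planeSeq α β with hv
  set S := ∑ m ∈ E, θ * (2 * ‖v m‖ ^ 2) with hS
  have hS0 : 0 ≤ S := Finset.sum_nonneg fun m _ => by positivity
  refine ⟨Real.pi / 2 * (K₂ * (C₂ + (shiftConst * C₁ * C₃ + S))), ?_⟩
  intro u c hu hu1 hl hc hcl g hg
  set lam : ℕ → ℝ := fun m => θ * u ^ m / m with hlam
  have hlam0 : ∀ m, 0 ≤ lam m := fun m => by positivity
  set κ := ∑' m : ℕ, (θ * u ^ m / m) • v m with hκ
  set X : Multiset ℕ → Plane := fun s => c • ((s.map v).sum - κ) with hX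
  have hs1 : Summable fun m : ℕ => θ * u ^ m / m * ‖v m‖ := by
    simpa using (hC₃ u hu hu1 hl 1 (by norm_num)).1
  have hs2 := (hC₃ u hu hu1 hl 2 (by norm_num)).1
  obtain ⟨hs3, hb3⟩ := hC₃ u hu hu1 hl 3 (by norm_num)
  obtain ⟨hint, hstein⟩ := mixMeasure_stein hθ hu hu1 hs1 c (X := X) fun s => rfl
  have := isProbabilityMeasure_mixMeasure hθ hu hu1 X
  have hsum := mixSummable_sum hθ hu hu1 hs1
  have hK₁ := hg.nonneg₁
  have hK₂ : 0 ≤ K₂ := (ContinuousLinearMap.opNorm_nonneg _).trans (hg.norm_fderiv_fderiv_le 0)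
  have hgX : MixSummable θ u fun s => g (X s) := by
    have h1 : MixSummable θ u fun s => K₁ * c * ‖(s.map v).sum‖ + (|g 0| + K₁ * c * ‖κ‖) :=
      (hsum.const_mul (K₁ * c)).add
        (mixSummable_of_bounded hθ hu hu1 (c := abs (|g 0| + K₁ * c * ‖κ‖)) fun _ => le_rfl) hθ hu
    refine h1.mono hθ hu fun s => le_trans ?_ (le_abs_self _)
    have h2 := hg.abs_sub_le (X s) 0
    rw [sub_zero] at h2
    have h3 : ‖X s‖ ≤ c * (‖(s.map v).sum‖ + ‖κ‖) := by
      rw [hX, norm_smul, Real.norm_of_nonneg hc.le]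
      gcongr
      exact norm_sub_le _ _
    have h4 : K₁ * ‖X s‖ ≤ K₁ * (c * (‖(s.map v).sum‖ + ‖κ‖)) := by gcongr
    have h5 := abs_sub_abs_le_abs_sub (g (X s)) (g 0)
    linarith
  have hmean := integral_mixMeasure hθ hu hu1 hgX
  have hnorm : ∀ m, ‖c • v m‖ = c * ‖v m‖ := fun m => by
    rw [norm_smul, Real.norm_of_nonneg hc.le]
  -- The jump error is of third order in c for generic m and of second order for the exceptional m,
  -- whose jumps may leave the range of the covariance. The index 0 is adjoined because degeneracy
  -- is known for m ≥ 1 only; it costs nothing since lam 0 = 0.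
  set e : ℕ → ℝ := fun m => c ^ 3 * (shiftConst * C₁) * ‖v m‖ ^ 3 +
    c ^ 2 * (if m ∈ insert 0 E then 2 * ‖v m‖ ^ 2 else 0) with he
  have hterm : ∀ m : ℕ, lam m * e m = c ^ 3 * (shiftConst * C₁) * (lam m * ‖v m‖ ^ 3) +
      c ^ 2 * (lam m * if m ∈ insert 0 E then 2 * ‖v m‖ ^ 2 else 0) := fun m => by
    simp only [he]
    ring
  have hfin : ∀ m ∉ insert 0 E, (lam m * if m ∈ insert 0 E then 2 * ‖v m‖ ^ 2 else 0) = 0 :=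
    fun m hm => by rw [if_neg hm, mul_zero]
  have hse' : Summable fun m : ℕ => lam m * if m ∈ insert 0 E then 2 * ‖v m‖ ^ 2 else 0 :=
    summable_of_ne_finset_zero hfin
  have hse : Summable fun m : ℕ => lam m * e m := by
    simp only [hterm]
    exact (hs3.mul_left _).add (hse'.mul_left _)
  have hfinle : ∑' m : ℕ, (lam m * if m ∈ insert 0 E then 2 * ‖v m‖ ^ 2 else 0) ≤ S := by
    rw [tsum_eq_sum hfin]
    have hz : lam 0 = 0 := by simp [hlam]
    calc _ = ∑ m ∈ insert 0 E, lam m * (2 * ‖v m‖ ^ 2) :=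
          Finset.sum_congr rfl fun m hm => by rw [if_pos hm]
      _ = ∑ m ∈ E, lam m * (2 * ‖v m‖ ^ 2) :=
          Finset.sum_insert_of_eq_zero_if_notMem fun _ => by rw [hz, zero_mul]
      _ ≤ S := by
          refine Finset.sum_le_sum fun m _ => ?_
          gcongr
          rcases Nat.eq_zero_or_pos m with rfl | hm
          · rw [hz]
            exact hθ.le
          · have hm1 : (1 : ℝ) ≤ m := by exact_mod_cast hm
            simp only [hlam]
            rw [div_le_iff₀ (by linarith)]
            gcongr
            exact (pow_le_one₀ hu.le hu1.le).trans hm1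
  -- The third moments sum to O(-log (1 - u)) = O(c^(-2)), which leaves one power of c: this is the
  -- rate.
  have hesum : ∑' m : ℕ, lam m * e m ≤ c * (shiftConst * C₁ * C₃) + c ^ 2 * S := by
    rw [tsum_congr hterm, (hs3.mul_left _).tsum_add (hse'.mul_left _), tsum_mul_left,
      tsum_mul_left]
    refine add_le_add ?_ (mul_le_mul_of_nonneg_left hfinle (sq_nonneg c))
    calc c ^ 3 * (shiftConst * C₁) * ∑' m : ℕ, lam m * ‖v m‖ ^ 3
        ≤ c ^ 3 * (shiftConst * C₁) * (C₃ * -Real.log (1 - u)) := by gcongr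
      _ = c * (shiftConst * C₁ * C₃) * (c ^ 2 * -Real.log (1 - u)) := by ring
      _ = _ := by rw [hcl, mul_one]
  have key := abs_integral_sub_gaussian_le (r₁ := r₁) (r₂ := r₂) (e := e) (Δ := c ^ 2 * C₂) hint
    hlam0 hstein (fun m => ?_) ?_ ?_ hse hg (fun T hT => ?_)
  · rw [hmean, ← hgauss g hg.contDiff.continuous] at key
    refine key.trans ?_
    have hc1 : c ^ 2 ≤ c := by
      have h1 : c ^ 2 ≤ 1 := by
        rw [← hcl]
        exact le_mul_of_one_le_right (sq_nonneg c) hl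
      nlinarith
    have h2 : c ^ 2 * C₂ + ∑' m : ℕ, lam m * e m ≤
        (C₂ + (shiftConst * C₁ * C₃ + S)) * c := by
      have h3 : c ^ 2 * C₂ ≤ c * C₂ := by gcongr
      have h4 : c ^ 2 * S ≤ c * S := by gcongr
      linarith
    calc _ ≤ Real.pi / 2 * (K₂ * ((C₂ + (shiftConst * C₁ * C₃ + S)) * c)) := by gcongr
      _ = _ := by ring
  · by_cases hm : m ∈ insert 0 E
    · right
      rw [hnorm]
      simp only [he, if_pos hm]
      have : 0 ≤ c ^ 3 * (shiftConst * C₁) * ‖v m‖ ^ 3 := by positivity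
      linarith [show 2 * (c * ‖v m‖ * (c * ‖v m‖)) = c ^ 2 * (2 * ‖v m‖ ^ 2) by ring]
    · left
      rw [Finset.mem_insert, not_or] at hm
      obtain ⟨z, hz, hzle⟩ := hrange (v m) fun c₁ c₂ h0 => by
        have := hE m (Nat.one_le_iff_ne_zero.2 hm.1) hm.2 c₁ c₂ (by
          have h1 : θ * (c₁ ^ 2 * A + 2 * c₁ * c₂ * B + c₂ ^ 2 * D) = 0 := by
            rw [← h0]
            ring
          exact (mul_eq_zero.1 h1).resolve_left hθ.ne')
        simpa [hv, planeSeq] using this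
      refine ⟨(c * z.1, c * z.2), ?_, ?_⟩
      · rw [← hz, comb, comb, smul_add, smul_smul, smul_smul]
      · rw [hnorm]
        simp only [he, Finset.mem_insert, hm, or_self, if_false, mul_zero, add_zero]
        rw [abs_mul, abs_mul, abs_of_pos hc]
        calc shiftConst * (c * ‖v m‖ * (c * ‖v m‖) * (c * |z.1| + c * |z.2|))
            = shiftConst * (c ^ 3 * ‖v m‖ ^ 2 * (|z.1| + |z.2|)) := by ring
          _ ≤ shiftConst * (c ^ 3 * ‖v m‖ ^ 2 * (C₁ * ‖v m‖)) := by gcongr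
          _ = _ := by ring
  · refine (hs1.mul_left c).congr fun m => ?_
    rw [hnorm]
    ring
  · refine (hs2.mul_left (c ^ 2)).congr fun m => ?_
    rw [hnorm]
    ring
  · rw [hcov]
    exact hC₂ u c hu hu1 hcl T K₂ hT

/-- The normal approximation under the Ewens measures. -/
theorem HasPairMeans.exists_ewens_bound (h : HasPairMeans α β a b A B D) (hθ : 0 < θ)
    (K₁ K₂ : ℝ) :
    ∃ C, ∀ n : ℕ, 3 ≤ n → ∀ g : Plane → ℝ, HasBoundedDerivs g K₁ K₂ →
      |(ewensMass θ n)⁻¹ * ewensSum θ n (fun s => g ((√(Real.log n))⁻¹ •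
          (s.map (planeSeq α β)).sum - (θ * √(Real.log n)) • (!₂[a, b] : Plane))) -
        ∫ v, g v ∂multivariateGaussian 0 !![θ * A, θ * B; θ * B, θ * D]| ≤
          C / √(Real.log n) := by
  obtain ⟨C₁, hC₁⟩ := h.exists_mixture_bound hθ K₁ K₂
  obtain ⟨C₂, hC₂0, hC₂⟩ := h.exists_center_bound hθ
  obtain ⟨J, hJ0, hJ⟩ := exists_sum_ewensMass_mul_le hθ
    (b := fun m => ‖planeSeq α β m‖) (fun m => norm_nonneg _) h.exists_moment_bound
  -- Three errors: normal approximation of the mixture, mixture against Ewens measure, and centring.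
  refine ⟨C₁ + K₁ * J * (3 + θ + 2 * θ ^ 2) + K₁ * C₂, fun n hn g hg => ?_⟩
  have hn3 : (3 : ℝ) ≤ n := by exact_mod_cast hn
  have hlog1 : 1 ≤ Real.log n := by
    rw [Real.le_log_iff_exp_le (by linarith)]
    linarith [Real.exp_one_lt_d9]
  set l := Real.log n with hl
  set v := planeSeq α β with hv
  set u : ℝ := 1 - 1 / (n : ℝ) with hu
  have hn1 : 1 / (n : ℝ) ≤ 1 / 3 := by gcongr
  have hn0 : 0 < 1 / (n : ℝ) := by positivity
  have hu0 : 0 < u := by linarith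
  have hu1 : u < 1 := by linarith
  have hlu : -Real.log (1 - u) = l := by
    rw [hu, sub_sub_cancel, one_div, Real.log_inv, neg_neg]
  have hsq : √l ^ 2 = l := Real.sq_sqrt (by linarith)
  have hs0 : 0 < √l := Real.sqrt_pos.2 (by linarith)
  set c := (√l)⁻¹ with hc
  have hc0 : 0 < c := inv_pos.2 hs0
  have hcl : c ^ 2 * -Real.log (1 - u) = 1 := by
    rw [hlu, hc, inv_pow, hsq, inv_mul_cancel₀ (by linarith)]
  have hK₁ := hg.nonneg₁
  set κ := ∑' m : ℕ, (θ * u ^ m / m) • v m with hκ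
  set G : Multiset ℕ → ℝ := fun s => g (c • ((s.map v).sum - κ)) with hG
  set G' : Multiset ℕ → ℝ := fun s =>
    g (c • (s.map v).sum - (θ * √l) • (!₂[a, b] : Plane)) with hG'
  have h1 := hC₁ u c hu0 hu1 (by rw [hlu]; exact hlog1) hc0 hcl g hg
  -- A cycle of length m moves G by at most K₁ c times the norm of its jump, so this comparison
  -- gains the factor c.
  have h2 := (abs_mix_sub_le (G := G) (K := K₁ * c) hθ hJ0 (by positivity) hJ (fun m s => by
    refine (hg.abs_sub_le _ _).trans_eq ?_
    rw [← smul_sub, sub_sub_sub_cancel_right, Multiset.map_cons, Multiset.sum_cons,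
      add_sub_cancel_right, norm_smul, Real.norm_of_nonneg hc0.le, mul_assoc])
    (by omega : 2 ≤ n) hu).2
  -- The centring κ of the mixture and θ log n times the mean differ by O(1), which the scaling
  -- reduces to O(c).
  have hdiff : ∀ s, |G' s - G s| ≤ K₁ * (c * C₂) := fun s => by
    refine (hg.abs_sub_le _ _).trans ?_
    have e : c • (s.map v).sum - (θ * √l) • (!₂[a, b] : Plane) - c • ((s.map v).sum - κ) =
        c • (κ - (θ * -Real.log (1 - u)) • (!₂[a, b] : Plane)) := by
      have e1 : θ * √l = c * (θ * -Real.log (1 - u)) := by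
        rw [hlu, hc, ← hsq]
        field_simp
        rw [Real.sqrt_sq hs0.le]
      rw [e1, smul_sub, smul_sub, smul_smul]
      abel
    rw [e, norm_smul, Real.norm_of_nonneg hc0.le]
    gcongr
    exact hC₂ u hu0 hu1 (by rw [hlu]; exact hlog1)
  have hmass := ewensMass_pos hθ n
  have h3 : |(ewensMass θ n)⁻¹ * ewensSum θ n G' - (ewensMass θ n)⁻¹ * ewensSum θ n G| ≤
      K₁ * (c * C₂) := by
    have e : ewensSum θ n G' - ewensSum θ n G = ewensSum θ n fun s => G' s - G s := by
      simp [ewensSum, mul_sub, Finset.sum_sub_distrib]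
    rw [← mul_sub, e, abs_mul, abs_of_pos (inv_pos.2 hmass), inv_mul_le_iff₀ hmass]
    refine (abs_ewensSum_le hθ n _).trans ((ewensSum_mono hθ n hdiff).trans_eq ?_)
    have := ewensSum_const_mul (θ := θ) n (K₁ * (c * C₂)) fun _ => 1
    simp only [mul_one] at this
    rw [this, ewensSum_one, mul_comm]
  set I := ∫ v, g v ∂multivariateGaussian 0 !![θ * A, θ * B; θ * B, θ * D]
  rw [div_eq_mul_inv, ← hc]
  have h4 := abs_le.1 h1
  have h5 := abs_le.1 h2
  have h6 := abs_le.1 h3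
  rw [mixMean] at h4
  rw [abs_le]
  constructor <;> linarith [h4.1, h4.2, h5.1, h5.2, h6.1, h6.2]

end EwensEstimate

/-! ### Operator norms from bounds on partial derivatives. -/

section TestFunctions

lemma norm_iteratedFDeriv_apply_le {d k : ℕ} {g : EuclideanSpace ℝ (Fin d) → ℝ}
    (hg : partialSup k g ≤ 1) (u : EuclideanSpace ℝ (Fin d)) (i : Fin k → Fin d) :
    ‖iteratedFDeriv ℝ k g u (fun j => EuclideanSpace.single (i j) 1)‖ ≤ 1 := by
  have h : ‖iteratedFDeriv ℝ k g u (fun j => EuclideanSpace.single (i j) 1)‖ₑ ≤ 1 :=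
    (le_iSup₂ (f := fun (u : EuclideanSpace ℝ (Fin d)) (i : Fin k → Fin d) =>
      ‖iteratedFDeriv ℝ k g u (fun j => EuclideanSpace.single (i j) 1)‖ₑ) u i).trans hg
  rwa [← ofReal_norm, ENNReal.ofReal_le_one] at h

/-- Each coordinate is at most the norm, so the two coordinates cost a factor 2 per derivative. -/
lemma hasBoundedDerivs_of_mem_testFunctions {g : Plane → ℝ} (hg : g ∈ testFunctions 2) :
    HasBoundedDerivs g 2 4 := by
  obtain ⟨hc, h1, h2⟩ := hg
  have hd1 : ∀ v i, ‖fderiv ℝ g v (basisVec i)‖ ≤ 1 := fun v i => by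
    have := norm_iteratedFDeriv_apply_le h1 v fun _ => i
    rwa [iteratedFDeriv_one_apply] at this
  have hd2 : ∀ v i j, ‖fderiv ℝ (fderiv ℝ g) v (basisVec i) (basisVec j)‖ ≤ 1 := fun v i j => by
    have := norm_iteratedFDeriv_apply_le h2 v ![i, j]
    rwa [iteratedFDeriv_two_apply] at this
  have hlin : ∀ (l : Plane →L[ℝ] ℝ) (C : ℝ), 0 ≤ C → (∀ i, ‖l (basisVec i)‖ ≤ C) →
      ∀ w, ‖l w‖ ≤ 2 * C * ‖w‖ := fun l C hC hl w => by
    have hw : ∀ i, ‖w i‖ ≤ ‖w‖ := fun i => PiLp.norm_apply_le w i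
    conv_lhs => rw [plane_eq w]
    rw [map_add, map_smul, map_smul]
    calc _ ≤ ‖w 0‖ * ‖l (basisVec 0)‖ + ‖w 1‖ * ‖l (basisVec 1)‖ := by
          refine (norm_add_le _ _).trans ?_
          rw [norm_smul, norm_smul]
      _ ≤ ‖w‖ * C + ‖w‖ * C := by
          gcongr
          · exact hw 0
          · exact hl 0
          · exact hw 1
          · exact hl 1
      _ = _ := by ring
  refine ⟨contDiff_infty.1 hc 2, fun v => ?_, fun v => ?_⟩
  · exact ContinuousLinearMap.opNorm_le_bound _ (by norm_num) fun w => by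
      simpa using hlin (fderiv ℝ g v) 1 zero_le_one (hd1 v) w
  · refine ContinuousLinearMap.opNorm_le_bound₂ _ (by norm_num) fun w w' => ?_
    have h3 : ∀ j, ‖fderiv ℝ (fderiv ℝ g) v w (basisVec j)‖ ≤ 2 * ‖w‖ := fun j => by
      have := hlin ((fderiv ℝ (fderiv ℝ g) v).flip (basisVec j)) 1 zero_le_one
        (fun i => by simpa using hd2 v i j) w
      simpa using this
    refine (hlin (fderiv ℝ (fderiv ℝ g) v w) (2 * ‖w‖) (by positivity) h3 w').trans_eq ?_
    ring

end TestFunctions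

/-! ### From complex random variables to the plane. -/

section Rescaling

lemma toPlane_rescaled {f : Circle → ℂ} {x : Circle} (θ : ℝ) {a b : ℝ}
    (ha : (mahler f x).re = a) (hb : (mahler f x).im = b) {n : ℕ} (σ : Equiv.Perm (Fin n)) :
    toPlane (rescaled θ f x n σ) = (√(Real.log n))⁻¹ •
      (σ.partition.parts.map (planeSeq (fun m => (Complex.log (f (x ^ m))).re)
        fun m => (Complex.log (f (x ^ m))).im)).sum - (θ * √(Real.log n)) • (!₂[a, b] : Plane) := by
  have hsum : (σ.partition.parts.map (planeSeq (fun m => (Complex.log (f (x ^ m))).re)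
      fun m => (Complex.log (f (x ^ m))).im)).sum = toPlane (logClassFun f x σ) := by
    have hI : Finset.Icc 1 (Fintype.card (Fin n)) = Finset.Icc 1 n := by rw [Fintype.card_fin]
    rw [sum_map_eq_sum_count, hI]
    ext i
    fin_cases i <;> simp [toPlane, logClassFun, planeSeq, cycleCount]
  rw [hsum, rescaled]
  ext i
  fin_cases i
  · simp [toPlane, Complex.div_ofReal_re, ha, inv_mul_eq_div]
  · simp [toPlane, Complex.div_ofReal_im, hb, inv_mul_eq_div]

lemma limitCov_eq (θ : ℝ) (f : Circle → ℂ) (x : Circle) : limitCov θ f x =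
    !![θ * powerMean x (fun z => (Complex.log (f z)).re ^ 2),
        θ * powerMean x (fun z => (Complex.log (f z)).re * (Complex.log (f z)).im);
      θ * powerMean x (fun z => (Complex.log (f z)).re * (Complex.log (f z)).im),
        θ * powerMean x (fun z => (Complex.log (f z)).im ^ 2)] := by
  ext i j
  fin_cases i <;> fin_cases j <;> simp [limitCov]

end Rescaling

end EwensCLT

end

theorem mainTheorem4 (θ : ℝ) (hθ : 0 < θ) (f : Circle → ℂ) (hf : EwensCLT.IsRealAnalytic f)
    (x : Circle)
    (hx : (¬ IsOfFinOrder x ∧ EwensCLT.IsFiniteType x ∧ ∀ z : Circle, f z = 0 → IsOfFinOrder z) ∨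
      (IsOfFinOrder x ∧ ∀ m ∈ Finset.Icc 1 (orderOf x), f (x ^ m) ≠ 0))
    {Ω : Type*} [MeasurableSpace Ω] (P : Measure Ω) (N : Ω → ℂ)
    (hN : EwensCLT.IsCenteredComplexNormal N P (EwensCLT.limitCov θ f x)) :
    ∃ C : ℝ, ∀ᶠ n : ℕ in atTop,
      EwensCLT.weakWasserstein (fun ω => EwensCLT.toPlane (N ω)) P
          (fun σ => EwensCLT.toPlane (EwensCLT.rescaled θ f x n σ)) (EwensCLT.ewensMeasure θ n)
        ≤ ENNReal.ofReal (C / √(Real.log n)) := by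
  have hx' := hx.imp_right And.left
  obtain ⟨ha, hb⟩ := EwensCLT.mahler_eq hf hx'
  obtain ⟨C, hC⟩ := (EwensCLT.hasPairMeans_log hf hx').exists_ewens_bound hθ 2 4
  -- C depends on g only through the derivative bounds 2 and 4, so it is uniform over the test
  -- functions; n ≥ 3 ensures log n ≥ 1.
  refine ⟨C, (eventually_ge_atTop 3).mono fun n hn => iSup₂_le fun g hg => ?_⟩
  refine ENNReal.ofReal_le_ofReal ?_
  have hbd := EwensCLT.hasBoundedDerivs_of_mem_testFunctions hg
  have h1 : ∫ ω, g (EwensCLT.toPlane (N ω)) ∂P =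
      ∫ v, g v ∂multivariateGaussian 0 (EwensCLT.limitCov θ f x) :=
    hN.integral_comp hbd.contDiff.continuous.aestronglyMeasurable
  rw [h1, EwensCLT.limitCov_eq, abs_sub_comm]
  simp only [EwensCLT.toPlane_rescaled θ ha hb]
  rw [EwensCLT.integral_ewensMeasure hθ n fun s => g ((√(Real.log n))⁻¹ •
    (s.map (EwensCLT.planeSeq (fun m => (Complex.log (f (x ^ m))).re)
      fun m => (Complex.log (f (x ^ m))).im)).sum - (θ * √(Real.log n)) •
        (!₂[EwensCLT.powerMean x fun z => (Complex.log (f z)).re,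
          EwensCLT.powerMean x fun z => (Complex.log (f z)).im] : EwensCLT.Plane))]
  exact hC n hn g hbd
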